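/- **Model.** Let $h$ be an integrable real random variable whose law $\nu$ is symmetric about $0$, and let $\theta_1>0$. For $S\subset[n]$ with $|S|=k$, an observation of the planted random field Curie–Weiss model with clique $S$ is a vector $\sigma\in\{-1,1\}^n$ generated as follows: $h_1,\dots,h_n$ are i.i.d. copies of $h$ and, given $h_1,\dots,h_n$, $$\mathbb P_S(\sigma\mid h_1,\dots,h_n)\ \propto\ \exp\Big(\frac{\theta_1}{2k}\Big(\sum_{i\in S}\sigma_i\Big)^2+\sum_{i=1}^n h_i\sigma_i\Big).$$ We observe $m$ i.i.d. such vectors $\sigma^{(1)},\dots,\sigma^{(m)}$ (with a fresh field for each). Put $H(x)=\frac{x^2}{2}-\mathbb E[\log\cosh(\sqrt{\theta_1}\,x+h)]$. The temperature is * *high* if $\theta_1\mathbb E[\operatorname{sech}^2 h]<1$ and $0$ is the unique global minimizer of $H$; * *critical with flatness $\tau\in\mathbb N$* if $\theta_1\mathbb E[\operatorname{sech}^2h]=1$, $0$ is the unique global minimizer of $H$, and $H(x)=H(0)+\frac{H^{(2\tau)}(0)}{(2\tau)!}x^{2\tau}+O(x^{2\tau+1})$ as $x\to0$ with $H^{(2\tau)}(0)>0$;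 in this case we also assume that $h$ is not almost surely $0$; * *low* if $\theta_1\mathbb E[\operatorname{sech}^2h]>1$, or $\theta_1\mathbb E[\operatorname{sech}^2h]=1$ and $0$ is not a global minimizer of $H$. **Screening.** Let $a_k=1$, $a_k=k^{\frac{2\tau-2}{2\tau-1}}$, $a_k=k$ and $r_k=k$, $r_k=k^{\frac1{2\tau-1}}$, $r_k=1$ at high, critical and low temperature respectively. Given a set $S'\subset[n]$ and a threshold $t$, the screening step computes, for every $i\in[n]$, $$\phi_i=\frac1{m\,a_k}\sum_{j=1}^m\sigma^{(j)}_i\sum_{l\in S'\setminus\{i\}}\sigma^{(j)}_l ,\qquad\text{and returns}\qquad S''=\{i\in[n]:\phi_i\ge t\}.$$ **Theorem.** At each of the high, critical and low temperatures the following holds. Let $\phi_i^\circ$ be the score $\phi_i$ computed with $S'=S$. 1. There is $\mu>0$ such that, for all sufficiently large $k$, $\mathbb E[\phi_i^\circ]\ge\mu$ for all $n$, all $S\subset[n]$ with $|S|=k$ and all $i\in S$. 2. For every $\mu$ as in 1 and every $t\in(0,\mu)$ there is a constant $C>0$, depending only on $\nu,\theta_1,\mu,t$ (and $\tau$ in the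 critical case), such that along every sequence of $(n,k,m,S)$ with $|S|=k\le n$, $k\to\infty$ and $m\ge C\,r_k\log n$ eventually, and for every random set $S'\subset[n]$ that is independent of the $m$ observations used in the screening step and satisfies $\mathbb P(|S'\,\triangle\,S|\le\varepsilon k)\to1$ for every fixed $\varepsilon>0$, $$\mathbb P(S''=S)=1-o(1).$$ Thus $m\gtrsim k\log n$ (high), $m\gtrsim k^{\frac1{2\tau-1}}\log n$ (critical), $m\gtrsim\log n$ (low) observations suffice. -/

import Mathlib

open MeasureTheory Filter Topology
open scoped symmDiff

noncomputable section

/-- The numerical value `±1` of a spin. -/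
def spin (b : Bool) : ℝ := if b then 1 else -1

/-- The unnormalised Gibbs weight of the configuration `x` given the external field `h`:
`exp (θ / (2 k) * (∑_{i ∈ S} σ_i)² + ∑_i h_i σ_i)` with `k = |S|`. -/
def gibbsWeight {n : ℕ} (θ : ℝ) (S : Finset (Fin n)) (h : Fin n → ℝ) (x : Fin n → Bool) : ℝ :=
  Real.exp (θ / (2 * (S.card : ℝ)) * (∑ i ∈ S, spin (x i)) ^ 2 + ∑ i, h i * spin (x i))

/-- The conditional probability of the configuration `x` given the external field `h`. -/
def gibbsProb {n : ℕ} (θ : ℝ) (S : Finset (Fin n)) (h : Fin n → ℝ) (x : Fin n → Bool) : ℝ :=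
  gibbsWeight θ S h x / ∑ y : Fin n → Bool, gibbsWeight θ S h y

/-- The law of one observation of the planted random field Curie-Weiss model with clique `S`:
the field has i.i.d. coordinates of law `ν`, and given the field the spins follow the Gibbs
distribution. -/
def plantedLaw {n : ℕ} (ν : Measure ℝ) (θ : ℝ) (S : Finset (Fin n)) :
    Measure (Fin n → Bool) :=
  ∑ x : Fin n → Bool,
    ENNReal.ofReal (∫ h, gibbsProb θ S h x ∂(Measure.pi fun _ : Fin n => ν)) • Measure.dirac x

theorem gibbsWeight_pos {n : ℕ} (θ : ℝ) (S : Finset (Fin n)) (h : Fin n → ℝ)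
    (x : Fin n → Bool) : 0 < gibbsWeight θ S h x := Real.exp_pos _

theorem gibbsProb_nonneg {n : ℕ} (θ : ℝ) (S : Finset (Fin n)) (h : Fin n → ℝ)
    (x : Fin n → Bool) : 0 ≤ gibbsProb θ S h x :=
  div_nonneg (gibbsWeight_pos θ S h x).le
    (Finset.sum_nonneg fun y _ => (gibbsWeight_pos θ S h y).le)

theorem sum_gibbsProb {n : ℕ} (θ : ℝ) (S : Finset (Fin n)) (h : Fin n → ℝ) :
    ∑ x : Fin n → Bool, gibbsProb θ S h x = 1 := by
  unfold gibbsProb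
  rw [← Finset.sum_div]
  exact div_self (Finset.sum_pos (fun y _ => gibbsWeight_pos θ S h y)
    Finset.univ_nonempty).ne'

theorem continuous_gibbsProb {n : ℕ} (θ : ℝ) (S : Finset (Fin n)) (x : Fin n → Bool) :
    Continuous fun h => gibbsProb θ S h x := by
  unfold gibbsProb
  have hc : ∀ y : Fin n → Bool, Continuous fun h => gibbsWeight θ S h y := by
    intro y
    unfold gibbsWeight
    fun_prop
  refine (hc x).div (continuous_finsetSum _ fun y _ => hc y) fun h => ?_
  exact (Finset.sum_pos (fun y _ => gibbsWeight_pos θ S h y) Finset.univ_nonempty).ne'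

theorem integrable_gibbsProb {n : ℕ} (ν : Measure ℝ) [IsProbabilityMeasure ν] (θ : ℝ)
    (S : Finset (Fin n)) (x : Fin n → Bool) :
    Integrable (fun h => gibbsProb θ S h x) (Measure.pi fun _ : Fin n => ν) := by
  refine Integrable.of_bound (continuous_gibbsProb θ S x).aestronglyMeasurable 1 ?_
  refine ae_of_all _ fun h => ?_
  rw [Real.norm_eq_abs, abs_of_nonneg (gibbsProb_nonneg θ S h x), ← sum_gibbsProb θ S h]
  exact Finset.single_le_sum (fun y _ => gibbsProb_nonneg θ S h y) (Finset.mem_univ x)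

instance isProbabilityMeasure_plantedLaw {n : ℕ} (ν : Measure ℝ) [IsProbabilityMeasure ν]
    (θ : ℝ) (S : Finset (Fin n)) : IsProbabilityMeasure (plantedLaw ν θ S) := by
  constructor
  unfold plantedLaw
  rw [Measure.finsetSum_apply]
  simp only [Measure.smul_apply, measure_univ, smul_eq_mul, mul_one]
  rw [← ENNReal.ofReal_sum_of_nonneg
    (fun x _ => integral_nonneg fun h => gibbsProb_nonneg θ S h x),
    ← integral_finsetSum _ (fun x _ => integrable_gibbsProb ν θ S x)]
  simp [sum_gibbsProb]

/-- `E[sech² h]`. -/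
def meanSechSq (ν : Measure ℝ) : ℝ := ∫ h, (1 / Real.cosh h ^ 2) ∂ν

/-- The limiting potential `x² / 2 - E[log cosh (√θ x + h)]`. -/
def potential (ν : Measure ℝ) (θ x : ℝ) : ℝ :=
  x ^ 2 / 2 - ∫ h, Real.log (Real.cosh (Real.sqrt θ * x + h)) ∂ν

/-- `0` is the unique global minimum of the potential. -/
def ZeroIsUniqueMinimum (ν : Measure ℝ) (θ : ℝ) : Prop :=
  ∀ x, x ≠ 0 → potential ν θ 0 < potential ν θ x

/-- High temperature. -/
def HighTemperature (ν : Measure ℝ) (θ : ℝ) : Prop :=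
  θ * meanSechSq ν < 1 ∧ ZeroIsUniqueMinimum ν θ

/-- Critical temperature, where the minimum at `0` has flatness `τ`: the leading term of the
Taylor expansion of the potential at its minimum is a positive multiple of `x ^ (2 τ)`. -/
def CriticalTemperature (ν : Measure ℝ) (θ : ℝ) (τ : ℕ) : Prop :=
  θ * meanSechSq ν = 1 ∧ ZeroIsUniqueMinimum ν θ ∧
    0 < iteratedDeriv (2 * τ) (potential ν θ) 0 ∧
    (fun x => potential ν θ x - potential ν θ 0 -
      iteratedDeriv (2 * τ) (potential ν θ) 0 / ((2 * τ).factorial : ℝ) * x ^ (2 * τ))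
      =O[𝓝 0] fun x => x ^ (2 * τ + 1)

/-- Low temperature (including the case that `θ E[sech² h] = 1` but the potential is smaller
elsewhere than at `0`). -/
def LowTemperature (ν : Measure ℝ) (θ : ℝ) : Prop :=
  1 < θ * meanSechSq ν ∨
    (θ * meanSechSq ν = 1 ∧ ∃ x, potential ν θ x < potential ν θ 0)

/-- The contribution of a single observation `x` to the screening score of the coordinate `i`:
`a⁻¹ σ_i ∑_{l ∈ T, l ≠ i} σ_l`. -/
def coordScore {n : ℕ} (a : ℝ) (T : Finset (Fin n)) (x : Fin n → Bool) (i : Fin n) : ℝ :=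
  spin (x i) * (∑ l ∈ T.erase i, spin (x l)) / a

/-- The screening score of the coordinate `i`: the average of the single contributions over the
`m` observations. -/
def score {n m : ℕ} (a : ℝ) (T : Finset (Fin n)) (X : Fin m → Fin n → Bool) (i : Fin n) : ℝ :=
  (∑ j, coordScore a T (X j) i) / (m : ℝ)

/-- The screening step: starting from the set `T`, return all coordinates whose score is at
least the threshold `t`. -/
def screen {n m : ℕ} (a t : ℝ) (T : Finset (Fin n)) (X : Fin m → Fin n → Bool) :
    Finset (Fin n) :=
  {i | t ≤ score a T X i}

/-- For large cliques, the expected score of every member of the clique, computed with the clique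
itself, is at least `μ`. -/
def SignalAtLeast (ν : Measure ℝ) (θ : ℝ) (a : ℕ → ℝ) (μ : ℝ) : Prop :=
  ∀ᶠ k : ℕ in atTop, ∀ (n : ℕ) (S : Finset (Fin n)), S.card = k → ∀ i ∈ S,
    μ ≤ ∫ x, coordScore (a k) S x i ∂(plantedLaw ν θ S)

/-- Screening at threshold `t` with normalisation `a k` is exact with probability `1 - o(1)` as
soon as `m ≥ C r(k) log n`, whenever the input set `S'` is independent of the `m` observations
used and satisfies `|S' ∆ S| = o(k)` with probability `1 - o(1)`. The probability space `Ω N`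
carries everything that the input set is computed from. -/
def ScreeningExact (ν : Measure ℝ) (θ : ℝ) (a r : ℕ → ℝ) (t C : ℝ) : Prop :=
  ∀ (n m : ℕ → ℕ) (S : ∀ N, Finset (Fin (n N)))
    (Ω : ℕ → Type) (_ : ∀ N, MeasurableSpace (Ω N)) (Q : ∀ N, Measure (Ω N))
    (S' : ∀ N, Ω N → Finset (Fin (n N))),
    (∀ N, IsProbabilityMeasure (Q N)) →
    (∀ N T, MeasurableSet {ω | S' N ω = T}) →
    Tendsto (fun N => (S N).card) atTop atTop →
    (∀ᶠ N in atTop, C * r (S N).card * Real.log (n N) ≤ (m N : ℝ)) →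
    (∀ ε : ℝ, 0 < ε → Tendsto
      (fun N => (Q N).real {ω | ((S' N ω ∆ S N).card : ℝ) ≤ ε * (S N).card}) atTop (𝓝 1)) →
    Tendsto (fun N => ((Q N).prod (Measure.pi fun _ : Fin (m N) => plantedLaw ν θ (S N))).real
      {p | screen (a (S N).card) t (S' N p.1) p.2 = S N}) atTop (𝓝 1)

/-- The screening guarantee with normalisation `a k` and sample size of order `r k * log n`: the
expected scores of clique members are bounded away from zero, and every threshold strictly
between zero and their lower limit gives exact recovery. -/
def ScreeningGuarantee (ν : Measure ℝ) (θ : ℝ) (a r : ℕ → ℝ) : Prop :=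
  (∃ μ : ℝ, 0 < μ ∧ SignalAtLeast ν θ a μ) ∧
    ∀ μ t : ℝ, SignalAtLeast ν θ a μ → 0 < t → t < μ →
      ∃ C : ℝ, 0 < C ∧ ScreeningExact ν θ a r t C

end

/-! Everything reduces to one number, the correlation ρ of two distinct clique spins. Since ν is
symmetric, reversing both the spin and the field at a vertex outside S shows that this spin is
uncorrelated with every other one; by exchangeability all pairs inside S have the same correlation.
For a fixed T close to S, the single-observation score therefore has mean 0 off the clique and |(T ∩
S) \ {i}| ρ / a on it. If ρ ≤ K a/k, the score is bounded by O(r) and has second moment O(r),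
because a r = k. A Bernstein bound gives error exp(-κ m/r) per coordinate, and m ≥ (2/κ) r log n
pays for the union bound. Independence of S' from the sample allows averaging over T. These steps
are `measureReal_screen_ne_le` and `exists_screeningExact`.

What remains is that ρ is of order a_k/k. With M the magnetization per clique vertex, (k - 1) ρ = k
E[M²] - 1.

Upper bound at high and critical temperature: put F(m) = m - E tanh(θ m + h), a rescaled derivative
of H, so |F(m)| ≥ c |m|^N near 0 with N = 2τ - 1 (τ = 1 at high temperature). For every field, M
nearly solves the quenched mean-field equation, with mean square error O(1/k), because the
deviations of the spins from their conditional means are almost uncorrelated. The empirical field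
average is replaced by its expectation uniformly in M by expanding tanh(u + s) in powers of tanh u,
which leaves finitely many empirical averages of variance O(1/k). Large |M| is excluded because 0 is
the unique minimum of H. Hence E[M^(2N)] = O(1/k), and interpolation gives E[M²] = O(k^(-1/N)).

Lower bounds differ by regime. At high temperature, a cavity computation averaged over the sign of
one field yields ρ ≥ const/k (`le_pairCorr`). At critical temperature, a nondegenerate field makes
the empirical mean of tanh h_i of order k^(-1/2); the Gibbs average of the mean-field equation
transfers this to E|M|^N, and interpolation against E[M^(2N)] brings it down to E[M²]. At low
temperature, Jensen's inequality turns a point x with H(x) < H(0) into E[M²] ≥ 2 (H(0) - H(x)) / θ;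
there ρ ≤ 1 suffices from above. -/

/-! ### Product measures and spins -/

/-- The law of the i.i.d. external field. -/
noncomputable abbrev iidField (n : ℕ) (ν : Measure ℝ) : Measure (Fin n → ℝ) :=
  Measure.pi fun _ : Fin n => ν

theorem abs_spin (b : Bool) : |spin b| = 1 := by cases b <;> simp [spin]

theorem spin_mul_self (b : Bool) : spin b * spin b = 1 := by cases b <;> simp [spin]

theorem spin_not (b : Bool) : spin (!b) = -spin b := by cases b <;> simp [spin]

theorem abs_sum_spin_le {n : ℕ} (T : Finset (Fin n)) (x : Fin n → Bool) :
    |∑ i ∈ T, spin (x i)| ≤ T.card := by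
  refine (Finset.abs_sum_le_sum_abs _ _).trans ?_
  simp [abs_spin]

theorem integrable_of_continuous_of_abs_le {n : ℕ} {ν : Measure ℝ} [IsProbabilityMeasure ν]
    {f : (Fin n → ℝ) → ℝ} (hf : Continuous f) (B : ℝ) (hB : ∀ h, |f h| ≤ B) :
    Integrable f (iidField n ν) :=
  Integrable.of_bound hf.aestronglyMeasurable B (ae_of_all _ hB)

/-! ### The quenched Gibbs average -/

/-- The Gibbs average of the observable `f` given the external field `h`. -/
noncomputable def gibbsMean {n : ℕ} (θ : ℝ) (S : Finset (Fin n)) (h : Fin n → ℝ)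
    (f : (Fin n → Bool) → ℝ) : ℝ := ∑ x, gibbsProb θ S h x * f x

section gibbsMean

variable {n : ℕ} {θ : ℝ} {S : Finset (Fin n)} {h : Fin n → ℝ}

theorem gibbsMean_add (f g : (Fin n → Bool) → ℝ) :
    gibbsMean θ S h (fun x => f x + g x) = gibbsMean θ S h f + gibbsMean θ S h g := by
  simp [gibbsMean, mul_add, Finset.sum_add_distrib]

theorem gibbsMean_sub (f g : (Fin n → Bool) → ℝ) :
    gibbsMean θ S h (fun x => f x - g x) = gibbsMean θ S h f - gibbsMean θ S h g := by
  simp [gibbsMean, mul_sub, Finset.sum_sub_distrib]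

theorem gibbsMean_const_mul (c : ℝ) (f : (Fin n → Bool) → ℝ) :
    gibbsMean θ S h (fun x => c * f x) = c * gibbsMean θ S h f := by
  simp only [gibbsMean, Finset.mul_sum]
  exact Finset.sum_congr rfl fun x _ => by ring

theorem gibbsMean_sum {ι : Type*} (s : Finset ι) (f : ι → (Fin n → Bool) → ℝ) :
    gibbsMean θ S h (fun x => ∑ i ∈ s, f i x) = ∑ i ∈ s, gibbsMean θ S h (f i) := by
  simp only [gibbsMean, Finset.mul_sum]
  exact Finset.sum_comm

theorem gibbsMean_const (c : ℝ) : gibbsMean θ S h (fun _ => c) = c := by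
  simp [gibbsMean, ← Finset.sum_mul, sum_gibbsProb]

theorem gibbsMean_mono {f g : (Fin n → Bool) → ℝ} (hfg : ∀ x, f x ≤ g x) :
    gibbsMean θ S h f ≤ gibbsMean θ S h g :=
  Finset.sum_le_sum fun x _ => mul_le_mul_of_nonneg_left (hfg x) (gibbsProb_nonneg _ _ _ _)

theorem abs_gibbsMean_le_gibbsMean_abs (f : (Fin n → Bool) → ℝ) :
    |gibbsMean θ S h f| ≤ gibbsMean θ S h (fun x => |f x|) := by
  refine (Finset.abs_sum_le_sum_abs _ _).trans (le_of_eq ?_)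
  exact Finset.sum_congr rfl fun x _ => by
    rw [abs_mul, abs_of_nonneg (gibbsProb_nonneg _ _ _ _)]

theorem abs_gibbsMean_le {f : (Fin n → Bool) → ℝ} {B : ℝ} (hf : ∀ x, |f x| ≤ B) :
    |gibbsMean θ S h f| ≤ B :=
  (abs_gibbsMean_le_gibbsMean_abs f).trans
    ((gibbsMean_mono hf).trans (gibbsMean_const B).le)

theorem gibbsMean_eq_div (f : (Fin n → Bool) → ℝ) :
    gibbsMean θ S h f =
      (∑ x, gibbsWeight θ S h x * f x) / ∑ x, gibbsWeight θ S h x := by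
  simp only [gibbsMean, gibbsProb, Finset.sum_div]
  exact Finset.sum_congr rfl fun x _ => by ring

theorem sum_gibbsWeight_pos : 0 < ∑ x, gibbsWeight θ S h x :=
  Finset.sum_pos (fun y _ => gibbsWeight_pos θ S h y) Finset.univ_nonempty

theorem continuous_gibbsMean (θ : ℝ) (S : Finset (Fin n)) {f : (Fin n → ℝ) → (Fin n → Bool) → ℝ}
    (hf : ∀ x, Continuous fun h => f h x) :
    Continuous fun h => gibbsMean θ S h (f h) :=
  continuous_finsetSum _ fun x _ => (continuous_gibbsProb θ S x).mul (hf x)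

theorem integrable_gibbsMean (ν : Measure ℝ) [IsProbabilityMeasure ν] (θ : ℝ)
    (S : Finset (Fin n)) (f : (Fin n → Bool) → ℝ) :
    Integrable (fun h => gibbsMean θ S h f) (iidField n ν) :=
  integrable_finsetSum _ fun x _ => (integrable_gibbsProb ν θ S x).mul_const _

theorem integral_plantedLaw (ν : Measure ℝ) [IsProbabilityMeasure ν] (θ : ℝ)
    (S : Finset (Fin n)) (f : (Fin n → Bool) → ℝ) :
    ∫ x, f x ∂(plantedLaw ν θ S) = ∫ h, gibbsMean θ S h f ∂(iidField n ν) := by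
  unfold plantedLaw gibbsMean
  rw [integral_finsetSum_measure fun x _ =>
      (Integrable.of_finite (μ := Measure.dirac x)).smul_measure ENNReal.ofReal_ne_top,
    integral_finsetSum _ fun x _ => (integrable_gibbsProb ν θ S x).mul_const _]
  refine Finset.sum_congr rfl fun x _ => ?_
  rw [integral_smul_measure, integral_dirac, integral_mul_const, ENNReal.toReal_ofReal
    (integral_nonneg fun h => gibbsProb_nonneg θ S h x), smul_eq_mul]

end gibbsMean

/-! ### Spin flips -/

/-- The configuration `x` with the spin at `i` reversed. -/
def flipAt {n : ℕ} (i : Fin n) (x : Fin n → Bool) : Fin n → Bool :=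
  fun j => if j = i then !x j else x j

theorem flipAt_flipAt {n : ℕ} (i : Fin n) (x : Fin n → Bool) : flipAt i (flipAt i x) = x := by
  ext j; by_cases hj : j = i <;> simp [flipAt, hj]

theorem flipAt_self {n : ℕ} (i : Fin n) (x : Fin n → Bool) : flipAt i x i = !x i := by
  simp [flipAt]

theorem flipAt_of_ne {n : ℕ} {i j : Fin n} (hj : j ≠ i) (x : Fin n → Bool) :
    flipAt i x j = x j := by simp [flipAt, hj]

theorem sum_comp_flipAt {n : ℕ} (i : Fin n) (f : (Fin n → Bool) → ℝ) :
    ∑ x, f (flipAt i x) = ∑ x, f x :=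
  Equiv.sum_comp (Function.Involutive.toPerm (flipAt i) (flipAt_flipAt i)) f

theorem sum_eq_sum_flip_average {n : ℕ} (i : Fin n) (f : (Fin n → Bool) → ℝ) :
    ∑ x, f x = ∑ x, (f x + f (flipAt i x)) / 2 := by
  rw [← Finset.sum_div, Finset.sum_add_distrib, sum_comp_flipAt]
  ring

theorem sum_spin_flipAt {n : ℕ} {i : Fin n} {T : Finset (Fin n)} (hi : i ∉ T)
    (x : Fin n → Bool) : ∑ l ∈ T, spin (flipAt i x l) = ∑ l ∈ T, spin (x l) :=
  Finset.sum_congr rfl fun l hl => by rw [flipAt_of_ne (ne_of_mem_of_not_mem hl hi)]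

/-- The field `h` with the sign at `i` reversed. -/
def negAt {n : ℕ} (i : Fin n) (h : Fin n → ℝ) : Fin n → ℝ :=
  fun j => if j = i then -h j else h j

theorem measurePreserving_negAt {n : ℕ} {ν : Measure ℝ} [IsProbabilityMeasure ν]
    (hsymm : ν.map (fun h : ℝ => -h) = ν) (i : Fin n) :
    MeasurePreserving (negAt i) (iidField n ν) (iidField n ν) := by
  have := measurePreserving_pi (fun _ : Fin n => ν) (fun _ : Fin n => ν)
    (f := fun j s => if j = i then -s else s) (fun j => by
      by_cases hj : j = i
      · simp only [hj, if_true]; exact ⟨measurable_neg, hsymm⟩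
      · simp only [hj, if_false]; exact MeasurePreserving.id ν)
  exact this

theorem integral_comp_negAt {n : ℕ} {ν : Measure ℝ} [IsProbabilityMeasure ν]
    (hsymm : ν.map (fun h : ℝ => -h) = ν) (i : Fin n) {f : (Fin n → ℝ) → ℝ}
    (hf : Continuous f) :
    ∫ h, f (negAt i h) ∂(iidField n ν) = ∫ h, f h ∂(iidField n ν) := by
  have h1 := measurePreserving_negAt hsymm i
  conv_rhs => rw [← h1.map_eq]
  rw [integral_map h1.measurable.aemeasurable hf.aestronglyMeasurable]

/-- The product h_i σ_i is unchanged when both signs are reversed, and the quadratic term does not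
see i because i lies outside S. -/
theorem gibbsProb_negAt_flipAt {n : ℕ} (θ : ℝ) {S : Finset (Fin n)} {i : Fin n} (hi : i ∉ S)
    (h : Fin n → ℝ) (x : Fin n → Bool) :
    gibbsProb θ S (negAt i h) (flipAt i x) = gibbsProb θ S h x := by
  have hw : ∀ y, gibbsWeight θ S (negAt i h) (flipAt i y) = gibbsWeight θ S h y := by
    intro y
    unfold gibbsWeight
    rw [sum_spin_flipAt hi]
    congr 2
    refine Finset.sum_congr rfl fun j _ => ?_
    by_cases hj : j = i
    · simp [negAt, flipAt, hj, spin_not]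
    · simp [negAt, flipAt, hj]
  unfold gibbsProb
  rw [hw, ← sum_comp_flipAt i (gibbsWeight θ S (negAt i h))]
  simp only [hw]

/-- The joint reversal of spin and field at i preserves the planted law, by symmetry of ν, and
changes the sign of the integrand. -/
theorem integral_spin_mul_eq_zero {n : ℕ} {ν : Measure ℝ} [IsProbabilityMeasure ν]
    (hsymm : ν.map (fun h : ℝ => -h) = ν) (θ : ℝ) {S : Finset (Fin n)} {i : Fin n}
    (hi : i ∉ S) {f : (Fin n → Bool) → ℝ} (hf : ∀ x, f (flipAt i x) = f x) :
    ∫ x, spin (x i) * f x ∂(plantedLaw ν θ S) = 0 := by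
  rw [integral_plantedLaw]
  have hneg : ∀ h, gibbsMean θ S (negAt i h) (fun x => spin (x i) * f x) =
      -gibbsMean θ S h (fun x => spin (x i) * f x) := by
    intro h
    unfold gibbsMean
    rw [← sum_comp_flipAt i, ← Finset.sum_neg_distrib]
    refine Finset.sum_congr rfl fun x _ => ?_
    simp only [gibbsProb_negAt_flipAt θ hi, hf, flipAt_self, spin_not]
    ring
  have h1 := integral_comp_negAt hsymm i
    (continuous_gibbsMean θ S (f := fun _ x => spin (x i) * f x) fun x => continuous_const)
  simp only [hneg, integral_neg] at h1
  linarith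

/-! ### Exchangeability inside the clique -/

theorem measurePreserving_comp_perm {n : ℕ} (ν : Measure ℝ) [IsProbabilityMeasure ν]
    (π : Equiv.Perm (Fin n)) :
    MeasurePreserving (fun h : Fin n → ℝ => h ∘ π) (iidField n ν) (iidField n ν) := by
  have := measurePreserving_piCongrLeft (fun _ : Fin n => ν) π.symm
  convert this using 1
  ext h i
  have := MeasurableEquiv.piCongrLeft_apply_apply (β := fun _ : Fin n => ℝ) π.symm h (π i)
  simpa using this.symm

theorem gibbsProb_comp_perm {n : ℕ} (θ : ℝ) {S : Finset (Fin n)} {π : Equiv.Perm (Fin n)}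
    (hπ : ∀ i, π i ∈ S ↔ i ∈ S) (h : Fin n → ℝ) (x : Fin n → Bool) :
    gibbsProb θ S (h ∘ π) (x ∘ π) = gibbsProb θ S h x := by
  have hw : ∀ y, gibbsWeight θ S (h ∘ π) (y ∘ π) = gibbsWeight θ S h y := by
    intro y
    unfold gibbsWeight
    have e1 : ∑ i ∈ S, spin ((y ∘ π) i) = ∑ i ∈ S, spin (y i) :=
      Finset.sum_bijective π π.bijective (fun i => (hπ i).symm) fun i _ => rfl
    have e2 : ∑ i, (h ∘ π) i * spin ((y ∘ π) i) = ∑ i, h i * spin (y i) :=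
      Equiv.sum_comp π fun i => h i * spin (y i)
    rw [e1, e2]
  unfold gibbsProb
  rw [hw, ← Equiv.sum_comp (π.symm.arrowCongr (Equiv.refl Bool)) (gibbsWeight θ S (h ∘ π))]
  congr 1
  exact Finset.sum_congr rfl fun y _ => hw y

theorem integral_comp_perm {n : ℕ} (ν : Measure ℝ) [IsProbabilityMeasure ν] (θ : ℝ)
    {S : Finset (Fin n)} {π : Equiv.Perm (Fin n)} (hπ : ∀ i, π i ∈ S ↔ i ∈ S)
    (f : (Fin n → Bool) → ℝ) :
    ∫ x, f (x ∘ π) ∂(plantedLaw ν θ S) = ∫ x, f x ∂(plantedLaw ν θ S) := by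
  rw [integral_plantedLaw, integral_plantedLaw]
  have h1 := measurePreserving_comp_perm ν π
  conv_rhs => rw [← h1.map_eq]
  rw [integral_map h1.measurable.aemeasurable
    (continuous_gibbsMean θ S (f := fun _ => f) fun x => continuous_const).aestronglyMeasurable]
  refine integral_congr_ae (ae_of_all _ fun h => ?_)
  simp only [gibbsMean]
  rw [← Equiv.sum_comp (π.symm.arrowCongr (Equiv.refl Bool))
    (fun x => gibbsProb θ S (h ∘ π) x * f x)]
  refine Finset.sum_congr rfl fun x _ => ?_
  rw [← gibbsProb_comp_perm θ hπ h x]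
  rfl

/-- The correlation of the spins at `i` and `j` under the planted law. -/
noncomputable def pairCorr {n : ℕ} (ν : Measure ℝ) (θ : ℝ) (S : Finset (Fin n)) (i j : Fin n) :
    ℝ := ∫ x, spin (x i) * spin (x j) ∂(plantedLaw ν θ S)

theorem pairCorr_comm {n : ℕ} (ν : Measure ℝ) (θ : ℝ) (S : Finset (Fin n)) (i j : Fin n) :
    pairCorr ν θ S i j = pairCorr ν θ S j i := by
  unfold pairCorr; simp only [mul_comm]

theorem pairCorr_self {n : ℕ} (ν : Measure ℝ) [IsProbabilityMeasure ν] (θ : ℝ)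
    (S : Finset (Fin n)) (i : Fin n) : pairCorr ν θ S i i = 1 := by
  simp [pairCorr, spin_mul_self]

theorem abs_pairCorr_le_one {n : ℕ} (ν : Measure ℝ) [IsProbabilityMeasure ν] (θ : ℝ)
    (S : Finset (Fin n)) (i j : Fin n) : |pairCorr ν θ S i j| ≤ 1 := by
  have := norm_integral_le_of_norm_le_const (μ := plantedLaw ν θ S)
    (f := fun x => spin (x i) * spin (x j)) (C := 1)
    (ae_of_all _ fun x => by rw [Real.norm_eq_abs, abs_mul, abs_spin, abs_spin, one_mul])
  simpa [pairCorr] using this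

theorem pairCorr_of_notMem {n : ℕ} {ν : Measure ℝ} [IsProbabilityMeasure ν]
    (hsymm : ν.map (fun h : ℝ => -h) = ν) (θ : ℝ) {S : Finset (Fin n)} {i j : Fin n}
    (hij : i ≠ j) (hi : i ∉ S) : pairCorr ν θ S i j = 0 :=
  integral_spin_mul_eq_zero hsymm θ hi fun x => by rw [flipAt_of_ne hij.symm]

theorem pairCorr_perm {n : ℕ} (ν : Measure ℝ) [IsProbabilityMeasure ν] (θ : ℝ)
    {S : Finset (Fin n)} {π : Equiv.Perm (Fin n)} (hπ : ∀ i, π i ∈ S ↔ i ∈ S) (i j : Fin n) :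
    pairCorr ν θ S (π i) (π j) = pairCorr ν θ S i j :=
  integral_comp_perm ν θ hπ fun x => spin (x i) * spin (x j)

theorem swap_mem_iff {n : ℕ} {S : Finset (Fin n)} {a b : Fin n} (ha : a ∈ S) (hb : b ∈ S)
    (i : Fin n) : Equiv.swap a b i ∈ S ↔ i ∈ S := by
  rcases eq_or_ne i a with rfl | h1
  · simp [ha, hb]
  rcases eq_or_ne i b with rfl | h2
  · simp [ha, hb]
  rw [Equiv.swap_apply_of_ne_of_ne h1 h2]

theorem pairCorr_eq_of_mem_right {n : ℕ} (ν : Measure ℝ) [IsProbabilityMeasure ν] (θ : ℝ)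
    {S : Finset (Fin n)} {i j l : Fin n} (hj : j ∈ S) (hl : l ∈ S)
    (hij : i ≠ j) (hil : i ≠ l) : pairCorr ν θ S i j = pairCorr ν θ S i l := by
  have := pairCorr_perm ν θ (swap_mem_iff hj hl) i j
  rwa [Equiv.swap_apply_of_ne_of_ne hij hil, Equiv.swap_apply_left, eq_comm] at this

/-- Move one index at a time by a transposition inside S. A transposition must not touch the index
that stays, so the case i = j' first exchanges the roles of i' and j'. -/
theorem pairCorr_eq_of_mem {n : ℕ} (ν : Measure ℝ) [IsProbabilityMeasure ν] (θ : ℝ)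
    {S : Finset (Fin n)} {i j i' j' : Fin n} (hi : i ∈ S) (hj : j ∈ S) (hi' : i' ∈ S)
    (hj' : j' ∈ S) (hij : i ≠ j) (hij' : i' ≠ j') :
    pairCorr ν θ S i j = pairCorr ν θ S i' j' := by
  by_cases h1 : i = j'
  · rw [pairCorr_comm ν θ S i' j', ← h1]
    exact pairCorr_eq_of_mem_right ν θ hj hi' hij (fun e => hij' (e ▸ h1))
  · rw [pairCorr_eq_of_mem_right ν θ hj hj' hij h1, pairCorr_comm ν θ S i j',
      pairCorr_comm ν θ S i' j']
    exact pairCorr_eq_of_mem_right ν θ hi hi' (Ne.symm h1) hij'.symm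

theorem integral_coordScore {n : ℕ} (ν : Measure ℝ) [IsProbabilityMeasure ν] (θ a : ℝ)
    (S T : Finset (Fin n)) (i : Fin n) :
    ∫ x, coordScore a T x i ∂(plantedLaw ν θ S) =
      (∑ l ∈ T.erase i, pairCorr ν θ S i l) / a := by
  unfold coordScore pairCorr
  rw [integral_div, ← integral_finsetSum _ fun l _ => Integrable.of_finite]
  simp only [Finset.mul_sum]

theorem integral_coordScore_clique {n : ℕ} (ν : Measure ℝ) [IsProbabilityMeasure ν] (θ a : ℝ)
    {S : Finset (Fin n)} {i j i' : Fin n} (hi : i ∈ S) (hj : j ∈ S) (hij : i ≠ j)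
    (hi' : i' ∈ S) :
    ∫ x, coordScore a S x i' ∂(plantedLaw ν θ S) =
      ((S.card : ℝ) - 1) * pairCorr ν θ S i j / a := by
  rw [integral_coordScore, Finset.sum_congr rfl fun l hl => pairCorr_eq_of_mem ν θ hi'
    (Finset.mem_of_mem_erase hl) hi hj (Finset.ne_of_mem_erase hl).symm hij]
  rw [Finset.sum_const, Finset.card_erase_of_mem hi', nsmul_eq_mul,
    Nat.cast_sub (Finset.card_pos.2 ⟨i, hi⟩), Nat.cast_one]

theorem integral_sq_sum_spin {n : ℕ} (ν : Measure ℝ) [IsProbabilityMeasure ν] (θ : ℝ)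
    (S T : Finset (Fin n)) :
    ∫ x, (∑ i ∈ T, spin (x i)) ^ 2 ∂(plantedLaw ν θ S) =
      ∑ i ∈ T, ∑ j ∈ T, pairCorr ν θ S i j := by
  unfold pairCorr
  simp_rw [← integral_finsetSum T fun l _ => Integrable.of_finite (μ := plantedLaw ν θ S)]
  simp only [sq, Finset.sum_mul_sum]

/-- The second moment of the magnetization of the clique in terms of a single correlation. -/
theorem integral_sq_cliqueSum {n : ℕ} (ν : Measure ℝ) [IsProbabilityMeasure ν] (θ : ℝ)
    {S : Finset (Fin n)} {i j : Fin n} (hi : i ∈ S) (hj : j ∈ S) (hij : i ≠ j) :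
    ∫ x, (∑ l ∈ S, spin (x l)) ^ 2 ∂(plantedLaw ν θ S) =
      S.card + S.card * ((S.card : ℝ) - 1) * pairCorr ν θ S i j := by
  rw [integral_sq_sum_spin]
  have : ∀ l ∈ S, ∑ l' ∈ S, pairCorr ν θ S l l' =
      1 + ((S.card : ℝ) - 1) * pairCorr ν θ S i j := by
    intro l hl
    rw [← Finset.add_sum_erase _ _ hl, pairCorr_self, Finset.sum_congr rfl fun l' hl' =>
      pairCorr_eq_of_mem ν θ hl (Finset.mem_of_mem_erase hl') hi hj
        (Finset.ne_of_mem_erase hl').symm hij]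
    rw [Finset.sum_const, Finset.card_erase_of_mem hl, nsmul_eq_mul,
      Nat.cast_sub (Finset.card_pos.2 ⟨i, hi⟩), Nat.cast_one]
  rw [Finset.sum_congr rfl this, Finset.sum_const, nsmul_eq_mul]
  ring

/-! ### Exactness of the screening step from correlation bounds -/

theorem exp_le_one_add_add_sq {u : ℝ} (hu : |u| ≤ 1) : Real.exp u ≤ 1 + u + u ^ 2 := by
  have := (abs_le.1 (Real.abs_exp_sub_one_sub_id_le hu)).2
  linarith

theorem integrable_of_measurable_of_abs_le {α : Type*} [MeasurableSpace α] {P : Measure α}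
    [IsFiniteMeasure P] {f : α → ℝ} (hf : Measurable f) (B : ℝ) (hB : ∀ x, |f x| ≤ B) :
    Integrable f P :=
  Integrable.of_bound hf.aestronglyMeasurable B (ae_of_all _ hB)

theorem integral_exp_le {α : Type*} [MeasurableSpace α] {P : Measure α} [IsProbabilityMeasure P]
    {Z : α → ℝ} (hZ : Measurable Z) {B l : ℝ} (hB : ∀ x, |Z x| ≤ B) (hl : 0 ≤ l)
    (hlB : l * B ≤ 1) :
    ∫ x, Real.exp (l * Z x) ∂P ≤ 1 + l * ∫ x, Z x ∂P + l ^ 2 * ∫ x, Z x ^ 2 ∂P := by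
  have hlZ : ∀ x, |l * Z x| ≤ 1 := fun x => by
    rw [abs_mul, abs_of_nonneg hl]
    exact (mul_le_mul_of_nonneg_left (hB x) hl).trans hlB
  have i1 : Integrable (fun x => l * Z x) P :=
    integrable_of_measurable_of_abs_le (hZ.const_mul l) 1 hlZ
  have i2 : Integrable (fun x => (l * Z x) ^ 2) P :=
    integrable_of_measurable_of_abs_le ((hZ.const_mul l).pow_const 2) 1 fun x => by
      rw [abs_pow]; exact pow_le_one₀ (abs_nonneg _) (hlZ x)
  have i3 : Integrable (fun x => 1 + l * Z x) P := (integrable_const 1).add i1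
  calc ∫ x, Real.exp (l * Z x) ∂P ≤ ∫ x, (1 + l * Z x + (l * Z x) ^ 2) ∂P := by
        refine integral_mono ?_ (i3.add i2) fun x => exp_le_one_add_add_sq (hlZ x)
        refine integrable_of_measurable_of_abs_le (hZ.const_mul l).exp (Real.exp 1) fun x => ?_
        rw [Real.abs_exp]
        exact Real.exp_le_exp.2 (abs_le.1 (hlZ x)).2
    _ = 1 + l * ∫ x, Z x ∂P + l ^ 2 * ∫ x, Z x ^ 2 ∂P := by
        rw [integral_add i3 i2, integral_add (integrable_const 1) i1, integral_const_mul]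
        simp only [mul_pow, integral_const_mul, integral_const, probReal_univ, smul_eq_mul, mul_one]

/-- A Bernstein bound for sums of independent bounded variables of negative mean. -/
theorem measureReal_sum_nonneg_le {α : Type*} [MeasurableSpace α] {P : Measure α}
    [IsProbabilityMeasure P] {Z : α → ℝ} (hZ : Measurable Z) {B l : ℝ}
    (hB : ∀ x, |Z x| ≤ B) (hl : 0 ≤ l) (hlB : l * B ≤ 1) (m : ℕ) :
    (Measure.pi fun _ : Fin m => P).real {X | 0 ≤ ∑ j, Z (X j)} ≤
      Real.exp (m * (l * ∫ x, Z x ∂P + l ^ 2 * ∫ x, Z x ^ 2 ∂P)) := by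
  have hmeas : Measurable fun X : Fin m → α => ∑ j, Z (X j) :=
    Finset.measurable_sum _ fun j _ => hZ.comp (measurable_pi_apply j)
  have hint : Integrable (fun X : Fin m → α => Real.exp (l * ∑ j, Z (X j)))
      (Measure.pi fun _ : Fin m => P) := by
    refine integrable_of_measurable_of_abs_le (hmeas.const_mul l).exp
      (Real.exp (l * (m * B))) fun X => ?_
    rw [Real.abs_exp, Real.exp_le_exp]
    refine mul_le_mul_of_nonneg_left ?_ hl
    refine (Finset.sum_le_sum fun j _ => (abs_le.1 (hB (X j))).2).trans ?_
    simp
  refine (ProbabilityTheory.measure_ge_le_exp_mul_mgf 0 hl hint).trans ?_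
  rw [mul_zero, Real.exp_zero, one_mul]
  unfold ProbabilityTheory.mgf
  simp only [Finset.mul_sum, Real.exp_sum]
  rw [integral_fintype_prod_eq_prod (μ := fun _ : Fin m => P)
    (fun _ x => Real.exp (l * Z x)), Finset.prod_const, Finset.card_univ, Fintype.card_fin,
    Real.exp_nat_mul]
  refine pow_le_pow_left₀ (integral_nonneg fun x => (Real.exp_pos _).le) ?_ m
  refine (integral_exp_le hZ hB hl hlB).trans ?_
  have := Real.add_one_le_exp (l * ∫ x, Z x ∂P + l ^ 2 * ∫ x, Z x ^ 2 ∂P)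
  linarith

/-- When the bound and the second moment are both of order r, the exponential parameter can be taken
of order 1/r, so the decay rate is m/r and not m/r². -/
theorem measureReal_sum_nonneg_le_exp_neg {α : Type*} [MeasurableSpace α] {P : Measure α}
    [IsProbabilityMeasure P] {Z : α → ℝ} (hZ : Measurable Z) {B V δ r : ℝ}
    (hB0 : 0 < B) (hV0 : 0 < V) (hδ : 0 < δ) (hr : 0 < r)
    (hB : ∀ x, |Z x| ≤ B * r) (hV : ∫ x, Z x ^ 2 ∂P ≤ V * r) (hm : ∫ x, Z x ∂P ≤ -δ) (m : ℕ) :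
    (Measure.pi fun _ : Fin m => P).real {X | 0 ≤ ∑ j, Z (X j)} ≤
      Real.exp (-(δ * min (1 / B) (δ / (2 * V)) / 2) * (m / r)) := by
  -- The first entry keeps the exponent in the range |u| ≤ 1 of the quadratic bound; the second
  -- makes the second-order term at most half of the drift δ.
  set c := min (1 / B) (δ / (2 * V)) with hc
  have hc0 : 0 < c := lt_min (by positivity) (by positivity)
  have hcB : c * B ≤ 1 := by
    have := min_le_left (1 / B) (δ / (2 * V))
    rw [← hc, le_div_iff₀ hB0] at this
    exact this
  have hcV : c * V ≤ δ / 2 := by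
    have := min_le_right (1 / B) (δ / (2 * V))
    rw [← hc, le_div_iff₀ (by positivity)] at this
    linarith
  refine (measureReal_sum_nonneg_le hZ hB (l := c / r) (by positivity)
    (by field_simp; linarith) m).trans ?_
  rw [Real.exp_le_exp]
  have h1 : c / r * ∫ x, Z x ∂P ≤ c / r * (-δ) := mul_le_mul_of_nonneg_left hm (by positivity)
  have h2 : (c / r) ^ 2 * ∫ x, Z x ^ 2 ∂P ≤ (c / r) ^ 2 * (V * r) :=
    mul_le_mul_of_nonneg_left hV (by positivity)
  have h3 : (c / r) ^ 2 * (V * r) = c / r * (c * V) := by field_simp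
  have h4 : c / r * (c * V) ≤ c / r * (δ / 2) := mul_le_mul_of_nonneg_left hcV (by positivity)
  have h5 : (m : ℝ) * (c / r * (-δ) + c / r * (δ / 2)) = -(δ * c / 2) * (m / r) := by
    field_simp; ring
  rw [← h5]
  exact mul_le_mul_of_nonneg_left (by linarith) (Nat.cast_nonneg m)

/-! ### Mean and second moment of a single score. -/

section coordScore

variable {n : ℕ} {ν : Measure ℝ} [IsProbabilityMeasure ν] {θ : ℝ} {S T : Finset (Fin n)}

theorem abs_coordScore_le {a : ℝ} (ha : 0 < a) (x : Fin n → Bool) (i : Fin n) :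
    |coordScore a T x i| ≤ T.card / a := by
  unfold coordScore
  rw [abs_div, abs_of_pos ha, abs_mul, abs_spin, one_mul]
  refine div_le_div_of_nonneg_right ((abs_sum_spin_le _ x).trans ?_) ha.le
  exact_mod_cast Finset.card_le_card (Finset.erase_subset i T)

/-- In the double sum over T the diagonal contributes 1 per vertex, and an off-diagonal pair
contributes at most ρ, being uncorrelated unless both vertices lie in S. -/
theorem integral_sq_coordScore_le (hsymm : ν.map (fun h : ℝ => -h) = ν) {a ρ : ℝ}
    (hρ0 : 0 ≤ ρ) (hρ : ∀ i ∈ S, ∀ j ∈ S, i ≠ j → pairCorr ν θ S i j ≤ ρ) (i : Fin n) :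
    ∫ x, coordScore a T x i ^ 2 ∂(plantedLaw ν θ S) ≤
      (T.card + (T.card : ℝ) ^ 2 * ρ) / a ^ 2 := by
  have h0 : ∀ x, coordScore a T x i ^ 2 = (∑ l ∈ T.erase i, spin (x l)) ^ 2 / a ^ 2 := by
    intro x
    unfold coordScore
    rw [div_pow, mul_pow, sq (spin _), spin_mul_self, one_mul]
  simp only [h0]
  rw [integral_div, integral_sq_sum_spin]
  refine div_le_div_of_nonneg_right ?_ (sq_nonneg a)
  have hc : ((T.erase i).card : ℝ) ≤ T.card := by
    exact_mod_cast Finset.card_le_card (Finset.erase_subset i T)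
  have hpair : ∀ j l, pairCorr ν θ S j l ≤ (if j = l then 1 else 0) + ρ := by
    intro j l
    by_cases hjl : j = l
    · rw [if_pos hjl, hjl, pairCorr_self]; linarith
    · rw [if_neg hjl, zero_add]
      by_cases hj : j ∈ S
      · by_cases hl : l ∈ S
        · exact hρ j hj l hl hjl
        · rw [pairCorr_comm, pairCorr_of_notMem hsymm θ (Ne.symm hjl) hl]; exact hρ0
      · rw [pairCorr_of_notMem hsymm θ hjl hj]; exact hρ0
  calc ∑ j ∈ T.erase i, ∑ l ∈ T.erase i, pairCorr ν θ S j l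
      ≤ ∑ j ∈ T.erase i, ∑ l ∈ T.erase i, ((if j = l then 1 else 0) + ρ) :=
        Finset.sum_le_sum fun j _ => Finset.sum_le_sum fun l _ => hpair j l
    _ = ∑ j ∈ T.erase i, (1 + (T.erase i).card * ρ) := by
        refine Finset.sum_congr rfl fun j hj => ?_
        rw [Finset.sum_add_distrib, Finset.sum_ite_eq, if_pos hj, Finset.sum_const, nsmul_eq_mul]
    _ = (T.erase i).card + ((T.erase i).card : ℝ) ^ 2 * ρ := by
        rw [Finset.sum_const, nsmul_eq_mul]; ring
    _ ≤ T.card + (T.card : ℝ) ^ 2 * ρ := by gcongr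

theorem integral_coordScore_of_notMem (hsymm : ν.map (fun h : ℝ => -h) = ν) (a : ℝ) {i : Fin n}
    (hi : i ∉ S) : ∫ x, coordScore a T x i ∂(plantedLaw ν θ S) = 0 := by
  rw [integral_coordScore, Finset.sum_eq_zero, zero_div]
  intro l hl
  exact pairCorr_of_notMem hsymm θ (Finset.ne_of_mem_erase hl).symm hi

/-- Vertices of T outside the clique are uncorrelated with i', so only T ∩ S contributes, each
vertex with the common correlation. -/
theorem integral_coordScore_of_mem (hsymm : ν.map (fun h : ℝ => -h) = ν) (a : ℝ)
    {i j i' : Fin n} (hi : i ∈ S) (hj : j ∈ S) (hij : i ≠ j) (hi' : i' ∈ S) :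
    ∫ x, coordScore a T x i' ∂(plantedLaw ν θ S) =
      (((T ∩ S).erase i').card : ℝ) * pairCorr ν θ S i j / a := by
  rw [integral_coordScore]
  congr 1
  have hsub : (T ∩ S).erase i' ⊆ T.erase i' :=
    Finset.erase_subset_erase _ Finset.inter_subset_left
  rw [← Finset.sum_subset hsub]
  · rw [Finset.sum_congr rfl fun l hl => pairCorr_eq_of_mem ν θ hi'
      (Finset.mem_inter.1 (Finset.mem_of_mem_erase hl)).2 hi hj
      (Finset.ne_of_mem_erase hl).symm hij]
    rw [Finset.sum_const, nsmul_eq_mul]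
  · intro l hl hl'
    have hlS : l ∉ S := fun h => hl' (Finset.mem_erase.2 ⟨Finset.ne_of_mem_erase hl,
      Finset.mem_inter.2 ⟨Finset.mem_of_mem_erase hl, h⟩⟩)
    rw [pairCorr_comm, pairCorr_of_notMem hsymm θ (Finset.ne_of_mem_erase hl) hlS]

end coordScore

theorem card_le_two_mul_of_symmDiff {n : ℕ} {S T : Finset (Fin n)} {ε : ℝ} (hε : ε ≤ 1)
    (h : ((T ∆ S).card : ℝ) ≤ ε * S.card) : (T.card : ℝ) ≤ 2 * S.card := by
  have h1 : T.card ≤ (T ∆ S).card + S.card := by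
    refine (Finset.card_le_card fun x hx => ?_).trans (Finset.card_union_le _ _)
    by_cases hS : x ∈ S <;> simp [Finset.mem_symmDiff, hx, hS]
  have h2 : (T.card : ℝ) ≤ (T ∆ S).card + S.card := by exact_mod_cast h1
  have h3 : ε * (S.card : ℝ) ≤ 1 * S.card := by gcongr
  linarith

theorem card_sub_le_card_inter_erase {n : ℕ} {S T : Finset (Fin n)} {i : Fin n} :
    (S.card : ℝ) - 1 - (T ∆ S).card ≤ ((T ∩ S).erase i).card := by
  have h1 : S.card ≤ (T ∆ S).card + (((T ∩ S).erase i).card + 1) := by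
    refine (Finset.card_le_card fun x hx => ?_).trans ((Finset.card_union_le _
      (insert i ((T ∩ S).erase i))).trans (Nat.add_le_add_left (Finset.card_insert_le _ _) _))
    by_cases hT : x ∈ T <;> by_cases hi : x = i <;> simp [Finset.mem_symmDiff, hx, hT, hi]
  have h2 : (S.card : ℝ) ≤ (T ∆ S).card + (((T ∩ S).erase i).card + 1) := by exact_mod_cast h1
  linarith

/-- Screening from a fixed set `T` close to the clique fails with small probability. -/
theorem measureReal_screen_ne_le {n : ℕ} {ν : Measure ℝ} [IsProbabilityMeasure ν] {θ : ℝ}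
    (hsymm : ν.map (fun h : ℝ => -h) = ν) {S T : Finset (Fin n)} {a r μ t K : ℝ}
    (ha : 1 ≤ a) (hr : 1 ≤ r) (har : a * r = S.card) (hS : 2 ≤ S.card) (hK : 0 ≤ K)
    (hρ : ∀ i ∈ S, ∀ j ∈ S, i ≠ j → pairCorr ν θ S i j ≤ K * a / S.card)
    (hμ : ∀ i ∈ S, μ ≤ ∫ x, coordScore a S x i ∂(plantedLaw ν θ S))
    (ht : 0 < t) (htμ : t < μ)
    (hT : ((T ∆ S).card : ℝ) ≤ (μ - t) / (4 * μ) * S.card) {m : ℕ} (hm : 0 < m) {κ : ℝ}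
    (hκ : κ = min t ((μ - t) / 2) * min (1 / (t + 2))
      (min t ((μ - t) / 2) / (2 * (2 * t ^ 2 + 2 * (2 + 4 * K)))) / 2) :
    (Measure.pi fun _ : Fin m => plantedLaw ν θ S).real {X | screen a t T X ≠ S} ≤
      n * Real.exp (-κ * (m / r)) := by
  have ha0 : 0 < a := by linarith
  have hr0 : 0 < r := by linarith
  have hμ0 : 0 < μ := by linarith
  have hk2 : (2 : ℝ) ≤ S.card := by exact_mod_cast hS
  set k : ℝ := (S.card : ℝ) with hk
  have hk0 : 0 < k := by linarith
  -- The smaller of the two margins: outside S the mean 0 lies t below the threshold, inside S the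
  -- mean stays at least (μ - t)/2 above it.
  set δ := min t ((μ - t) / 2) with hδ
  have hδ0 : 0 < δ := lt_min ht (by linarith)
  obtain ⟨i₀, hi₀, j₀, hj₀, hij₀⟩ := Finset.one_lt_card.1 (show 1 < S.card by omega)
  set ρ := pairCorr ν θ S i₀ j₀ with hρdef
  have hsig : μ ≤ (k - 1) * ρ / a := by
    have := hμ i₀ hi₀
    rwa [integral_coordScore_clique ν θ a hi₀ hj₀ hij₀ hi₀] at this
  have hTc : (T.card : ℝ) ≤ 2 * k := card_le_two_mul_of_symmDiff (ε := (μ - t) / (4 * μ))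
    (by rw [div_le_one (by positivity)]; linarith) hT
  have hY : ∀ i x, |coordScore a T x i| ≤ 2 * r := by
    intro i x
    refine (abs_coordScore_le ha0 x i).trans ?_
    rw [div_le_iff₀ ha0]; nlinarith
  have hY2 : ∀ i, ∫ x, coordScore a T x i ^ 2 ∂(plantedLaw ν θ S) ≤ (2 + 4 * K) * r := by
    intro i
    refine (integral_sq_coordScore_le hsymm (by positivity) hρ i).trans ?_
    rw [div_le_iff₀ (by positivity)]
    have h1 : (T.card : ℝ) ^ 2 * (K * a / k) ≤ (2 * k) ^ 2 * (K * a / k) := by gcongr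
    have h2 : (2 * k) ^ 2 * (K * a / k) = 4 * K * (a * k) := by field_simp; ring
    have h3 : (2 + 4 * K) * r * a ^ 2 = 2 * (a * k) + 4 * K * (a * k) := by rw [← har]; ring
    have h4 : k ≤ a * k := le_mul_of_one_le_left hk0.le ha
    linarith
  -- Both kinds of error take one form, a nonnegative sum of i.i.d. variables of mean at most -δ:
  -- threshold minus score on S, score minus threshold off S.
  have hfail : ∀ i : Fin n, ∃ Z : (Fin n → Bool) → ℝ, (∀ x, |Z x| ≤ (t + 2) * r) ∧
      (∫ x, Z x ^ 2 ∂(plantedLaw ν θ S) ≤ (2 * t ^ 2 + 2 * (2 + 4 * K)) * r) ∧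
      (∫ x, Z x ∂(plantedLaw ν θ S) ≤ -δ) ∧
      ∀ X : Fin m → Fin n → Bool, ¬ (i ∈ screen a t T X ↔ i ∈ S) → 0 ≤ ∑ j, Z (X j) := by
    intro i
    have hbd : ∀ x, |coordScore a T x i - t| ≤ (t + 2) * r := by
      intro x
      refine (abs_sub _ _).trans ?_
      rw [abs_of_pos ht]
      nlinarith [hY i x]
    have hsq : ∫ x, (coordScore a T x i - t) ^ 2 ∂(plantedLaw ν θ S) ≤
        (2 * t ^ 2 + 2 * (2 + 4 * K)) * r := by
      calc ∫ x, (coordScore a T x i - t) ^ 2 ∂(plantedLaw ν θ S)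
          ≤ ∫ x, (2 * t ^ 2 + 2 * coordScore a T x i ^ 2) ∂(plantedLaw ν θ S) :=
            integral_mono Integrable.of_finite Integrable.of_finite fun x => by
              nlinarith [sq_nonneg (coordScore a T x i + t)]
        _ = 2 * t ^ 2 + 2 * ∫ x, coordScore a T x i ^ 2 ∂(plantedLaw ν θ S) := by
            rw [integral_add Integrable.of_finite Integrable.of_finite]
            simp [integral_const_mul]
        _ ≤ _ := by nlinarith [hY2 i, sq_nonneg t]
    have hscore : ∀ X : Fin m → Fin n → Bool,
        ∑ j, (coordScore a T (X j) i - t) = m * (score a T X i - t) := by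
      intro X
      have : (m : ℝ) ≠ 0 := by exact_mod_cast hm.ne'
      simp only [Finset.sum_sub_distrib, score, Finset.sum_const, Finset.card_univ,
        Fintype.card_fin, nsmul_eq_mul]
      field_simp
    by_cases hi : i ∈ S
    · refine ⟨fun x => t - coordScore a T x i, fun x => by rw [abs_sub_comm]; exact hbd x,
        ?_, ?_, ?_⟩
      · refine le_of_eq_of_le (integral_congr_ae (ae_of_all _ fun x => ?_)) hsq
        simp only; ring
      · rw [integral_sub Integrable.of_finite Integrable.of_finite,
          integral_coordScore_of_mem hsymm a hi₀ hj₀ hij₀ hi]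
        simp only [integral_const, probReal_univ, smul_eq_mul, one_mul]
        have h1 : k - 1 - (μ - t) / (4 * μ) * k ≤ (((T ∩ S).erase i).card : ℝ) := by
          have := card_sub_le_card_inter_erase (S := S) (T := T) (i := i)
          linarith
        -- Since k ≤ 2 (k - 1), the loss of vertices relative to k becomes a loss relative to the k
        -- - 1 partners of i; this is why the tolerance has 4 μ in the denominator.
        have hq : (μ - t) / (4 * μ) * k ≤ (μ - t) / (2 * μ) * (k - 1) := by
          have h5 : (μ - t) / (2 * μ) * (k - 1) = (μ - t) / (4 * μ) * (2 * (k - 1)) := by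
            field_simp; ring
          rw [h5]
          refine mul_le_mul_of_nonneg_left (by linarith) (div_nonneg (by linarith) (by linarith))
        have hρa : 0 < ρ / a := by
          by_contra hneg
          have : (k - 1) * ρ / a ≤ 0 := by
            rw [mul_div_assoc]
            exact mul_nonpos_of_nonneg_of_nonpos (by linarith) (not_lt.1 hneg)
          linarith
        have h2 : (1 - (μ - t) / (2 * μ)) * ((k - 1) * ρ / a) ≤
            (((T ∩ S).erase i).card : ℝ) * ρ / a := by
          rw [mul_div_assoc, mul_div_assoc, ← mul_assoc]
          refine mul_le_mul_of_nonneg_right ?_ hρa.le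
          linarith
        have h3 : (1 - (μ - t) / (2 * μ)) * μ ≤ (1 - (μ - t) / (2 * μ)) * ((k - 1) * ρ / a) := by
          refine mul_le_mul_of_nonneg_left hsig ?_
          rw [sub_nonneg, div_le_one (by positivity)]; linarith
        have h4 : (1 - (μ - t) / (2 * μ)) * μ = t + (μ - t) / 2 := by field_simp; ring
        have : δ ≤ (μ - t) / 2 := min_le_right _ _
        linarith
      · intro X hX
        have h1 : i ∉ screen a t T X := fun h => hX ⟨fun _ => hi, fun _ => h⟩
        have h2 : score a T X i < t := by simpa [screen] using h1
        have h3 := hscore X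
        have h4 : ∑ j, (t - coordScore a T (X j) i) = -(m * (score a T X i - t)) := by
          rw [← h3, ← Finset.sum_neg_distrib]
          exact Finset.sum_congr rfl fun j _ => by ring
        simp only [h4]
        have : (0 : ℝ) < m := by exact_mod_cast hm
        nlinarith
    · refine ⟨fun x => coordScore a T x i - t, hbd, hsq, ?_, ?_⟩
      · rw [integral_sub Integrable.of_finite Integrable.of_finite,
          integral_coordScore_of_notMem hsymm a hi]
        simp only [integral_const, probReal_univ, smul_eq_mul, one_mul]
        have : δ ≤ t := min_le_left _ _
        linarith
      · intro X hX
        have h1 : i ∈ screen a t T X := by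
          by_contra h; exact hX ⟨fun h' => absurd h' h, fun h' => absurd h' hi⟩
        have h2 : t ≤ score a T X i := by simpa [screen] using h1
        simp only [hscore X]
        have : (0 : ℝ) < m := by exact_mod_cast hm
        nlinarith
  choose Z hZB hZV hZm hZ using hfail
  have hsub : {X : Fin m → Fin n → Bool | screen a t T X ≠ S} ⊆
      ⋃ i : Fin n, {X | 0 ≤ ∑ j, Z i (X j)} := by
    intro X hX
    have : ∃ i, ¬ (i ∈ screen a t T X ↔ i ∈ S) := by
      by_contra hne
      push Not at hne
      exact hX (Finset.ext hne)
    obtain ⟨i, hi⟩ := this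
    exact Set.mem_iUnion.2 ⟨i, hZ i X hi⟩
  refine (measureReal_mono hsub).trans ((measureReal_iUnion_fintype_le _).trans ?_)
  refine (Finset.sum_le_sum fun i _ => measureReal_sum_nonneg_le_exp_neg (P := plantedLaw ν θ S)
    (Measurable.of_discrete (f := Z i)) (B := t + 2) (V := 2 * t ^ 2 + 2 * (2 + 4 * K))
    (by positivity) (by positivity) hδ0 hr0 (hZB i) (hZV i) (hZm i) m).trans ?_
  rw [← hκ]
  simp

/-- Averaging over an independent random starting set. -/
theorem mul_le_measureReal_prod {Ω β ι : Type*} [Fintype ι] [MeasurableSpace Ω]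
    [MeasurableSpace β] (Q : Measure Ω) [IsProbabilityMeasure Q] (P : Measure β)
    [IsProbabilityMeasure P] (S' : Ω → ι) (hS' : ∀ T, MeasurableSet {ω | S' ω = T})
    (E : ι → Set β) (good : ι → Prop) {η : ℝ} (hη : ∀ T, good T → P.real (E T)ᶜ ≤ η)
    (hE : ∀ T, MeasurableSet (E T)) :
    Q.real {ω | good (S' ω)} * (1 - η) ≤ (Q.prod P).real {p | p.2 ∈ E (S' p.1)} := by
  classical
  -- Conditioning on the finitely many values of S' becomes a disjoint union of measurable
  -- rectangles, on which the product measure factors.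
  have hsub : (⋃ T ∈ Finset.univ.filter good, {ω | S' ω = T} ×ˢ E T) ⊆
      {p : Ω × β | p.2 ∈ E (S' p.1)} := by
    intro p hp
    simp only [Set.mem_iUnion, Set.mem_prod, Set.mem_ofPred_eq] at hp
    obtain ⟨T, _, h1, h2⟩ := hp
    simpa [h1] using h2
  refine le_trans ?_ (measureReal_mono hsub)
  rw [measureReal_biUnion_finset]
  · have hgood : {ω | good (S' ω)} = ⋃ T ∈ Finset.univ.filter good, {ω | S' ω = T} := by
      ext ω; simp
    rw [hgood, measureReal_biUnion_finset, Finset.sum_mul]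
    · refine Finset.sum_le_sum fun T hT => ?_
      rw [measureReal_prod_prod]
      refine mul_le_mul_of_nonneg_left ?_ measureReal_nonneg
      have h1 := hη T (Finset.mem_filter.1 hT).2
      rw [measureReal_compl (hE T), probReal_univ] at h1
      linarith
    · intro T _ T' _ hTT'
      refine Set.disjoint_left.2 fun ω h1 h2 => hTT' ?_
      rw [← h1, ← h2]
    · exact fun T _ => hS' T
  · intro T _ T' _ hTT'
    refine Set.disjoint_left.2 fun p h1 h2 => hTT' ?_
    rw [← h1.1, ← h2.1]
  · exact fun T _ => (hS' T).prod (hE T)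

/-- The whole probabilistic half: once ρ ≤ K a/k, any positive lower limit of the signal yields
exactness. The constant depends only on t, μ and K. -/
theorem exists_screeningExact {ν : Measure ℝ} [IsProbabilityMeasure ν] {θ : ℝ}
    (hsymm : ν.map (fun h : ℝ => -h) = ν) {a r : ℕ → ℝ} (ha : ∀ k, 1 ≤ k → 1 ≤ a k)
    (hr : ∀ k, 1 ≤ k → 1 ≤ r k) (har : ∀ k, 1 ≤ k → a k * r k = k) {K : ℝ} (hK : 0 ≤ K)
    (hρ : ∀ᶠ k : ℕ in atTop, ∀ (n : ℕ) (S : Finset (Fin n)), S.card = k →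
      ∀ i ∈ S, ∀ j ∈ S, i ≠ j → pairCorr ν θ S i j ≤ K * a k / k)
    {μ t : ℝ} (hμ : SignalAtLeast ν θ a μ) (ht : 0 < t) (htμ : t < μ) :
    ∃ C : ℝ, 0 < C ∧ ScreeningExact ν θ a r t C := by
  obtain ⟨κ, hκ⟩ : ∃ κ, κ = min t ((μ - t) / 2) * min (1 / (t + 2))
      (min t ((μ - t) / 2) / (2 * (2 * t ^ 2 + 2 * (2 + 4 * K)))) / 2 := ⟨_, rfl⟩
  have hδ0 : 0 < min t ((μ - t) / 2) := lt_min ht (by linarith)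
  have hκ0 : 0 < κ := by
    rw [hκ]
    refine div_pos (mul_pos hδ0 (lt_min (by positivity) (by positivity))) two_pos
  -- With this constant κ m/r ≥ 2 log n, so the union bound over n coordinates leaves n · n⁻² = 1/n
  -- ≤ 1/k, which tends to 0.
  refine ⟨2 / κ, by positivity, ?_⟩
  intro n m S Ω _ Q S' hQ hS' hS hm hQS
  have hε : 0 < (μ - t) / (4 * μ) := div_pos (by linarith) (by linarith)
  have hlim := (hQS _ hε).mul
    ((tendsto_const_nhds (x := (1 : ℝ))).sub
      (tendsto_inv_atTop_zero.comp (tendsto_natCast_atTop_atTop.comp hS)))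
  simp only [sub_zero, mul_one] at hlim
  refine tendsto_of_tendsto_of_tendsto_of_le_of_le' hlim tendsto_const_nhds ?_
    (Eventually.of_forall fun N => measureReal_le_one)
  filter_upwards [hS.eventually hρ, hS.eventually hμ, hS.eventually_ge_atTop 2, hm]
    with N h1 h2 h3 h4
  have hk1 : 1 ≤ (S N).card := by omega
  have hkn : (S N).card ≤ n N := by simpa using Finset.card_le_univ (S N)
  have hn2 : (2 : ℝ) ≤ n N := by exact_mod_cast h3.trans hkn
  have hlog : 0 < Real.log (n N) := Real.log_pos (by linarith)
  have hrk : 0 < r (S N).card := by linarith [hr _ hk1]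
  have hm0 : 0 < m N := by
    have : (0 : ℝ) < m N := lt_of_lt_of_le (by positivity) h4
    exact_mod_cast this
  have hP := fun T hT => measureReal_screen_ne_le (T := T) hsymm (ha _ hk1) (hr _ hk1)
    (har _ hk1) h3 hK (h1 _ _ rfl) (h2 _ _ rfl) ht htμ hT hm0 hκ
  have hbound : (n N : ℝ) * Real.exp (-κ * (m N / r (S N).card)) ≤ ((S N).card : ℝ)⁻¹ := by
    have e1 : 2 * Real.log (n N) ≤ κ * (m N / r (S N).card) := by
      rw [← mul_div_assoc, le_div_iff₀ hrk]
      have := mul_le_mul_of_nonneg_left h4 hκ0.le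
      calc _ = κ * (2 / κ * r (S N).card * Real.log (n N)) := by field_simp
        _ ≤ _ := this
    have e2 : Real.exp (-κ * (m N / r (S N).card)) ≤ ((n N : ℝ) ^ 2)⁻¹ := by
      calc _ ≤ Real.exp (-(2 * Real.log (n N))) := Real.exp_le_exp.2 (by linarith)
        _ = _ := by
          rw [Real.exp_neg, mul_comm, Real.exp_mul, Real.exp_log (by linarith)]
          norm_num
    calc (n N : ℝ) * Real.exp (-κ * (m N / r (S N).card))
        ≤ n N * ((n N : ℝ) ^ 2)⁻¹ := by gcongr
      _ = (n N : ℝ)⁻¹ := by field_simp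
      _ ≤ ((S N).card : ℝ)⁻¹ := by
          have hk1' : (0 : ℝ) < (S N).card := by exact_mod_cast hk1
          gcongr
  have := mul_le_measureReal_prod (Q N) (Measure.pi fun _ : Fin (m N) => plantedLaw ν θ (S N))
    (S' N) (hS' N) (fun T => {X | screen (a (S N).card) t T X = S N})
    (fun T => ((T ∆ S N).card : ℝ) ≤ (μ - t) / (4 * μ) * (S N).card)
    (fun T hT => (hP T hT).trans hbound) (fun T => Set.Finite.measurableSet (Set.toFinite _))
  exact this

/-! ### Integrals of product functions of the field -/

section iidField

variable {n : ℕ} {ν : Measure ℝ} [IsProbabilityMeasure ν]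

theorem integral_prod_field (S : Finset (Fin n)) (f : ℝ → ℝ) :
    ∫ h, ∏ i ∈ S, f (h i) ∂(iidField n ν) = (∫ s, f s ∂ν) ^ S.card := by
  classical
  have h1 : ∀ h : Fin n → ℝ, ∏ i ∈ S, f (h i) = ∏ i, (if i ∈ S then f (h i) else 1) := by
    intro h; simp [Finset.prod_ite_mem]
  simp only [h1]
  rw [integral_fintype_prod_eq_prod (μ := fun _ : Fin n => ν)
    (fun i s => if i ∈ S then f s else 1)]
  have h2 : ∀ i, ∫ s, (if i ∈ S then f s else 1) ∂ν = if i ∈ S then ∫ s, f s ∂ν else 1 := by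
    intro i; by_cases hi : i ∈ S <;> simp [hi]
  simp only [h2]
  rw [Finset.prod_ite_mem, Finset.univ_inter, Finset.prod_const]

theorem integral_field_apply (i : Fin n) (f : ℝ → ℝ) :
    ∫ h, f (h i) ∂(iidField n ν) = ∫ s, f s ∂ν := by
  simpa using integral_prod_field (ν := ν) {i} f

theorem integral_field_mul_field {i j : Fin n} (hij : i ≠ j) (f : ℝ → ℝ) :
    ∫ h, f (h i) * f (h j) ∂(iidField n ν) = (∫ s, f s ∂ν) ^ 2 := by
  simpa [Finset.prod_pair hij, Finset.card_pair hij] using integral_prod_field (ν := ν) {i, j} f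

theorem integral_sq_sum_field (S : Finset (Fin n)) {g : ℝ → ℝ} (hg : Continuous g) {B : ℝ}
    (hB : ∀ s, |g s| ≤ B) (h0 : ∫ s, g s ∂ν = 0) :
    ∫ h, (∑ i ∈ S, g (h i)) ^ 2 ∂(iidField n ν) = S.card * ∫ s, g s ^ 2 ∂ν := by
  have hint : ∀ i j : Fin n, Integrable (fun h : Fin n → ℝ => g (h i) * g (h j))
      (iidField n ν) := fun i j =>
    integrable_of_continuous_of_abs_le (by fun_prop) (B * B) fun h => by
      rw [abs_mul]
      exact mul_le_mul (hB _) (hB _) (abs_nonneg _) ((abs_nonneg _).trans (hB 0))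
  simp only [sq, Finset.sum_mul_sum]
  rw [integral_finsetSum _ fun i _ => integrable_finsetSum _ fun j _ => hint i j]
  have h1 : ∀ i ∈ S, ∫ h, ∑ j ∈ S, g (h i) * g (h j) ∂(iidField n ν) = ∫ s, g s * g s ∂ν := by
    intro i hi
    rw [integral_finsetSum _ fun j _ => hint i j, Finset.sum_eq_single i]
    · exact integral_field_apply i fun s => g s * g s
    · intro j _ hj
      rw [integral_field_mul_field hj.symm, h0]; ring
    · exact fun h => absurd hi h
  rw [Finset.sum_congr rfl h1, Finset.sum_const, nsmul_eq_mul]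

theorem integrable_of_continuous_real {g : ℝ → ℝ} (hg : Continuous g) {B : ℝ}
    (hB : ∀ s, |g s| ≤ B) : Integrable g ν :=
  Integrable.of_bound hg.aestronglyMeasurable B (ae_of_all _ hB)

theorem abs_integral_le_of_abs_le {g : ℝ → ℝ} {B : ℝ} (hB : ∀ s, |g s| ≤ B) :
    |∫ s, g s ∂ν| ≤ B := by
  simpa using norm_integral_le_of_norm_le_const (μ := ν) (f := g) (ae_of_all _ hB)

theorem integral_sq_centered_sum_field_le (S : Finset (Fin n)) {g : ℝ → ℝ} (hg : Continuous g)
    {B : ℝ} (hB : ∀ s, |g s| ≤ B) :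
    ∫ h, (∑ i ∈ S, (g (h i) - ∫ s, g s ∂ν)) ^ 2 ∂(iidField n ν) ≤ S.card * B ^ 2 := by
  set e := ∫ s, g s ∂ν with he
  have hi1 : Integrable g ν := integrable_of_continuous_real hg hB
  have hB0 : 0 ≤ B := (abs_nonneg _).trans (hB 0)
  have hi2 : Integrable (fun s => g s ^ 2) ν := integrable_of_continuous_real (by fun_prop)
    (B := B ^ 2) fun s => by rw [abs_pow]; exact pow_le_pow_left₀ (abs_nonneg _) (hB s) 2
  have hsub : ∫ s, (g s - e) ∂ν = 0 := by
    rw [integral_sub hi1 (integrable_const _)]; simp [he]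
  rw [integral_sq_sum_field S (g := fun s => g s - e) (by fun_prop) (B := B + B)
    (fun s => (abs_sub _ _).trans (add_le_add (hB s) (abs_integral_le_of_abs_le hB))) hsub]
  refine mul_le_mul_of_nonneg_left ?_ (Nat.cast_nonneg _)
  have h1 : ∫ s, (g s - e) ^ 2 ∂ν = ∫ s, g s ^ 2 ∂ν - e ^ 2 := by
    have : ∀ s, (g s - e) ^ 2 = g s ^ 2 - (2 * e) * g s + e ^ 2 := fun s => by ring
    simp only [this]
    have hi3 : Integrable (fun s => 2 * e * g s) ν := hi1.const_mul _
    have hi4 : Integrable (fun s => g s ^ 2 - 2 * e * g s) ν := hi2.sub hi3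
    rw [integral_add hi4 (integrable_const _), integral_sub hi2 hi3, integral_const_mul, ← he]
    simp; ring
  have h2 : ∫ s, g s ^ 2 ∂ν ≤ B ^ 2 := by
    refine (integral_mono hi2 (integrable_const (B ^ 2)) fun s => ?_).trans (by simp)
    rw [← sq_abs]; exact pow_le_pow_left₀ (abs_nonneg _) (hB s) 2
  nlinarith [sq_nonneg e]

/-- A function insensitive to the coordinate i is a function of the other coordinates, hence
independent of h_i. -/
theorem integral_mul_of_update_eq (i : Fin n) {f : ℝ → ℝ} (hf : Continuous f)
    {G : (Fin n → ℝ) → ℝ} (hG : Continuous G)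
    (hGi : ∀ h s, G (Function.update h i s) = G h) :
    ∫ h, f (h i) * G h ∂(iidField n ν) = (∫ s, f s ∂ν) * ∫ h, G h ∂(iidField n ν) := by
  classical
  have hind := (ProbabilityTheory.iIndepFun_pi (μ := fun _ : Fin n => ν)
    (X := fun _ s => s) fun _ => aemeasurable_id).indepFun_finset {i} (Finset.univ.erase i)
    (by simp) (fun j => measurable_pi_apply j)
  -- The missing coordinate is filled with 0; by `hGi` any value would do.
  set Φ : (↥(Finset.univ.erase i) → ℝ) → ℝ := fun r =>
    G fun j => if hj : j ∈ Finset.univ.erase i then r ⟨j, hj⟩ else 0 with hΦ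
  have hΦc : Continuous Φ := by
    refine hG.comp (continuous_pi fun j => ?_)
    by_cases hj : j ∈ Finset.univ.erase i
    · simp only [hj, dif_pos]; exact continuous_apply _
    · simp only [hj, dif_neg, not_false_iff]; exact continuous_const
  have hΦG : ∀ h : Fin n → ℝ, Φ (fun j => h j) = G h := by
    intro h
    rw [← hGi h 0]
    refine congrArg G (funext fun j => ?_)
    by_cases hj : j = i
    · subst hj; simp
    · simp [hj]
  have h2 := hind.comp (φ := fun r : ↥({i} : Finset (Fin n)) → ℝ =>
    f (r ⟨i, Finset.mem_singleton_self i⟩)) (ψ := Φ) (by fun_prop) hΦc.measurable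
  have h3 := h2.integral_mul_eq_mul_integral
    (Continuous.aestronglyMeasurable (by fun_prop))
    (hΦc.comp (by fun_prop)).aestronglyMeasurable
  simp only [Pi.mul_apply, Function.comp_def, hΦG] at h3
  rw [h3, integral_field_apply]

end iidField

/-! ### The cavity decomposition at a clique vertex -/

/-- The sum of the spins of the clique other than the one at `i`. -/
noncomputable def cavitySum {n : ℕ} (S : Finset (Fin n)) (i : Fin n) (x : Fin n → Bool) : ℝ :=
  ∑ l ∈ S.erase i, spin (x l)

/-- The part of the Gibbs weight which does not involve the spin and the field at `i`. -/
noncomputable def cavityWeight {n : ℕ} (θ : ℝ) (S : Finset (Fin n)) (i : Fin n) (h : Fin n → ℝ)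
    (x : Fin n → Bool) : ℝ :=
  Real.exp (θ / (2 * (S.card : ℝ)) * (cavitySum S i x ^ 2 + 1) +
    ∑ j ∈ Finset.univ.erase i, h j * spin (x j))

/-- The interaction part of the local field acting on the spin at `i`. -/
noncomputable def cavityField {n : ℕ} (θ : ℝ) (S : Finset (Fin n)) (i : Fin n)
    (x : Fin n → Bool) : ℝ := θ / S.card * cavitySum S i x

section cavity

variable {n : ℕ} {θ : ℝ} {S : Finset (Fin n)} {i : Fin n}

theorem cavityWeight_pos (h : Fin n → ℝ) (x : Fin n → Bool) : 0 < cavityWeight θ S i h x :=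
  Real.exp_pos _

theorem cavitySum_add_spin (hi : i ∈ S) (x : Fin n → Bool) :
    ∑ l ∈ S, spin (x l) = cavitySum S i x + spin (x i) :=
  (Finset.sum_erase_add _ _ hi).symm

theorem cavitySum_flipAt (x : Fin n → Bool) : cavitySum S i (flipAt i x) = cavitySum S i x :=
  sum_spin_flipAt (Finset.notMem_erase i S) x

theorem cavityField_flipAt (x : Fin n → Bool) :
    cavityField θ S i (flipAt i x) = cavityField θ S i x := by
  unfold cavityField; rw [cavitySum_flipAt]

theorem cavityWeight_flipAt (h : Fin n → ℝ) (x : Fin n → Bool) :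
    cavityWeight θ S i h (flipAt i x) = cavityWeight θ S i h x := by
  unfold cavityWeight
  rw [cavitySum_flipAt]
  congr 2
  exact Finset.sum_congr rfl fun j hj => by rw [flipAt_of_ne (Finset.ne_of_mem_erase hj)]

theorem cavityWeight_update (h : Fin n → ℝ) (s : ℝ) (x : Fin n → Bool) :
    cavityWeight θ S i (Function.update h i s) x = cavityWeight θ S i h x := by
  unfold cavityWeight
  congr 2
  exact Finset.sum_congr rfl fun j hj => by
    rw [Function.update_of_ne (Finset.ne_of_mem_erase hj)]

theorem negAt_eq_update (h : Fin n → ℝ) : negAt i h = Function.update h i (-h i) := by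
  ext j
  by_cases hj : j = i
  · subst hj; simp [negAt]
  · simp [negAt, hj]

/-- Expand (M + σ_i)² = M² + 1 + 2 M σ_i, using σ_i² = 1: the first two terms belong to the cavity
weight, the cross term is the local field at i. -/
theorem gibbsWeight_eq_cavity (hi : i ∈ S) (h : Fin n → ℝ) (x : Fin n → Bool) :
    gibbsWeight θ S h x =
      cavityWeight θ S i h x * Real.exp (spin (x i) * (cavityField θ S i x + h i)) := by
  have hk : (S.card : ℝ) ≠ 0 := by exact_mod_cast (Finset.card_pos.2 ⟨i, hi⟩).ne'
  unfold gibbsWeight cavityWeight cavityField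
  rw [← Real.exp_add, cavitySum_add_spin hi, ← Finset.sum_erase_add _ _ (Finset.mem_univ i)]
  congr 1
  have := spin_mul_self (x i)
  field_simp
  linear_combination θ * this

theorem exp_spin_average (b : Bool) (u : ℝ) :
    (Real.exp (spin b * u) + Real.exp (spin (!b) * u)) / 2 = Real.cosh u := by
  rw [Real.cosh_eq]; cases b <;> simp [spin]; ring

theorem spin_mul_exp_spin_average (b : Bool) (u : ℝ) :
    (spin b * Real.exp (spin b * u) + spin (!b) * Real.exp (spin (!b) * u)) / 2 =
      Real.sinh u := by
  rw [Real.sinh_eq]; cases b <;> simp [spin] <;> ring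

theorem sum_gibbsWeight_mul_of_flip (hi : i ∈ S) (h : Fin n → ℝ) {f : (Fin n → Bool) → ℝ}
    (hf : ∀ x, f (flipAt i x) = f x) :
    ∑ x, gibbsWeight θ S h x * f x =
      ∑ x, cavityWeight θ S i h x * f x * Real.cosh (cavityField θ S i x + h i) := by
  rw [sum_eq_sum_flip_average i]
  refine Finset.sum_congr rfl fun x _ => ?_
  rw [gibbsWeight_eq_cavity hi, gibbsWeight_eq_cavity hi, cavityWeight_flipAt,
    cavityField_flipAt, hf, flipAt_self, ← exp_spin_average (x i)]
  ring

theorem sum_gibbsWeight_mul_spin_of_flip (hi : i ∈ S) (h : Fin n → ℝ)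
    {f : (Fin n → Bool) → ℝ} (hf : ∀ x, f (flipAt i x) = f x) :
    ∑ x, gibbsWeight θ S h x * (f x * spin (x i)) =
      ∑ x, cavityWeight θ S i h x * f x * Real.sinh (cavityField θ S i x + h i) := by
  rw [sum_eq_sum_flip_average i]
  refine Finset.sum_congr rfl fun x _ => ?_
  rw [gibbsWeight_eq_cavity hi, gibbsWeight_eq_cavity hi, cavityWeight_flipAt,
    cavityField_flipAt, hf, flipAt_self, ← spin_mul_exp_spin_average (x i)]
  ring

/-- The conditional mean of the spin at `i` given the other spins. -/
theorem gibbsMean_mul_spin_sub_tanh (hi : i ∈ S) (h : Fin n → ℝ) {f : (Fin n → Bool) → ℝ}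
    (hf : ∀ x, f (flipAt i x) = f x) :
    gibbsMean θ S h (fun x => f x * (spin (x i) - Real.tanh (cavityField θ S i x + h i))) = 0 := by
  simp only [mul_sub]
  rw [gibbsMean_sub, gibbsMean_eq_div, gibbsMean_eq_div, sum_gibbsWeight_mul_spin_of_flip hi h hf,
    sum_gibbsWeight_mul_of_flip hi h fun x => by rw [hf, cavityField_flipAt], sub_eq_zero]
  congr 1
  refine Finset.sum_congr rfl fun x _ => ?_
  rw [Real.tanh_eq_sinh_div_cosh]
  have := (Real.cosh_pos (cavityField θ S i x + h i)).ne'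
  field_simp

theorem abs_cavitySum_le (x : Fin n → Bool) : |cavitySum S i x| ≤ S.card :=
  (abs_sum_spin_le _ x).trans (by exact_mod_cast Finset.card_le_card (Finset.erase_subset i S))

theorem abs_cavityField_le (hθ : 0 ≤ θ) (hi : i ∈ S) (x : Fin n → Bool) :
    |cavityField θ S i x| ≤ θ := by
  have hk : (0 : ℝ) < S.card := by exact_mod_cast Finset.card_pos.2 ⟨i, hi⟩
  unfold cavityField
  rw [abs_mul, abs_of_nonneg (by positivity), div_mul_eq_mul_div, div_le_iff₀ hk]
  exact mul_le_mul_of_nonneg_left (abs_cavitySum_le x) hθ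

end cavity

/-! ### Hyperbolic inequalities for the cavity argument. -/

theorem cosh_add_le (y s : ℝ) : Real.cosh (y + s) ≤ Real.exp |y| * Real.cosh s := by
  rw [Real.cosh_eq, Real.cosh_eq, neg_add, Real.exp_add, Real.exp_add]
  have h1 : Real.exp y ≤ Real.exp |y| := Real.exp_le_exp.2 (le_abs_self y)
  have h2 : Real.exp (-y) ≤ Real.exp |y| := Real.exp_le_exp.2 (neg_le_abs y)
  nlinarith [Real.exp_pos s, Real.exp_pos (-s)]

theorem le_cosh_add (y s : ℝ) : Real.exp (-|y|) * Real.cosh s ≤ Real.cosh (y + s) := by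
  have := cosh_add_le (-y) (y + s)
  rw [neg_add_cancel_left, abs_neg] at this
  rw [Real.exp_neg, inv_mul_le_iff₀ (Real.exp_pos _)]
  exact this

theorem self_mul_self_le_mul_sinh (c x : ℝ) (hc : 0 ≤ c) : c * x ^ 2 ≤ x * Real.sinh (c * x) := by
  rcases le_total 0 x with hx | hx
  · have := Real.self_le_sinh_iff.2 (mul_nonneg hc hx)
    nlinarith
  · have := Real.sinh_le_self_iff.2 (mul_nonpos_of_nonneg_of_nonpos hc hx)
    nlinarith

/-- By the addition formulas the right side equals (M + M') sinh(c(M + M')) + (M - M') sinh(c(M -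
M')) cosh 2s. Now y sinh(c y) ≥ c y² and cosh 2s ≥ 1, and the two squares add up to 2 (M² + M'²). -/
theorem symmetrized_sinh_cosh (c M M' s : ℝ) (hc : 0 ≤ c) :
    2 * c * (M ^ 2 + M' ^ 2) ≤
      M * (Real.sinh (c * M + s) * Real.cosh (c * M' - s) +
        Real.sinh (c * M - s) * Real.cosh (c * M' + s)) +
      M' * (Real.sinh (c * M' + s) * Real.cosh (c * M - s) +
        Real.sinh (c * M' - s) * Real.cosh (c * M + s)) := by
  have h1 := self_mul_self_le_mul_sinh c (M + M') hc
  have h2 := self_mul_self_le_mul_sinh c (M - M') hc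
  have h3 : 1 ≤ Real.cosh (2 * s) := Real.one_le_cosh _
  have h4 : 0 ≤ (M - M') * Real.sinh (c * (M - M')) := le_trans (by positivity) h2
  have h5 : M * (Real.sinh (c * M + s) * Real.cosh (c * M' - s) +
        Real.sinh (c * M - s) * Real.cosh (c * M' + s)) +
      M' * (Real.sinh (c * M' + s) * Real.cosh (c * M - s) +
        Real.sinh (c * M' - s) * Real.cosh (c * M + s)) =
      (M + M') * Real.sinh (c * (M + M')) +
        (M - M') * Real.sinh (c * (M - M')) * Real.cosh (2 * s) := by
    rw [mul_add c, mul_sub c, two_mul]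
    simp only [Real.sinh_add, Real.cosh_add, Real.sinh_sub, Real.cosh_sub]
    linear_combination (M + M') * (Real.sinh (c * M) * Real.cosh (c * M') +
      Real.cosh (c * M) * Real.sinh (c * M')) * Real.cosh_sq s
  rw [h5]
  nlinarith

/-! ### A lower bound on the correlations at every temperature -/

/-- The second moment of the cavity sum under the normalised cavity weight. -/
noncomputable def cavitySecondMoment {n : ℕ} (θ : ℝ) (S : Finset (Fin n)) (i : Fin n)
    (h : Fin n → ℝ) : ℝ :=
  (∑ x, cavityWeight θ S i h x * cavitySum S i x ^ 2) / ∑ x, cavityWeight θ S i h x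

section lower

variable {n : ℕ} {θ : ℝ} {S : Finset (Fin n)} {i : Fin n}

theorem sum_cavityWeight_pos (h : Fin n → ℝ) : 0 < ∑ x, cavityWeight θ S i h x :=
  Finset.sum_pos (fun y _ => cavityWeight_pos h y) Finset.univ_nonempty

theorem cavitySecondMoment_nonneg (h : Fin n → ℝ) : 0 ≤ cavitySecondMoment θ S i h :=
  div_nonneg (Finset.sum_nonneg fun x _ => mul_nonneg (cavityWeight_pos h x).le (sq_nonneg _))
    (sum_cavityWeight_pos h).le

theorem cavitySecondMoment_le (h : Fin n → ℝ) : cavitySecondMoment θ S i h ≤ (S.card : ℝ) ^ 2 := by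
  unfold cavitySecondMoment
  rw [div_le_iff₀ (sum_cavityWeight_pos h), Finset.mul_sum]
  refine Finset.sum_le_sum fun x _ => ?_
  rw [mul_comm]
  refine mul_le_mul_of_nonneg_right ?_ (cavityWeight_pos h x).le
  rw [← sq_abs]
  exact pow_le_pow_left₀ (abs_nonneg _) (abs_cavitySum_le x) 2

theorem continuous_cavitySecondMoment : Continuous (cavitySecondMoment θ S i) := by
  have hc : ∀ x, Continuous fun h : Fin n → ℝ => cavityWeight θ S i h x := by
    intro x; unfold cavityWeight; fun_prop
  unfold cavitySecondMoment
  exact (continuous_finsetSum _ fun x _ => (hc x).mul continuous_const).div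
    (continuous_finsetSum _ fun x _ => hc x) fun h => (sum_cavityWeight_pos h).ne'

theorem cavitySecondMoment_update (h : Fin n → ℝ) (s : ℝ) :
    cavitySecondMoment θ S i (Function.update h i s) = cavitySecondMoment θ S i h := by
  simp only [cavitySecondMoment, cavityWeight_update]

theorem sum_gibbsWeight_eq_cavity (hi : i ∈ S) (h : Fin n → ℝ) :
    ∑ x, gibbsWeight θ S h x =
      ∑ x, cavityWeight θ S i h x * Real.cosh (cavityField θ S i x + h i) := by
  simpa using sum_gibbsWeight_mul_of_flip (θ := θ) hi h (f := fun _ => 1) fun _ => rfl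

theorem sum_gibbsWeight_le_cavity (hθ : 0 ≤ θ) (hi : i ∈ S) (h : Fin n → ℝ) :
    ∑ x, gibbsWeight θ S h x ≤
      Real.exp θ * Real.cosh (h i) * ∑ x, cavityWeight θ S i h x := by
  rw [sum_gibbsWeight_eq_cavity hi, Finset.mul_sum]
  refine Finset.sum_le_sum fun x _ => ?_
  rw [mul_comm]
  refine mul_le_mul_of_nonneg_right ((cosh_add_le _ _).trans ?_) (cavityWeight_pos h x).le
  exact mul_le_mul_of_nonneg_right (Real.exp_le_exp.2 (abs_cavityField_le hθ hi x))
    (Real.cosh_pos _).le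

theorem le_sum_gibbsWeight (hθ : 0 ≤ θ) (hi : i ∈ S) (h : Fin n → ℝ) :
    Real.exp (-θ) * Real.cosh (h i) * ∑ x, cavityWeight θ S i h x ≤
      ∑ x, gibbsWeight θ S h x := by
  rw [sum_gibbsWeight_eq_cavity hi, Finset.mul_sum]
  refine Finset.sum_le_sum fun x _ => ?_
  rw [mul_comm]
  refine mul_le_mul_of_nonneg_left (le_trans ?_ (le_cosh_add _ _)) (cavityWeight_pos h x).le
  exact mul_le_mul_of_nonneg_right
    (Real.exp_le_exp.2 (neg_le_neg (abs_cavityField_le hθ hi x))) (Real.cosh_pos _).le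

/-- The interaction field is at most θ in absolute value, so reinstating the spin at i changes
numerator and denominator by a factor e^θ each, up to the common cosh h_i. -/
theorem gibbsMean_sq_cavitySum_le (hθ : 0 ≤ θ) (hi : i ∈ S) (h : Fin n → ℝ) :
    gibbsMean θ S h (fun x => cavitySum S i x ^ 2) ≤
      Real.exp (2 * θ) * cavitySecondMoment θ S i h := by
  have hA := sum_cavityWeight_pos (θ := θ) (S := S) (i := i) h
  have hc := Real.cosh_pos (h i)
  rw [gibbsMean_eq_div, sum_gibbsWeight_mul_of_flip hi h fun x => by rw [cavitySum_flipAt],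
    div_le_iff₀ sum_gibbsWeight_pos]
  have h1 : ∑ x, cavityWeight θ S i h x * cavitySum S i x ^ 2 *
      Real.cosh (cavityField θ S i x + h i) ≤
      Real.exp θ * Real.cosh (h i) * ∑ x, cavityWeight θ S i h x * cavitySum S i x ^ 2 := by
    rw [Finset.mul_sum]
    refine Finset.sum_le_sum fun x _ => ?_
    rw [mul_comm]
    refine mul_le_mul_of_nonneg_right ((cosh_add_le _ _).trans ?_)
      (mul_nonneg (cavityWeight_pos h x).le (sq_nonneg _))
    exact mul_le_mul_of_nonneg_right (Real.exp_le_exp.2 (abs_cavityField_le hθ hi x)) hc.le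
  refine h1.trans ?_
  have h2 := mul_le_mul_of_nonneg_left (le_sum_gibbsWeight hθ hi h)
    (mul_nonneg (Real.exp_pos (2 * θ)).le (cavitySecondMoment_nonneg (θ := θ) (S := S) (i := i) h))
  refine le_trans (le_of_eq ?_) h2
  unfold cavitySecondMoment
  have h3 : Real.exp (2 * θ) * Real.exp (-θ) = Real.exp θ := by
    rw [← Real.exp_add]; congr 1; ring
  rw [← h3]
  field_simp

/-- For a fixed field the average of M σ_i may be negative. Adding the average for the reversed h_i
cures this: over the common denominator the numerator is a sum over two replicas, bounded below by
`symmetrized_sinh_cosh`. -/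
theorem le_gibbsMean_add_gibbsMean_negAt (hθ : 0 ≤ θ) (hi : i ∈ S) (h : Fin n → ℝ) :
    2 * (θ / S.card * Real.exp (-(2 * θ)) *
      (1 / Real.cosh (h i) ^ 2 * cavitySecondMoment θ S i h)) ≤
    gibbsMean θ S h (fun x => cavitySum S i x * spin (x i)) +
      gibbsMean θ S (negAt i h) (fun x => cavitySum S i x * spin (x i)) := by
  have hk : (0 : ℝ) < S.card := by exact_mod_cast Finset.card_pos.2 ⟨i, hi⟩
  set W := cavityWeight θ S i h with hW
  set M := cavitySum S i with hM
  set s := h i with hs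
  have hWn : cavityWeight θ S i (negAt i h) = W := by
    ext x; rw [negAt_eq_update, cavityWeight_update]
  have hneg : negAt i h i = -s := by simp [negAt, hs]
  have hA := sum_cavityWeight_pos (θ := θ) (S := S) (i := i) h
  have hB : 0 ≤ ∑ x, W x * M x ^ 2 :=
    Finset.sum_nonneg fun x _ => mul_nonneg (cavityWeight_pos h x).le (sq_nonneg _)
  have hZ1 : 0 < ∑ x, gibbsWeight θ S h x := sum_gibbsWeight_pos
  have hZ2 : 0 < ∑ x, gibbsWeight θ S (negAt i h) x := sum_gibbsWeight_pos
  have hU1 := sum_gibbsWeight_le_cavity hθ hi h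
  have hU2 := sum_gibbsWeight_le_cavity hθ hi (negAt i h)
  rw [hWn, hneg, Real.cosh_neg] at hU2
  rw [gibbsMean_eq_div, gibbsMean_eq_div,
    sum_gibbsWeight_mul_spin_of_flip hi h fun x => cavitySum_flipAt x,
    sum_gibbsWeight_mul_spin_of_flip hi (negAt i h) fun x => cavitySum_flipAt x, hWn, hneg]
  have e1 := sum_gibbsWeight_eq_cavity (θ := θ) hi h
  have e2 := sum_gibbsWeight_eq_cavity (θ := θ) hi (negAt i h)
  rw [hWn, hneg] at e2
  rw [div_add_div _ _ hZ1.ne' hZ2.ne', le_div_iff₀ (mul_pos hZ1 hZ2)]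
  have key : 2 * (θ / S.card) * ((∑ x, W x * M x ^ 2) * ∑ x, W x) ≤
      (∑ x, W x * M x * Real.sinh (cavityField θ S i x + s)) *
        (∑ x, gibbsWeight θ S (negAt i h) x) +
      (∑ x, gibbsWeight θ S h x) *
        ∑ x, W x * M x * Real.sinh (cavityField θ S i x + -s) := by
    rw [e1, e2, mul_comm (∑ x, W x * Real.cosh _)]
    rw [Finset.sum_mul_sum, Finset.sum_mul_sum, Finset.sum_mul_sum]
    have hsym : ∀ F : (Fin n → Bool) → (Fin n → Bool) → ℝ,
        2 * ∑ x, ∑ y, F x y = ∑ x, ∑ y, (F x y + F y x) := by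
      intro F
      simp only [Finset.sum_add_distrib]
      rw [Finset.sum_comm (f := fun x y => F y x)]; ring
    rw [← Finset.sum_add_distrib]
    simp only [← Finset.sum_add_distrib, Finset.mul_sum]
    -- Doubling and exchanging the replicas x and y symmetrises both sides, so the inequality can be
    -- checked term by term.
    rw [← mul_le_mul_iff_right₀ (two_pos (α := ℝ)), hsym, hsym]
    refine Finset.sum_le_sum fun x _ => Finset.sum_le_sum fun y _ => ?_
    have := mul_le_mul_of_nonneg_left
      (symmetrized_sinh_cosh (θ / S.card) (M x) (M y) s (by positivity))
      (mul_nonneg (cavityWeight_pos (θ := θ) (S := S) (i := i) h x).le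
        (cavityWeight_pos (θ := θ) (S := S) (i := i) h y).le)
    refine le_trans (le_of_eq ?_) (this.trans (le_of_eq ?_))
    · rw [← hW]; ring
    · simp only [cavityField, ← hM, ← hW, sub_eq_add_neg]; ring
  refine le_trans ?_ key
  -- The product of the two partition functions is at most e^(2θ) cosh² h_i times the squared cavity
  -- mass: this is the source of e^(-2θ) and of sech² h_i.
  have hprod := mul_le_mul hU1 hU2 hZ2.le (hZ1.le.trans hU1)
  have hcoef : 0 ≤ 2 * (θ / S.card * Real.exp (-(2 * θ)) *
      (1 / Real.cosh s ^ 2 * cavitySecondMoment θ S i h)) := by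
    have := cavitySecondMoment_nonneg (θ := θ) (S := S) (i := i) h
    positivity
  refine (mul_le_mul_of_nonneg_left hprod hcoef).trans (le_of_eq ?_)
  have hcs := (Real.cosh_pos s).ne'
  have hee : Real.exp (-(2 * θ)) * Real.exp θ * Real.exp θ = 1 := by
    rw [← Real.exp_add, ← Real.exp_add]; simp; ring
  unfold cavitySecondMoment
  have hA' : (∑ x, cavityWeight θ S i h x) ≠ 0 := hA.ne'
  simp only [← hW, ← hM, ← hs] at hA' ⊢
  calc _ = 2 * (θ / S.card) * (Real.exp (-(2 * θ)) * Real.exp θ * Real.exp θ) *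
        ((∑ x, W x * M x ^ 2) * ∑ x, W x) := by field_simp
    _ = _ := by rw [hee, mul_one]

/-- In every temperature regime the correlation of two clique vertices is at least of the order
of the inverse size of the clique. -/
theorem le_pairCorr {ν : Measure ℝ} [IsProbabilityMeasure ν]
    (hsymm : ν.map (fun h : ℝ => -h) = ν) (hθ : 0 ≤ θ) {j : Fin n} (hi : i ∈ S) (hj : j ∈ S)
    (hij : i ≠ j) :
    θ / S.card * Real.exp (-(4 * θ)) * meanSechSq ν ≤ pairCorr ν θ S i j := by
  set k : ℝ := (S.card : ℝ) with hk
  set ρ := pairCorr ν θ S i j with hρ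
  have hk2 : (2 : ℝ) ≤ k := by
    rw [hk]; exact_mod_cast Finset.one_lt_card.2 ⟨i, hi, j, hj, hij⟩
  have hv0 : 0 ≤ meanSechSq ν := integral_nonneg fun s => by positivity
  have hcard : ((S.erase i).card : ℝ) = k - 1 := by
    rw [Finset.card_erase_of_mem hi, Nat.cast_sub (Finset.card_pos.2 ⟨i, hi⟩), Nat.cast_one]
  have hmean : ∫ h, gibbsMean θ S h (fun x => cavitySum S i x * spin (x i)) ∂(iidField n ν) =
      (k - 1) * ρ := by
    rw [← integral_plantedLaw]
    have := integral_coordScore_clique ν θ 1 hi hj hij hi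
    simp only [coordScore, div_one] at this
    rw [← this]
    simp only [cavitySum, mul_comm]
  have hsq : ∫ h, gibbsMean θ S h (fun x => cavitySum S i x ^ 2) ∂(iidField n ν) =
      (k - 1) + (k - 1) * (k - 2) * ρ := by
    rw [← integral_plantedLaw]
    simp only [cavitySum]
    rw [integral_sq_sum_spin]
    have : ∀ l ∈ S.erase i, ∑ l' ∈ S.erase i, pairCorr ν θ S l l' = 1 + (k - 2) * ρ := by
      intro l hl
      rw [← Finset.add_sum_erase _ _ hl, pairCorr_self, Finset.sum_congr rfl fun l' hl' =>
        pairCorr_eq_of_mem ν θ (Finset.mem_of_mem_erase hl)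
          (Finset.mem_of_mem_erase (Finset.mem_of_mem_erase hl')) hi hj
          (Finset.ne_of_mem_erase hl').symm hij]
      rw [Finset.sum_const, Finset.card_erase_of_mem hl, nsmul_eq_mul,
        Nat.cast_sub (Finset.card_pos.2 ⟨l, hl⟩), hcard, Nat.cast_one]
      ring
    rw [Finset.sum_congr rfl this, Finset.sum_const, nsmul_eq_mul, hcard]
    ring
  have hcint : Integrable (cavitySecondMoment θ S i) (iidField n ν) :=
    integrable_of_continuous_of_abs_le continuous_cavitySecondMoment (k ^ 2) fun h => by
      rw [abs_of_nonneg (cavitySecondMoment_nonneg h)]; exact cavitySecondMoment_le h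
  have hsech : Continuous fun s => 1 / Real.cosh s ^ 2 :=
    continuous_const.div (by fun_prop) fun s => by have := Real.cosh_pos s; positivity
  have hsech1 : ∀ s, |1 / Real.cosh s ^ 2| ≤ 1 := by
    intro s
    have := Real.one_le_cosh s
    rw [abs_of_nonneg (by positivity), div_le_one (by positivity)]
    exact one_le_pow₀ this
  have hsint : Integrable (fun h : Fin n → ℝ =>
      1 / Real.cosh (h i) ^ 2 * cavitySecondMoment θ S i h) (iidField n ν) :=
    integrable_of_continuous_of_abs_le
      ((hsech.comp (continuous_apply i)).mul continuous_cavitySecondMoment) (1 * k ^ 2)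
      fun h => by
        rw [abs_mul]
        refine mul_le_mul (hsech1 _) ?_ (abs_nonneg _) zero_le_one
        rw [abs_of_nonneg (cavitySecondMoment_nonneg h)]; exact cavitySecondMoment_le h
  -- The cavity second moment does not involve h_i, so the average of sech² h_i factors out.
  have hcav : (θ / k * Real.exp (-(2 * θ))) *
      (meanSechSq ν * ∫ h, cavitySecondMoment θ S i h ∂(iidField n ν)) ≤ (k - 1) * ρ := by
    have hgc : Continuous fun h : Fin n → ℝ =>
        gibbsMean θ S h (fun x => cavitySum S i x * spin (x i)) :=
      continuous_gibbsMean θ S (f := fun _ x => cavitySum S i x * spin (x i))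
        fun x => continuous_const
    have hgi := integrable_gibbsMean ν θ S (fun x => cavitySum S i x * spin (x i))
    have hgin : Integrable (fun h : Fin n → ℝ =>
        gibbsMean θ S (negAt i h) (fun x => cavitySum S i x * spin (x i))) (iidField n ν) :=
      (measurePreserving_negAt hsymm i).integrable_comp_of_integrable hgi
    have h1 := integral_mono (hsint.const_mul (θ / k * Real.exp (-(2 * θ))) |>.const_mul 2)
      (hgi.add hgin) fun h => le_gibbsMean_add_gibbsMean_negAt hθ hi h
    simp only [Pi.add_apply] at h1
    rw [integral_add hgi hgin, integral_comp_negAt hsymm i hgc, hmean, integral_const_mul,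
      integral_const_mul, integral_mul_of_update_eq i hsech continuous_cavitySecondMoment
        cavitySecondMoment_update] at h1
    unfold meanSechSq
    linarith
  have hcavpos : 0 ≤ ∫ h, cavitySecondMoment θ S i h ∂(iidField n ν) :=
    integral_nonneg fun h => cavitySecondMoment_nonneg h
  have hρ0 : 0 ≤ ρ := by
    have : 0 ≤ (k - 1) * ρ := le_trans (by positivity) hcav
    exact nonneg_of_mul_nonneg_right this (by linarith)
  -- Now that ρ ≥ 0 is known, the off-diagonal part of the second moment is dropped and only the
  -- diagonal k - 1 is kept.
  have h2 : k - 1 ≤ Real.exp (2 * θ) * ∫ h, cavitySecondMoment θ S i h ∂(iidField n ν) := by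
    rw [← integral_const_mul]
    refine le_trans ?_ (integral_mono (integrable_gibbsMean ν θ S _) (hcint.const_mul _)
      fun h => gibbsMean_sq_cavitySum_le hθ hi h)
    rw [hsq]
    have : 0 ≤ (k - 1) * (k - 2) * ρ :=
      mul_nonneg (mul_nonneg (by linarith) (by linarith)) hρ0
    linarith
  have h3 : (k - 1) * (θ / k * Real.exp (-(4 * θ)) * meanSechSq ν) ≤ (k - 1) * ρ := by
    refine le_trans ?_ hcav
    have he : Real.exp (-(4 * θ)) * Real.exp (2 * θ) = Real.exp (-(2 * θ)) := by
      rw [← Real.exp_add]; congr 1; ring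
    rw [← he]
    have := mul_le_mul_of_nonneg_left h2
      (show 0 ≤ θ / k * Real.exp (-(4 * θ)) * meanSechSq ν by positivity)
    linarith
  exact le_of_mul_le_mul_left h3 (by linarith)

end lower

/-! ### Smoothness of the potential -/

theorem hasDerivAt_tanh (x : ℝ) : HasDerivAt Real.tanh (1 - Real.tanh x ^ 2) x := by
  have hc := (Real.cosh_pos x).ne'
  have h := (Real.hasDerivAt_sinh x).div (Real.hasDerivAt_cosh x) hc
  have he : Real.tanh = Real.sinh / Real.cosh := by
    ext y; simp [Real.tanh_eq_sinh_div_cosh]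
  rw [he]
  refine h.congr_deriv ?_
  simp only [Pi.div_apply]
  field_simp

theorem continuous_tanh : Continuous Real.tanh :=
  continuous_iff_continuousAt.2 fun x => (hasDerivAt_tanh x).continuousAt

theorem abs_tanh_le_one (x : ℝ) : |Real.tanh x| ≤ 1 := (Real.abs_tanh_lt_one x).le

theorem one_sub_tanh_sq (x : ℝ) : 1 - Real.tanh x ^ 2 = 1 / Real.cosh x ^ 2 := by
  have hc := (Real.cosh_pos x).ne'
  have := Real.cosh_sq x
  rw [Real.tanh_eq_sinh_div_cosh]
  field_simp
  linarith

theorem abs_one_sub_tanh_sq_le (x : ℝ) : |1 - Real.tanh x ^ 2| ≤ 1 := by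
  have h1 : Real.tanh x ^ 2 ≤ 1 := by
    rw [← sq_abs]; exact pow_le_one₀ (abs_nonneg _) (abs_tanh_le_one x)
  rw [abs_of_nonneg (by linarith)]
  nlinarith [sq_nonneg (Real.tanh x)]

theorem log_cosh_add_le (y s : ℝ) :
    Real.log (Real.cosh (y + s)) ≤ |y| + Real.log (Real.cosh s) := by
  have h := Real.log_le_log (Real.cosh_pos _) (cosh_add_le y s)
  rwa [Real.log_mul (Real.exp_pos _).ne' (Real.cosh_pos s).ne', Real.log_exp] at h

theorem abs_log_cosh_add_sub_le (y s : ℝ) :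
    |Real.log (Real.cosh (y + s)) - Real.log (Real.cosh s)| ≤ |y| := by
  have h1 := log_cosh_add_le y s
  have h2 := log_cosh_add_le (-y) (y + s)
  rw [neg_add_cancel_left, abs_neg] at h2
  rw [abs_le]; constructor <;> linarith

theorem continuous_log_cosh : Continuous fun s => Real.log (Real.cosh s) :=
  Real.continuous_cosh.log fun s => (Real.cosh_pos s).ne'

theorem hasDerivAt_log_cosh (x : ℝ) :
    HasDerivAt (fun s => Real.log (Real.cosh s)) (Real.tanh x) x := by
  have := (Real.hasDerivAt_cosh x).log (Real.cosh_pos x).ne'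
  rwa [← Real.tanh_eq_sinh_div_cosh] at this

theorem integral_odd_eq_zero {ν : Measure ℝ} (hsymm : ν.map (fun h : ℝ => -h) = ν) {f : ℝ → ℝ}
    (hf : Continuous f) (hodd : ∀ s, f (-s) = -f s) : ∫ s, f s ∂ν = 0 := by
  have : ∫ s, f (-s) ∂ν = ∫ s, f s ∂ν := by
    conv_rhs => rw [← hsymm]
    rw [integral_map measurable_neg.aemeasurable hf.aestronglyMeasurable]
  simp only [hodd, integral_neg] at this
  linarith

theorem integral_tanh_eq_zero {ν : Measure ℝ} (hsymm : ν.map (fun h : ℝ => -h) = ν) :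
    ∫ s, Real.tanh s ∂ν = 0 :=
  integral_odd_eq_zero hsymm continuous_tanh Real.tanh_neg

section potential

variable {ν : Measure ℝ} [IsProbabilityMeasure ν]

theorem hasDerivAt_integral_shift {f f' : ℝ → ℝ} (hf : ∀ y, HasDerivAt f (f' y) y)
    (hf' : Continuous f') {B : ℝ} (hB : ∀ y, |f' y| ≤ B)
    (hint : ∀ x, Integrable (fun h => f (x + h)) ν) (x : ℝ) :
    HasDerivAt (fun x => ∫ h, f (x + h) ∂ν) (∫ h, f' (x + h) ∂ν) x := by
  have hfc : Continuous f := continuous_iff_continuousAt.2 fun y => (hf y).continuousAt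
  refine (hasDerivAt_integral_of_dominated_loc_of_deriv_le (bound := fun _ => B)
    (F := fun x h => f (x + h)) (F' := fun x h => f' (x + h)) (s := Set.univ) univ_mem ?_
    (hint x) ?_ ?_ (integrable_const B) ?_).2
  · exact Eventually.of_forall fun y => Continuous.aestronglyMeasurable (by fun_prop)
  · exact Continuous.aestronglyMeasurable (by fun_prop)
  · exact ae_of_all _ fun h y _ => hB _
  · exact ae_of_all _ fun h y _ => (hf (y + h)).comp_add_const y h

theorem exists_abs_eval_tanh_le (p : Polynomial ℝ) :
    ∃ B, ∀ y, |p.eval (Real.tanh y)| ≤ B := by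
  obtain ⟨B, hB⟩ := (isCompact_Icc (a := (-1 : ℝ)) (b := 1)).exists_bound_of_continuousOn
    (f := fun t => p.eval t) p.continuous.continuousOn
  exact ⟨B, fun y => hB _ (abs_le.1 (abs_tanh_le_one y))⟩

theorem hasDerivAt_eval_tanh (p : Polynomial ℝ) (y : ℝ) :
    HasDerivAt (fun y => p.eval (Real.tanh y))
      ((Polynomial.derivative p * (1 - Polynomial.X ^ 2)).eval (Real.tanh y)) y := by
  have := (p.hasDerivAt (Real.tanh y)).comp y (hasDerivAt_tanh y)
  exact this.congr_deriv (by simp)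

theorem continuous_eval_tanh (p : Polynomial ℝ) :
    Continuous fun y => p.eval (Real.tanh y) := p.continuous.comp continuous_tanh

theorem integrable_eval_tanh (p : Polynomial ℝ) (x : ℝ) :
    Integrable (fun h => p.eval (Real.tanh (x + h))) ν := by
  obtain ⟨B, hB⟩ := exists_abs_eval_tanh_le p
  exact integrable_of_continuous_real ((continuous_eval_tanh p).comp (by fun_prop))
    fun h => hB _

theorem hasDerivAt_integral_eval_tanh (p : Polynomial ℝ) (x : ℝ) :
    HasDerivAt (fun x => ∫ h, p.eval (Real.tanh (x + h)) ∂ν)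
      (∫ h, (Polynomial.derivative p * (1 - Polynomial.X ^ 2)).eval (Real.tanh (x + h)) ∂ν) x := by
  obtain ⟨B, hB⟩ := exists_abs_eval_tanh_le (Polynomial.derivative p * (1 - Polynomial.X ^ 2))
  exact hasDerivAt_integral_shift (hasDerivAt_eval_tanh p) (continuous_eval_tanh _) hB
    (integrable_eval_tanh p) x

/-- Polynomials in tanh are bounded and closed under differentiation, since tanh' = 1 - tanh². So
differentiation under the integral can be iterated without moment assumptions on ν. -/
theorem contDiff_integral_eval_tanh (m : ℕ) (p : Polynomial ℝ) :
    ContDiff ℝ m (fun x => ∫ h, p.eval (Real.tanh (x + h)) ∂ν) := by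
  induction m generalizing p with
  | zero =>
    exact contDiff_zero.2 (continuous_iff_continuousAt.2 fun x =>
      (hasDerivAt_integral_eval_tanh p x).continuousAt)
  | succ m ih =>
    rw [Nat.cast_succ, contDiff_succ_iff_deriv]
    refine ⟨fun x => (hasDerivAt_integral_eval_tanh p x).differentiableAt, by simp, ?_⟩
    rw [funext fun x => (hasDerivAt_integral_eval_tanh (ν := ν) p x).deriv]
    exact ih _

theorem integrable_log_cosh (hint : Integrable (fun h : ℝ => h) ν) (x : ℝ) :
    Integrable (fun h => Real.log (Real.cosh (x + h))) ν := by
  refine (((integrable_const |x|).add hint.abs)).mono'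
    (continuous_log_cosh.comp (by fun_prop)).aestronglyMeasurable (ae_of_all _ fun h => ?_)
  have := abs_log_cosh_add_sub_le (x + h) 0
  simp only [add_zero, Real.cosh_zero, Real.log_one, sub_zero] at this
  exact this.trans (abs_add_le x h)

theorem hasDerivAt_potential (hint : Integrable (fun h : ℝ => h) ν) (θ x : ℝ) :
    HasDerivAt (potential ν θ)
      (x - Real.sqrt θ * ∫ h, Real.tanh (Real.sqrt θ * x + h) ∂ν) x := by
  have h1 := hasDerivAt_integral_shift hasDerivAt_log_cosh continuous_tanh abs_tanh_le_one
    (integrable_log_cosh hint) (Real.sqrt θ * x)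
  have h2 := h1.comp x ((hasDerivAt_id x).const_mul (Real.sqrt θ))
  have h3 := ((hasDerivAt_pow 2 x).div_const 2).sub h2
  exact h3.congr_deriv (by simp; ring)

theorem deriv_potential (hint : Integrable (fun h : ℝ => h) ν) (θ : ℝ) :
    deriv (potential ν θ) =
      fun x => x - Real.sqrt θ * ∫ h, Real.tanh (Real.sqrt θ * x + h) ∂ν :=
  funext fun x => (hasDerivAt_potential hint θ x).deriv

theorem contDiff_deriv_potential (hint : Integrable (fun h : ℝ => h) ν) (θ : ℝ) (m : ℕ) :
    ContDiff ℝ m (deriv (potential ν θ)) := by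
  rw [deriv_potential hint]
  have := contDiff_integral_eval_tanh (ν := ν) m Polynomial.X
  simp only [Polynomial.eval_X] at this
  exact contDiff_id.sub (contDiff_const.mul (this.comp (contDiff_const.mul contDiff_id)))

theorem contDiff_potential (hint : Integrable (fun h : ℝ => h) ν) (θ : ℝ) (m : ℕ) :
    ContDiff ℝ m (potential ν θ) := by
  have : ContDiff ℝ (m + 1) (potential ν θ) :=
    contDiff_succ_iff_deriv.2 ⟨fun x => (hasDerivAt_potential hint θ x).differentiableAt,
      by simp, contDiff_deriv_potential hint θ m⟩
  exact this.of_le (by norm_cast; omega)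

theorem hasDerivAt_deriv_potential_zero (hint : Integrable (fun h : ℝ => h) ν) {θ : ℝ}
    (hθ : 0 ≤ θ) : HasDerivAt (deriv (potential ν θ)) (1 - θ * meanSechSq ν) 0 := by
  rw [deriv_potential hint]
  have h1 := hasDerivAt_integral_eval_tanh (ν := ν) Polynomial.X (Real.sqrt θ * 0)
  have h2 := (hasDerivAt_id (0 : ℝ)).sub
    ((h1.comp (0 : ℝ) ((hasDerivAt_id (0 : ℝ)).const_mul (Real.sqrt θ))).const_mul (Real.sqrt θ))
  simp only [Polynomial.eval_X] at h2
  refine h2.congr_deriv ?_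
  · simp only [Polynomial.derivative_X, one_mul, Polynomial.eval_sub, Polynomial.eval_one,
      Polynomial.eval_pow, Polynomial.eval_X, mul_zero, zero_add, one_sub_tanh_sq, mul_one,
      meanSechSq]
    linear_combination (-∫ h, 1 / Real.cosh h ^ 2 ∂ν) * Real.mul_self_sqrt hθ

theorem deriv_potential_zero (hint : Integrable (fun h : ℝ => h) ν)
    (hsymm : ν.map (fun h : ℝ => -h) = ν) (θ : ℝ) : deriv (potential ν θ) 0 = 0 := by
  rw [deriv_potential hint]
  simp [integral_tanh_eq_zero hsymm]

end potential

/-! ### Taylor expansions -/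

theorem taylor_leading_term {f : ℝ → ℝ} {p : ℕ} (hp : 1 ≤ p) (hf : ContDiff ℝ p f)
    (h0 : ∀ q, 1 ≤ q → q < p → iteratedDeriv q f 0 = 0) :
    (fun x => f x - f 0 - iteratedDeriv p f 0 / (p.factorial : ℝ) * x ^ p) =o[𝓝 0]
      fun x => x ^ p := by
  have := taylor_isLittleO_univ (x₀ := (0 : ℝ)) hf
  simp only [sub_zero] at this
  refine this.congr_left fun x => ?_
  rw [taylor_within_apply, Finset.sum_range_succ]
  obtain ⟨p, rfl⟩ : ∃ p', p = p' + 1 := ⟨p - 1, by omega⟩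
  rw [Finset.sum_range_succ', Finset.sum_eq_zero]
  · simp [iteratedDerivWithin_univ]; ring
  · intro q hq
    rw [iteratedDerivWithin_univ, h0 (q + 1) (by omega) (by simpa using hq), smul_zero]

theorem coeff_eq_zero_of_isLittleO {c : ℝ} {p : ℕ}
    (h : (fun x : ℝ => c * x ^ p) =o[𝓝 0] fun x => x ^ p) : c = 0 := by
  by_contra hc
  have h1 : (fun x : ℝ => x ^ p) =o[𝓝 0] fun x : ℝ => x ^ p :=
    (Asymptotics.isLittleO_const_mul_left_iff hc).1 h
  have h2 := h1.def (c := 1 / 2) (by norm_num)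
  obtain ⟨δ, hδ, hball⟩ := Metric.eventually_nhds_iff.1 h2
  have h3 := hball (y := δ / 2) (by rw [Real.dist_eq, sub_zero, abs_of_pos (by linarith)]; linarith)
  have h4 : 0 < ‖(δ / 2) ^ p‖ := norm_pos_iff.2 (by positivity)
  linarith

/-- By induction: if all lower derivatives vanish, the Taylor term of order p < N equals f - f(0) up
to o(x^p), while the expansion says that f - f(0) is itself o(x^p). -/
theorem iteratedDeriv_eq_zero_of_expansion {f : ℝ → ℝ} {N : ℕ} (hf : ContDiff ℝ N f) {A : ℝ}
    (hO : (fun x => f x - f 0 - A * x ^ N) =O[𝓝 0] fun x => x ^ (N + 1)) :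
    ∀ p, 1 ≤ p → p < N → iteratedDeriv p f 0 = 0 := by
  intro p
  induction p using Nat.strong_induction_on with
  | _ p ih =>
    intro hp hpN
    have h1 := taylor_leading_term hp (hf.of_le (by exact_mod_cast hpN.le))
      fun q hq hqp => ih q hqp hq (hqp.trans hpN)
    have hpow : ∀ M, p < M → (fun x : ℝ => x ^ M) =o[𝓝 0] fun x => x ^ p := fun M hM =>
      Asymptotics.isLittleO_pow_pow hM
    have h2 : (fun x => f x - f 0) =o[𝓝 0] fun x => x ^ p := by
      have := (hO.trans_isLittleO (hpow (N + 1) (by omega))).add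
        ((hpow N hpN).const_mul_left A)
      exact this.congr_left fun x => by ring
    have h3 := coeff_eq_zero_of_isLittleO ((h2.sub h1).congr_left
      (f₂ := fun x => iteratedDeriv p f 0 / (p.factorial : ℝ) * x ^ p) fun x => by ring)
    have : (p.factorial : ℝ) ≠ 0 := by exact_mod_cast p.factorial_ne_zero
    rw [div_eq_zero_iff] at h3
    exact h3.resolve_right this

/-- An asymptotic expansion cannot be differentiated directly. It does determine the vanishing
Taylor coefficients, and Taylor's formula is then applied to the derivative. -/
theorem deriv_expansion {f : ℝ → ℝ} {N : ℕ} (hN : 2 ≤ N) (hf : ContDiff ℝ N f)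
    (hf' : ContDiff ℝ ((N - 1 : ℕ) : WithTop ℕ∞) (deriv f)) {A : ℝ}
    (hO : (fun x => f x - f 0 - A * x ^ N) =O[𝓝 0] fun x => x ^ (N + 1)) :
    (fun x => deriv f x - iteratedDeriv N f 0 / ((N - 1).factorial : ℝ) * x ^ (N - 1)) =o[𝓝 0]
      fun x => x ^ (N - 1) := by
  have h0 := iteratedDeriv_eq_zero_of_expansion hf hO
  have h1 := taylor_leading_term (p := N - 1) (by omega) hf' fun q hq hqN => by
    rw [← iteratedDeriv_succ']; exact h0 (q + 1) (by omega) (by omega)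
  have h2 : deriv f 0 = 0 := by
    have := h0 1 le_rfl (by omega)
    rwa [iteratedDeriv_one] at this
  rw [← iteratedDeriv_succ', Nat.sub_add_cancel (by omega), h2] at h1
  simpa using h1

/-! ### The restoring force -/

/-- The derivative of the potential in terms of the magnetization per vertex. -/
noncomputable def restoringForce (ν : Measure ℝ) (θ m : ℝ) : ℝ :=
  m - ∫ h, Real.tanh (θ * m + h) ∂ν

section restoringForce

variable {ν : Measure ℝ} [IsProbabilityMeasure ν]

theorem deriv_potential_sqrt_mul (hint : Integrable (fun h : ℝ => h) ν) {θ : ℝ} (hθ : 0 ≤ θ)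
    (m : ℝ) : deriv (potential ν θ) (Real.sqrt θ * m) = Real.sqrt θ * restoringForce ν θ m := by
  simp only [deriv_potential hint, restoringForce]
  rw [← mul_assoc, Real.mul_self_sqrt hθ]
  ring

/-- Near zero the restoring force is a positive multiple of `m ^ (2 τ - 1)`. -/
def HasFlatness (ν : Measure ℝ) (θ : ℝ) (τ : ℕ) : Prop :=
  ∃ D : ℝ, 0 < D ∧ (fun m => restoringForce ν θ m - D * m ^ (2 * τ - 1)) =o[𝓝 0]
    fun m => m ^ (2 * τ - 1)

theorem hasFlatness_of_deriv (hint : Integrable (fun h : ℝ => h) ν) {θ : ℝ} (hθ : 0 < θ)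
    {τ : ℕ} {D : ℝ} (hD : 0 < D)
    (h : (fun x => deriv (potential ν θ) x - D * x ^ (2 * τ - 1)) =o[𝓝 0]
      fun x => x ^ (2 * τ - 1)) : HasFlatness ν θ τ := by
  have hs : 0 < Real.sqrt θ := Real.sqrt_pos.2 hθ
  refine ⟨D * Real.sqrt θ ^ (2 * τ - 1) / Real.sqrt θ, by positivity, ?_⟩
  have ht : Tendsto (fun m : ℝ => Real.sqrt θ * m) (𝓝 0) (𝓝 0) := by
    have : Continuous fun m : ℝ => Real.sqrt θ * m := by fun_prop
    simpa using this.tendsto 0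
  have h1 := h.comp_tendsto ht
  have h2 := (h1.const_mul_left (Real.sqrt θ)⁻¹).congr_left
    (f₂ := fun m => restoringForce ν θ m -
      D * Real.sqrt θ ^ (2 * τ - 1) / Real.sqrt θ * m ^ (2 * τ - 1)) fun m => by
    simp only [Function.comp_apply]
    rw [deriv_potential_sqrt_mul hint hθ.le, mul_pow]
    field_simp
  refine h2.trans_isBigO ?_
  simp only [Function.comp_def, mul_pow]
  exact (Asymptotics.isBigO_refl _ _).const_mul_left _

theorem hasFlatness_one (hint : Integrable (fun h : ℝ => h) ν)
    (hsymm : ν.map (fun h : ℝ => -h) = ν) {θ : ℝ} (hθ : 0 < θ)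
    (hlt : θ * meanSechSq ν < 1) : HasFlatness ν θ 1 := by
  refine hasFlatness_of_deriv hint hθ (D := 1 - θ * meanSechSq ν) (by linarith) ?_
  have := (hasDerivAt_deriv_potential_zero (ν := ν) hint hθ.le).isLittleO
  simp only [deriv_potential_zero hint hsymm, sub_zero, smul_eq_mul] at this
  simp only [mul_one, Nat.reduceSub, pow_one]
  exact this.congr_left fun x => by ring

/-- For τ = 0 the derivative of order 0 is H(0) ≤ 0, and for τ = 1 it is H''(0) = 1 - θ E[sech² h] =
0; both contradict positivity. -/
theorem CriticalTemperature.two_le (hint : Integrable (fun h : ℝ => h) ν) {θ : ℝ} (hθ : 0 < θ)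
    {τ : ℕ} (hc : CriticalTemperature ν θ τ) : 2 ≤ τ := by
  obtain ⟨h1, -, h3, h4⟩ := hc
  by_contra hlt
  have : τ = 0 ∨ τ = 1 := by omega
  rcases this with rfl | rfl
  · simp only [mul_zero, iteratedDeriv_zero] at h3
    have h5 : 0 ≤ ∫ h, Real.log (Real.cosh (Real.sqrt θ * 0 + h)) ∂ν :=
      integral_nonneg fun h => Real.log_nonneg (Real.one_le_cosh _)
    have : potential ν θ 0 ≤ 0 := by unfold potential; linarith
    linarith
  · have : iteratedDeriv (2 * 1) (potential ν θ) 0 = 1 - θ * meanSechSq ν := by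
      rw [mul_one, iteratedDeriv_succ', iteratedDeriv_one]
      exact (hasDerivAt_deriv_potential_zero hint hθ.le).deriv
    linarith

theorem CriticalTemperature.hasFlatness (hint : Integrable (fun h : ℝ => h) ν) {θ : ℝ}
    (hθ : 0 < θ) {τ : ℕ} (hc : CriticalTemperature ν θ τ) : HasFlatness ν θ τ := by
  have h2 := hc.two_le hint hθ
  obtain ⟨-, -, h3, h4⟩ := hc
  refine hasFlatness_of_deriv hint hθ (D := iteratedDeriv (2 * τ) (potential ν θ) 0 /
    ((2 * τ - 1).factorial : ℝ)) (by positivity) ?_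
  exact deriv_expansion (by omega) (contDiff_potential hint θ _)
    (contDiff_deriv_potential hint θ _) h4

/-- The lower bound holds only near 0, since the force may vanish elsewhere. The upper bound extends
to [-1, 1] because the force is at most 2 there and |m| stays away from 0. -/
theorem HasFlatness.exists_bounds {θ : ℝ} {τ : ℕ} (hτ : HasFlatness ν θ τ) :
    ∃ c C δ : ℝ, 0 < c ∧ 0 < C ∧ 0 < δ ∧
      (∀ m, |m| ≤ δ → c * |m| ^ (2 * τ - 1) ≤ |restoringForce ν θ m|) ∧
      ∀ m, |m| ≤ 1 → |restoringForce ν θ m| ≤ C * |m| ^ (2 * τ - 1) := by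
  obtain ⟨D, hD, ho⟩ := hτ
  obtain ⟨δ, hδ, hball⟩ := Metric.eventually_nhds_iff.1 (ho.def (c := D / 2) (by positivity))
  have hnear : ∀ m, |m| ≤ δ / 2 →
      |restoringForce ν θ m - D * m ^ (2 * τ - 1)| ≤ D / 2 * |m| ^ (2 * τ - 1) := by
    intro m hm
    have := hball (y := m) (by rw [Real.dist_eq, sub_zero]; linarith)
    simpa only [Real.norm_eq_abs, abs_pow] using this
  have habs : ∀ m : ℝ, |D * m ^ (2 * τ - 1)| = D * |m| ^ (2 * τ - 1) := fun m => by
    rw [abs_mul, abs_pow, abs_of_pos hD]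
  refine ⟨D / 2, max (3 * D / 2) (2 / (δ / 2) ^ (2 * τ - 1)), δ / 2, by positivity,
    lt_max_of_lt_left (by positivity), by positivity, fun m hm => ?_, fun m hm => ?_⟩
  · have h1 := abs_sub_abs_le_abs_sub (D * m ^ (2 * τ - 1)) (restoringForce ν θ m)
    rw [abs_sub_comm, habs] at h1
    linarith [hnear m hm]
  · rcases le_total |m| (δ / 2) with h | h
    · have h1 := abs_sub_abs_le_abs_sub (restoringForce ν θ m) (D * m ^ (2 * τ - 1))
      rw [habs] at h1
      calc |restoringForce ν θ m| ≤ 3 * D / 2 * |m| ^ (2 * τ - 1) := by linarith [hnear m h]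
        _ ≤ _ := mul_le_mul_of_nonneg_right (le_max_left _ _) (by positivity)
    · have h1 : |restoringForce ν θ m| ≤ 2 := by
        refine (abs_sub _ _).trans ?_
        have := abs_integral_le_of_abs_le (ν := ν) (g := fun h => Real.tanh (θ * m + h))
          fun s => abs_tanh_le_one _
        linarith
      calc |restoringForce ν θ m| ≤ 2 := h1
        _ = 2 / (δ / 2) ^ (2 * τ - 1) * (δ / 2) ^ (2 * τ - 1) := by field_simp
        _ ≤ 2 / (δ / 2) ^ (2 * τ - 1) * |m| ^ (2 * τ - 1) := by gcongr
        _ ≤ _ := mul_le_mul_of_nonneg_right (le_max_right _ _) (by positivity)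

end restoringForce

/-! ### Comparison with independent spins -/

/-- The logarithmic gain in the partition function of independent spins when the field on the
clique is shifted by `q`. -/
noncomputable def shiftGain {n : ℕ} (S : Finset (Fin n)) (h : Fin n → ℝ) (q : ℝ) : ℝ :=
  ∑ i ∈ S, (Real.log (Real.cosh (q + h i)) - Real.log (Real.cosh (h i)))

section freeSpins

variable {n : ℕ} {S : Finset (Fin n)}

theorem sum_exp_spin_prod (u : Fin n → ℝ) :
    ∑ x : Fin n → Bool, Real.exp (∑ i, u i * spin (x i)) = ∏ i, (2 * Real.cosh (u i)) := by
  simp only [Real.exp_sum]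
  rw [← Fintype.prod_sum fun i (b : Bool) => Real.exp (u i * spin b)]
  refine Finset.prod_congr rfl fun i _ => ?_
  rw [Fintype.sum_bool, Real.cosh_eq]
  simp [spin]; ring

theorem exp_shiftGain (h : Fin n → ℝ) (q : ℝ) :
    Real.exp (shiftGain S h q) = ∏ i ∈ S, (Real.cosh (q + h i) / Real.cosh (h i)) := by
  unfold shiftGain
  rw [Real.exp_sum]
  refine Finset.prod_congr rfl fun i _ => ?_
  rw [Real.exp_sub, Real.exp_log (Real.cosh_pos _), Real.exp_log (Real.cosh_pos _)]

theorem sum_exp_shift (h : Fin n → ℝ) (q : ℝ) :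
    ∑ x : Fin n → Bool, Real.exp (q * ∑ i ∈ S, spin (x i) + ∑ i, h i * spin (x i)) =
      Real.exp (shiftGain S h q) * ∑ x : Fin n → Bool, Real.exp (∑ i, h i * spin (x i)) := by
  classical
  have h1 : ∀ x : Fin n → Bool, q * ∑ i ∈ S, spin (x i) + ∑ i, h i * spin (x i) =
      ∑ i, ((if i ∈ S then q else 0) + h i) * spin (x i) := by
    intro x
    simp only [add_mul, Finset.sum_add_distrib, ite_mul, zero_mul, Finset.sum_ite_mem,
      Finset.univ_inter, Finset.mul_sum]
  simp only [h1]
  rw [sum_exp_spin_prod, sum_exp_spin_prod, exp_shiftGain]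
  have h2 : ∏ i ∈ S, (Real.cosh (q + h i) / Real.cosh (h i)) =
      ∏ i, (if i ∈ S then Real.cosh (q + h i) / Real.cosh (h i) else 1) := by
    rw [Finset.prod_ite_mem, Finset.univ_inter]
  rw [h2, ← Finset.prod_mul_distrib]
  refine Finset.prod_congr rfl fun i _ => ?_
  by_cases hi : i ∈ S
  · simp only [hi, if_true]
    have := (Real.cosh_pos (h i)).ne'
    field_simp
  · simp [hi]

theorem continuous_shiftGain (q : ℝ) : Continuous fun h : Fin n → ℝ => shiftGain S h q :=
  continuous_finsetSum _ fun i _ =>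
    (continuous_log_cosh.comp (by fun_prop)).sub (continuous_log_cosh.comp (by fun_prop))

theorem abs_shiftGain_le (h : Fin n → ℝ) (q : ℝ) : |shiftGain S h q| ≤ S.card * |q| := by
  refine (Finset.abs_sum_le_sum_abs _ _).trans ?_
  refine (Finset.sum_le_sum fun i _ => abs_log_cosh_add_sub_le q (h i)).trans ?_
  simp

/-- Compare with the free partition function Z₀. Completing the square gives log(Z/Z₀) ≥ gain - k
x²/2. Conversely Z₀/Z is the Gibbs average of exp(-(θ/2k)(∑σ)²), so Jensen's inequality bounds
log(Z/Z₀) by the averaged energy. -/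
theorem le_gibbsMean_sq_cliqueSum {θ : ℝ} (hθ : 0 ≤ θ) (hS : 0 < S.card) (h : Fin n → ℝ) (x : ℝ) :
    shiftGain S h (Real.sqrt θ * x) - S.card * (x ^ 2 / 2) ≤
      θ / (2 * S.card) * gibbsMean θ S h (fun y => (∑ i ∈ S, spin (y i)) ^ 2) := by
  have hk : (0 : ℝ) < S.card := by exact_mod_cast hS
  set k : ℝ := (S.card : ℝ) with hkdef
  set Z0 := ∑ y : Fin n → Bool, Real.exp (∑ i, h i * spin (y i)) with hZ0
  have hZ0pos : 0 < Z0 := Finset.sum_pos (fun y _ => Real.exp_pos _) Finset.univ_nonempty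
  have hZ : Real.exp (shiftGain S h (Real.sqrt θ * x) - k * (x ^ 2 / 2)) * Z0 ≤
      ∑ y, gibbsWeight θ S h y := by
    rw [sub_eq_add_neg, Real.exp_add, mul_right_comm, ← sum_exp_shift, Finset.sum_mul]
    refine Finset.sum_le_sum fun y _ => ?_
    rw [← Real.exp_add, gibbsWeight, Real.exp_le_exp]
    have h2 : θ / (2 * k) * (∑ i ∈ S, spin (y i)) ^ 2 + k * (x ^ 2 / 2) -
        Real.sqrt θ * x * ∑ i ∈ S, spin (y i) =
        (Real.sqrt θ * (∑ i ∈ S, spin (y i)) - k * x) ^ 2 / (2 * k) := by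
      have := Real.sq_sqrt hθ
      field_simp
      ring_nf
      rw [this]
      ring
    have h3 : 0 ≤ (Real.sqrt θ * (∑ i ∈ S, spin (y i)) - k * x) ^ 2 / (2 * k) := by positivity
    linarith
  set A := θ / (2 * k) * gibbsMean θ S h (fun y => (∑ i ∈ S, spin (y i)) ^ 2) with hA
  have hJ : Real.exp (-A) ≤
      gibbsMean θ S h (fun y => Real.exp (-(θ / (2 * k) * (∑ i ∈ S, spin (y i)) ^ 2))) := by
    -- Jensen's inequality through the tangent line of u ↦ e^(-u) at the mean A.
    have h1 : gibbsMean θ S h (fun y => Real.exp (-A) * (1 + A) -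
        Real.exp (-A) * (θ / (2 * k)) * (∑ i ∈ S, spin (y i)) ^ 2) = Real.exp (-A) := by
      rw [gibbsMean_sub, gibbsMean_const, gibbsMean_const_mul, mul_assoc, ← hA]; ring
    rw [← h1]
    refine gibbsMean_mono fun y => ?_
    have h2 := Real.add_one_le_exp (A - θ / (2 * k) * (∑ i ∈ S, spin (y i)) ^ 2)
    have h3 : Real.exp (-(θ / (2 * k) * (∑ i ∈ S, spin (y i)) ^ 2)) =
        Real.exp (-A) * Real.exp (A - θ / (2 * k) * (∑ i ∈ S, spin (y i)) ^ 2) := by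
      rw [← Real.exp_add]; congr 1; ring
    rw [h3]
    nlinarith [Real.exp_pos (-A)]
  have hfree : gibbsMean θ S h (fun y => Real.exp (-(θ / (2 * k) * (∑ i ∈ S, spin (y i)) ^ 2))) =
      Z0 / ∑ y, gibbsWeight θ S h y := by
    rw [gibbsMean_eq_div]
    congr 1
    refine Finset.sum_congr rfl fun y _ => ?_
    rw [gibbsWeight, ← Real.exp_add]; congr 1; ring
  rw [hfree, le_div_iff₀ sum_gibbsWeight_pos] at hJ
  have h4 : Real.exp (-A) * (Real.exp (shiftGain S h (Real.sqrt θ * x) - k * (x ^ 2 / 2)) * Z0) ≤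
      1 * Z0 := by
    rw [one_mul]
    exact (mul_le_mul_of_nonneg_left hZ (Real.exp_pos _).le).trans hJ
  rw [← mul_assoc, ← Real.exp_add] at h4
  have h5 := Real.exp_le_one_iff.1 (le_of_mul_le_mul_right h4 hZ0pos)
  linarith

/-- On the event ∑σ = v the quadratic energy coincides with its linearisation at v. The linear
energy describes independent spins with shifted field and may be summed over all configurations. -/
theorem gibbsMean_cliqueSum_eq_le {θ : ℝ} (hθ : 0 ≤ θ) (hS : 0 < S.card) (h : Fin n → ℝ) (v : ℝ) :
    gibbsMean θ S h (fun y => if ∑ i ∈ S, spin (y i) = v then 1 else 0) ≤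
      Real.exp (-(θ * v ^ 2 / (2 * S.card) - shiftGain S h (θ * v / S.card))) := by
  have hk : (0 : ℝ) < S.card := by exact_mod_cast hS
  set k : ℝ := (S.card : ℝ) with hkdef
  set Z0 := ∑ y : Fin n → Bool, Real.exp (∑ i, h i * spin (y i)) with hZ0
  have hZ : Z0 ≤ ∑ y, gibbsWeight θ S h y := by
    refine Finset.sum_le_sum fun y _ => Real.exp_le_exp.2 ?_
    have : 0 ≤ θ / (2 * k) * (∑ i ∈ S, spin (y i)) ^ 2 := by positivity
    linarith
  rw [gibbsMean_eq_div, div_le_iff₀ sum_gibbsWeight_pos]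
  refine le_trans ?_ (mul_le_mul_of_nonneg_left hZ (Real.exp_pos _).le)
  rw [neg_sub, sub_eq_add_neg, Real.exp_add, mul_right_comm, ← sum_exp_shift, Finset.sum_mul]
  refine Finset.sum_le_sum fun y _ => ?_
  by_cases hy : ∑ i ∈ S, spin (y i) = v
  · rw [if_pos hy, mul_one, gibbsWeight, hy, ← Real.exp_add, Real.exp_le_exp, ← hkdef]
    refine le_of_eq ?_
    field_simp
    ring
  · rw [if_neg hy, mul_zero]; positivity

end freeSpins

/-! ### Averaging the free-spin comparison over the field. -/

section annealed

variable {n : ℕ} {S : Finset (Fin n)} {ν : Measure ℝ} [IsProbabilityMeasure ν]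

theorem integral_log_cosh_shift (hint : Integrable (fun h : ℝ => h) ν) (θ x : ℝ) :
    ∫ s, (Real.log (Real.cosh (Real.sqrt θ * x + s)) - Real.log (Real.cosh s)) ∂ν =
      x ^ 2 / 2 - (potential ν θ x - potential ν θ 0) := by
  have h0 := integrable_log_cosh hint 0
  simp only [zero_add] at h0
  rw [integral_sub (integrable_log_cosh hint _) h0]
  simp [potential]
  ring

/-- The field average of the shift gain minus k x²/2 is exactly k (H(0) - H(x)); this drives the low
temperature regime. -/
theorem le_integral_sq_cliqueSum (hint : Integrable (fun h : ℝ => h) ν) {θ : ℝ} (hθ : 0 ≤ θ)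
    (hS : 0 < S.card) (x : ℝ) :
    S.card * (potential ν θ 0 - potential ν θ x) ≤
      θ / (2 * S.card) * ∫ y, (∑ i ∈ S, spin (y i)) ^ 2 ∂(plantedLaw ν θ S) := by
  rw [integral_plantedLaw, ← integral_const_mul]
  have hi : Integrable (fun h : Fin n → ℝ => shiftGain S h (Real.sqrt θ * x)) (iidField n ν) :=
    integrable_of_continuous_of_abs_le (continuous_shiftGain _) _ fun h => abs_shiftGain_le h _
  refine le_trans (le_of_eq ?_) (integral_mono (hi.sub (integrable_const _))
    ((integrable_gibbsMean ν θ S _).const_mul _) fun h => le_gibbsMean_sq_cliqueSum hθ hS h x)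
  simp only [Pi.sub_apply]
  rw [integral_sub hi (integrable_const _)]
  unfold shiftGain
  have hterm : ∀ i : Fin n, Integrable (fun h : Fin n → ℝ => Real.log (Real.cosh
      (Real.sqrt θ * x + h i)) - Real.log (Real.cosh (h i))) (iidField n ν) := fun i =>
    integrable_of_continuous_of_abs_le
      ((continuous_log_cosh.comp (by fun_prop)).sub (continuous_log_cosh.comp (by fun_prop)))
      |Real.sqrt θ * x| fun h => abs_log_cosh_add_sub_le _ _
  rw [integral_finsetSum _ fun i _ => hterm i]
  rw [Finset.sum_congr rfl fun i _ => integral_field_apply (ν := ν) i fun s =>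
    Real.log (Real.cosh (Real.sqrt θ * x + s)) - Real.log (Real.cosh s),
    integral_log_cosh_shift hint]
  simp
  ring

/-- The quenched probability is at most exp(∑Y(h_i)) with E[Y] = -(H(√θ m) - H(0)), but E[e^Y] may
exceed 1. Being also at most 1, the probability is at most exp(l ∑Y) for every l in [0, 1], and for
small l the negative mean dominates. -/
theorem integral_cliqueSum_eq_le (hint : Integrable (fun h : ℝ => h) ν) {θ : ℝ} (hθ : 0 ≤ θ)
    (hS : 0 < S.card) {m c l : ℝ} (hm : |m| ≤ 1)
    (hc : c ≤ potential ν θ (Real.sqrt θ * m) - potential ν θ 0)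
    (hl : 0 ≤ l) (hl1 : l ≤ 1) (hlB : l * (2 * θ) ≤ 1) :
    ∫ y, (if ∑ i ∈ S, spin (y i) = S.card * m then (1 : ℝ) else 0) ∂(plantedLaw ν θ S) ≤
      (1 - l * c + l ^ 2 * (2 * θ) ^ 2) ^ S.card := by
  have hk : (0 : ℝ) < S.card := by exact_mod_cast hS
  set k : ℝ := (S.card : ℝ) with hkdef
  set Y : ℝ → ℝ := fun s => Real.log (Real.cosh (θ * m + s)) - Real.log (Real.cosh s) -
    θ * m ^ 2 / 2 with hY
  have hYc : Continuous Y := ((continuous_log_cosh.comp (by fun_prop)).sub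
    continuous_log_cosh).sub continuous_const
  have hYB : ∀ s, |Y s| ≤ 2 * θ := by
    intro s
    have h1 := abs_log_cosh_add_sub_le (θ * m) s
    have h2 : |θ * m| ≤ θ := by
      rw [abs_mul, abs_of_nonneg hθ]; exact mul_le_of_le_one_right hθ hm
    have h3 : m ^ 2 ≤ 1 := by rw [← sq_abs]; exact pow_le_one₀ (abs_nonneg _) hm
    have h4 : |θ * m ^ 2 / 2| ≤ θ := by
      rw [abs_of_nonneg (by positivity)]; nlinarith
    refine (abs_sub _ _).trans ?_
    linarith
  have hYint : Integrable Y ν := integrable_of_continuous_real hYc hYB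
  have hYmean : ∫ s, Y s ∂ν ≤ -c := by
    have h1 := integral_log_cosh_shift hint θ (Real.sqrt θ * m)
    rw [← mul_assoc, Real.mul_self_sqrt hθ, mul_pow, Real.sq_sqrt hθ] at h1
    have hi : Integrable (fun s => Real.log (Real.cosh (θ * m + s)) - Real.log (Real.cosh s)) ν :=
      integrable_of_continuous_real ((continuous_log_cosh.comp (by fun_prop)).sub
        continuous_log_cosh) fun s => abs_log_cosh_add_sub_le _ _
    rw [hY, integral_sub hi (integrable_const _), h1]
    simp
    linarith
  have hYsq : ∫ s, Y s ^ 2 ∂ν ≤ (2 * θ) ^ 2 := by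
    refine (integral_mono (integrable_of_continuous_real (by fun_prop) (B := (2 * θ) ^ 2)
      fun s => ?_) (integrable_const ((2 * θ) ^ 2)) fun s => ?_).trans (by simp)
    · rw [abs_pow]; exact pow_le_pow_left₀ (abs_nonneg _) (hYB s) 2
    · simp only [← sq_abs (Y s)]; exact pow_le_pow_left₀ (abs_nonneg _) (hYB s) 2
  have hexp : ∫ s, Real.exp (l * Y s) ∂ν ≤ 1 - l * c + l ^ 2 * (2 * θ) ^ 2 := by
    refine (integral_exp_le hYc.measurable hYB hl hlB).trans ?_
    nlinarith [mul_le_mul_of_nonneg_left hYmean hl, mul_le_mul_of_nonneg_left hYsq (sq_nonneg l)]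
  refine le_trans ?_ (pow_le_pow_left₀ (integral_nonneg fun s => (Real.exp_pos _).le) hexp _)
  rw [← integral_prod_field, integral_plantedLaw]
  refine integral_mono (integrable_gibbsMean ν θ S _) ?_ fun h => ?_
  · refine integrable_of_continuous_of_abs_le (by fun_prop) (Real.exp 1 ^ S.card) fun h => ?_
    rw [Finset.abs_prod]
    refine (Finset.prod_le_prod (g := fun _ => Real.exp 1) (fun i _ => abs_nonneg _)
      fun i _ => ?_).trans (by simp)
    rw [Real.abs_exp, Real.exp_le_exp]
    refine le_trans ?_ hlB
    exact mul_le_mul_of_nonneg_left (abs_le.1 (hYB _)).2 hl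
  · have h1 := gibbsMean_cliqueSum_eq_le hθ hS h (k * m)
    have h2 : gibbsMean θ S h (fun y => if ∑ i ∈ S, spin (y i) = k * m then 1 else 0) ≤ 1 := by
      refine (gibbsMean_mono (g := fun _ => 1) fun y => ?_).trans (gibbsMean_const 1).le
      split_ifs <;> norm_num
    have h3 : -(θ * (k * m) ^ 2 / (2 * S.card) - shiftGain S h (θ * (k * m) / S.card)) =
        ∑ i ∈ S, Y (h i) := by
      rw [hY, Finset.sum_sub_distrib, Finset.sum_const, nsmul_eq_mul, ← hkdef]
      have e1 : θ * (k * m) / k = θ * m := by field_simp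
      rw [e1]; unfold shiftGain; field_simp; ring
    rw [h3] at h1
    simp only [← Real.exp_sum, ← Finset.mul_sum]
    rcases le_total 0 (∑ i ∈ S, Y (h i)) with h4 | h4
    · exact h2.trans (Real.one_le_exp (mul_nonneg hl h4))
    · refine h1.trans (Real.exp_le_exp.2 ?_)
      nlinarith

theorem exists_sum_spin_eq {n : ℕ} (S : Finset (Fin n)) (x : Fin n → Bool) :
    ∃ j ∈ Finset.range (S.card + 1), ∑ i ∈ S, spin (x i) = 2 * (j : ℝ) - S.card := by
  refine ⟨(S.filter fun i => x i = true).card, ?_, ?_⟩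
  · exact Finset.mem_range.2 (Nat.lt_succ_of_le (Finset.card_filter_le _ _))
  · have h1 : ∀ i, spin (x i) = 2 * (if x i = true then 1 else 0) - 1 := by
      intro i; cases x i <;> simp [spin]; norm_num
    simp only [h1, Finset.sum_sub_distrib, ← Finset.mul_sum, Finset.sum_boole]
    simp

/-- If zero is the unique minimum of the potential, the magnetization is small with high
probability. -/
theorem eventually_integral_large_cliqueSum_le (hint : Integrable (fun h : ℝ => h) ν) {θ : ℝ}
    (hθ : 0 < θ) (hmin : ZeroIsUniqueMinimum ν θ) {δ : ℝ} (hδ : 0 < δ) :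
    ∀ᶠ k : ℕ in atTop, ∀ (n : ℕ) (S : Finset (Fin n)), S.card = k →
      ∫ y, (if δ < |(∑ i ∈ S, spin (y i)) / S.card| then (1 : ℝ) else 0) ∂(plantedLaw ν θ S) ≤
        1 / k := by
  -- By compactness of {δ ≤ |m| ≤ 1} the unique minimum gives a uniform gap.
  obtain ⟨c, hc0, hc⟩ : ∃ c, 0 < c ∧ ∀ m, δ ≤ |m| → |m| ≤ 1 →
      c ≤ potential ν θ (Real.sqrt θ * m) - potential ν θ 0 := by
    have hcomp : IsCompact ({m : ℝ | δ ≤ |m|} ∩ Set.Icc (-1) 1) :=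
      isCompact_Icc.inter_left (isClosed_le continuous_const continuous_abs)
    have hcont : Continuous fun m => potential ν θ (Real.sqrt θ * m) - potential ν θ 0 :=
      ((contDiff_potential hint θ 0).continuous.comp (by fun_prop)).sub continuous_const
    obtain ⟨c, hc0, hc⟩ := hcomp.exists_forall_le' hcont.continuousOn (a := 0) fun m hm => by
      refine sub_pos.2 (hmin _ (mul_ne_zero (Real.sqrt_pos.2 hθ).ne' ?_))
      intro h0
      have h1 : δ ≤ |m| := hm.1
      rw [h0, abs_zero] at h1
      linarith
    exact ⟨c, hc0, fun m h1 h2 => hc m ⟨h1, abs_le.1 h2⟩⟩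
  -- The entries give l ≤ 1, |l Y| ≤ 1, a nonnegative base of the power, and a quadratic term at
  -- most half of the linear gain l c.
  set l := min (min 1 (1 / (2 * θ))) (min (1 / c) (c / (2 * (2 * θ) ^ 2))) with hl
  have hl0 : 0 < l := lt_min (lt_min one_pos (by positivity)) (lt_min (by positivity)
    (by positivity))
  have hl1 : l ≤ 1 := (min_le_left _ _).trans (min_le_left _ _)
  have hlB : l * (2 * θ) ≤ 1 := by
    have := (min_le_left _ _).trans (min_le_right _ _) (a := l)
    rwa [le_div_iff₀ (by positivity)] at this
  have hlc : l * c ≤ 1 := by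
    have := (min_le_right _ _).trans (min_le_left _ _) (a := l)
    rwa [le_div_iff₀ (by positivity)] at this
  have hlc' : l * (2 * θ) ^ 2 ≤ c / 2 := by
    have := (min_le_right _ _).trans (min_le_right _ _) (a := l)
    rw [le_div_iff₀ (by positivity)] at this
    linarith
  set q := 1 - l * c / 2 with hq
  have hq0 : 0 ≤ q := by rw [hq]; linarith
  have hq1 : q < 1 := by rw [hq]; linarith [mul_pos hl0 hc0]
  have hqe : 1 - l * c + l ^ 2 * (2 * θ) ^ 2 ≤ q := by
    rw [hq]; nlinarith
  have hqe0 : 0 ≤ 1 - l * c + l ^ 2 * (2 * θ) ^ 2 := by nlinarith [sq_nonneg (l * (2 * θ))]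
  -- The sum takes at most k + 1 values, and (k + 1) q^k ≤ 1/k is k² q^k + k q^k ≤ 1.
  have hlim : Tendsto (fun k : ℕ => (k : ℝ) ^ 2 * q ^ k + (k : ℝ) ^ 1 * q ^ k) atTop (𝓝 0) := by
    simpa using (tendsto_pow_const_mul_const_pow_of_lt_one 2 hq0 hq1).add
      (tendsto_pow_const_mul_const_pow_of_lt_one 1 hq0 hq1)
  filter_upwards [hlim.eventually (gt_mem_nhds one_pos), eventually_ge_atTop 1] with k hk hk1
  rintro n S rfl
  have hk0 : (0 : ℝ) < S.card := by exact_mod_cast hk1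
  set k : ℝ := (S.card : ℝ) with hkdef
  have hterm : ∀ j ∈ Finset.range (S.card + 1),
      ∫ y, (if ∑ i ∈ S, spin (y i) = 2 * (j : ℝ) - k ∧ δ < |(∑ i ∈ S, spin (y i)) / k|
        then (1 : ℝ) else 0) ∂(plantedLaw ν θ S) ≤ q ^ S.card := by
    intro j hj
    set m : ℝ := (2 * (j : ℝ) - k) / k with hm
    have hkm : 2 * (j : ℝ) - k = k * m := by rw [hm]; field_simp
    have hjk : (j : ℝ) ≤ k := by
      rw [hkdef]; exact_mod_cast Nat.lt_succ_iff.1 (Finset.mem_range.1 hj)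
    have hm1 : |m| ≤ 1 := by
      rw [hm, abs_div, abs_of_pos hk0, div_le_one hk0, abs_le]
      have : (0 : ℝ) ≤ j := Nat.cast_nonneg j
      constructor <;> linarith
    by_cases hmδ : δ < |m|
    · refine le_trans (integral_mono Integrable.of_finite Integrable.of_finite fun y => ?_)
        ((integral_cliqueSum_eq_le hint hθ.le hk1 hm1 (hc m hmδ.le hm1) hl0.le hl1 hlB).trans
          (pow_le_pow_left₀ hqe0 hqe _))
      simp only [← hkdef, ← hkm]
      split_ifs with h1 h2
      · exact le_rfl
      · exact absurd h1.1 h2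
      · exact zero_le_one
      · exact le_rfl
    · refine le_trans (le_of_eq ?_) (pow_nonneg hq0 _)
      refine integral_eq_zero_of_ae (ae_of_all _ fun y => ?_)
      simp only [Pi.zero_apply]
      rw [if_neg]
      rintro ⟨h1, h2⟩
      rw [h1, ← hm] at h2
      exact hmδ h2
  calc ∫ y, (if δ < |(∑ i ∈ S, spin (y i)) / k| then (1 : ℝ) else 0) ∂(plantedLaw ν θ S)
      ≤ ∫ y, ∑ j ∈ Finset.range (S.card + 1), (if ∑ i ∈ S, spin (y i) = 2 * (j : ℝ) - k ∧
          δ < |(∑ i ∈ S, spin (y i)) / k| then (1 : ℝ) else 0) ∂(plantedLaw ν θ S) := by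
        refine integral_mono Integrable.of_finite Integrable.of_finite fun y => ?_
        simp only
        obtain ⟨j, hj, hjy⟩ := exists_sum_spin_eq S y
        split_ifs with h1
        · refine le_trans (le_of_eq ?_) (Finset.single_le_sum (fun j _ => ?_) hj)
          · rw [if_pos ⟨hjy, h1⟩]
          · split_ifs <;> norm_num
        · refine Finset.sum_nonneg fun j _ => ?_
          split_ifs <;> norm_num
    _ ≤ ∑ j ∈ Finset.range (S.card + 1), q ^ S.card := by
        rw [integral_finsetSum _ fun j _ => Integrable.of_finite]
        exact Finset.sum_le_sum hterm
    _ = (k + 1) * q ^ S.card := by simp [hkdef]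
    _ ≤ 1 / k := by
        rw [le_div_iff₀ hk0]
        nlinarith

end annealed

/-! ### The mean-field equation for the Gibbs measure -/

theorem abs_tanh_sub_tanh_le (a b : ℝ) : |Real.tanh a - Real.tanh b| ≤ |a - b| := by
  have := Convex.norm_image_sub_le_of_norm_hasDerivWithin_le (f := Real.tanh) (C := 1)
    (f' := fun x => 1 - Real.tanh x ^ 2) (s := Set.univ) (x := b) (y := a)
    (fun x _ => (hasDerivAt_tanh x).hasDerivWithinAt) (fun x _ => abs_one_sub_tanh_sq_le x)
    convex_univ (Set.mem_univ _) (Set.mem_univ _)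
  simpa using this

/-- The magnetization of the clique per vertex. -/
noncomputable def magnetization {n : ℕ} (S : Finset (Fin n)) (x : Fin n → Bool) : ℝ :=
  (∑ i ∈ S, spin (x i)) / S.card

/-- The deviation of the spin at `i` from its conditional mean. -/
noncomputable def spinDefect {n : ℕ} (θ : ℝ) (S : Finset (Fin n)) (h : Fin n → ℝ) (i : Fin n)
    (x : Fin n → Bool) : ℝ := spin (x i) - Real.tanh (cavityField θ S i x + h i)

/-- The deviation of the magnetization from the solution of the quenched mean-field equation. -/
noncomputable def meanFieldDefect {n : ℕ} (θ : ℝ) (S : Finset (Fin n)) (h : Fin n → ℝ)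
    (x : Fin n → Bool) : ℝ :=
  magnetization S x - (∑ i ∈ S, Real.tanh (θ * magnetization S x + h i)) / S.card

section meanField

variable {n : ℕ} {θ : ℝ} {S : Finset (Fin n)} {h : Fin n → ℝ}

theorem abs_magnetization_le_one (x : Fin n → Bool) : |magnetization S x| ≤ 1 := by
  unfold magnetization
  rw [abs_div, Nat.abs_cast]
  exact div_le_one_of_le₀ (abs_sum_spin_le S x) (Nat.cast_nonneg _)

theorem abs_spinDefect_le (i : Fin n) (x : Fin n → Bool) : |spinDefect θ S h i x| ≤ 2 := by
  refine (abs_sub _ _).trans ?_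
  rw [abs_spin]
  linarith [abs_tanh_le_one (cavityField θ S i x + h i)]

/-- The defect at i is orthogonal to every function not depending on σ_i. The defect at j depends on
σ_i only through its cavity field, so removing σ_i there costs θ/k. -/
theorem abs_gibbsMean_spinDefect_mul_le (hθ : 0 ≤ θ) {i j : Fin n} (hi : i ∈ S) (hij : i ≠ j) :
    |gibbsMean θ S h (fun x => spinDefect θ S h j x * spinDefect θ S h i x)| ≤
      2 * θ / S.card := by
  have hk : (0 : ℝ) < S.card := by exact_mod_cast Finset.card_pos.2 ⟨i, hi⟩
  set g : (Fin n → Bool) → ℝ := fun x =>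
    spin (x j) - Real.tanh (θ / S.card * ∑ l ∈ (S.erase j).erase i, spin (x l) + h j) with hg
  have hgflip : ∀ x, g (flipAt i x) = g x := by
    intro x
    simp only [hg]
    rw [sum_spin_flipAt (Finset.notMem_erase i _), flipAt_of_ne hij.symm]
  have h0 := gibbsMean_mul_spin_sub_tanh (θ := θ) hi h hgflip
  have hclose : ∀ x, |spinDefect θ S h j x - g x| ≤ θ / S.card := by
    intro x
    simp only [hg, spinDefect]
    rw [sub_sub_sub_cancel_left, abs_sub_comm]
    refine (abs_tanh_sub_tanh_le _ _).trans ?_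
    unfold cavityField cavitySum
    rw [← Finset.add_sum_erase (S.erase j) (fun l => spin (x l))
      (Finset.mem_erase.2 ⟨hij, hi⟩)]
    rw [show θ / (S.card : ℝ) * (spin (x i) + ∑ l ∈ (S.erase j).erase i, spin (x l)) + h j -
      (θ / S.card * ∑ l ∈ (S.erase j).erase i, spin (x l) + h j) = θ / S.card * spin (x i) by ring]
    rw [abs_mul, abs_spin, mul_one, abs_of_nonneg (by positivity)]
  have h1 : gibbsMean θ S h (fun x => spinDefect θ S h j x * spinDefect θ S h i x) =
      gibbsMean θ S h (fun x => (spinDefect θ S h j x - g x) * spinDefect θ S h i x) := by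
    have : ∀ x, (spinDefect θ S h j x - g x) * spinDefect θ S h i x =
        spinDefect θ S h j x * spinDefect θ S h i x - g x * spinDefect θ S h i x :=
      fun x => by ring
    simp only [this]
    rw [gibbsMean_sub]
    unfold spinDefect at h0 ⊢
    rw [h0, sub_zero]
  rw [h1]
  refine abs_gibbsMean_le fun x => ?_
  rw [abs_mul]
  have := mul_le_mul (hclose x) (abs_spinDefect_le (θ := θ) (S := S) (h := h) i x) (abs_nonneg _)
    (by positivity)
  calc _ ≤ θ / S.card * 2 := this
    _ = _ := by ring

theorem gibbsMean_sq_sum_spinDefect_le (hθ : 0 ≤ θ) (hS : 0 < S.card) :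
    gibbsMean θ S h (fun x => (∑ i ∈ S, spinDefect θ S h i x) ^ 2) ≤ (4 + 2 * θ) * S.card := by
  have hk : (0 : ℝ) < S.card := by exact_mod_cast hS
  simp only [sq, Finset.sum_mul_sum]
  rw [gibbsMean_sum]
  simp only [gibbsMean_sum]
  have hterm : ∀ i ∈ S, ∀ j ∈ S,
      gibbsMean θ S h (fun x => spinDefect θ S h i x * spinDefect θ S h j x) ≤
        (if i = j then 4 else 0) + 2 * θ / S.card := by
    intro i hi j hj
    by_cases hij : i = j
    · rw [if_pos hij]
      subst hij
      have h1 : gibbsMean θ S h (fun x => spinDefect θ S h i x * spinDefect θ S h i x) ≤ 4 := by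
        refine (le_abs_self _).trans (abs_gibbsMean_le fun x => ?_)
        rw [abs_mul]
        have := abs_spinDefect_le (θ := θ) (S := S) (h := h) i x
        nlinarith [abs_nonneg (spinDefect θ S h i x)]
      have : 0 ≤ 2 * θ / S.card := by positivity
      linarith
    · rw [if_neg hij, zero_add]
      exact (le_abs_self _).trans (abs_gibbsMean_spinDefect_mul_le hθ hj (Ne.symm hij))
  refine (Finset.sum_le_sum fun i hi => Finset.sum_le_sum fun j hj => hterm i hi j hj).trans ?_
  have : ∀ i ∈ S, ∑ j ∈ S, ((if i = j then (4 : ℝ) else 0) + 2 * θ / S.card) = 4 + 2 * θ := by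
    intro i hi
    rw [Finset.sum_add_distrib, Finset.sum_ite_eq, if_pos hi, Finset.sum_const, nsmul_eq_mul]
    field_simp
  rw [Finset.sum_congr rfl this, Finset.sum_const, nsmul_eq_mul, mul_comm]

theorem abs_card_mul_meanFieldDefect_sub_le (hθ : 0 ≤ θ) (hS : 0 < S.card) (x : Fin n → Bool) :
    |S.card * meanFieldDefect θ S h x - ∑ i ∈ S, spinDefect θ S h i x| ≤ θ := by
  have hk : (0 : ℝ) < S.card := by exact_mod_cast hS
  have h1 : S.card * meanFieldDefect θ S h x - ∑ i ∈ S, spinDefect θ S h i x =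
      ∑ i ∈ S, (Real.tanh (cavityField θ S i x + h i) -
        Real.tanh (θ * magnetization S x + h i)) := by
    unfold meanFieldDefect spinDefect
    rw [mul_sub, mul_div_cancel₀ _ hk.ne']
    unfold magnetization
    rw [mul_div_cancel₀ _ hk.ne', Finset.sum_sub_distrib, Finset.sum_sub_distrib]
    ring
  rw [h1]
  refine (Finset.abs_sum_le_sum_abs _ _).trans ?_
  have h2 : ∀ i ∈ S, |Real.tanh (cavityField θ S i x + h i) -
      Real.tanh (θ * magnetization S x + h i)| ≤ θ / S.card := by
    intro i hi
    refine (abs_tanh_sub_tanh_le _ _).trans ?_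
    have : cavityField θ S i x + h i - (θ * magnetization S x + h i) =
        -(θ / S.card * spin (x i)) := by
      unfold cavityField magnetization
      rw [cavitySum_add_spin hi]
      field_simp
      ring
    rw [this, abs_neg, abs_mul, abs_spin, mul_one, abs_of_nonneg (by positivity)]
  refine (Finset.sum_le_sum h2).trans (le_of_eq ?_)
  rw [Finset.sum_const, nsmul_eq_mul]
  field_simp

theorem gibbsMean_sq_meanFieldDefect_le (hθ : 0 ≤ θ) (hS : 0 < S.card) :
    gibbsMean θ S h (fun x => meanFieldDefect θ S h x ^ 2) ≤
      (8 + 4 * θ + 2 * θ ^ 2) / S.card := by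
  have hk : (1 : ℝ) ≤ S.card := by exact_mod_cast hS
  set k : ℝ := (S.card : ℝ) with hkdef
  have h1 : ∀ x, meanFieldDefect θ S h x ^ 2 ≤
      2 / k ^ 2 * (∑ i ∈ S, spinDefect θ S h i x) ^ 2 + 2 * θ ^ 2 / k ^ 2 := by
    intro x
    have h2 := abs_card_mul_meanFieldDefect_sub_le (h := h) hθ hS x
    rw [div_mul_eq_mul_div, ← add_div, le_div_iff₀ (by positivity)]
    have h3 := sq_le_sq' (abs_le.1 h2).1 (abs_le.1 h2).2
    rw [← hkdef] at h3
    nlinarith [sq_nonneg (k * meanFieldDefect θ S h x - 2 * ∑ i ∈ S, spinDefect θ S h i x)]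
  refine (gibbsMean_mono h1).trans ?_
  rw [gibbsMean_add, gibbsMean_const_mul, gibbsMean_const]
  have h4 := mul_le_mul_of_nonneg_left (gibbsMean_sq_sum_spinDefect_le (h := h) hθ hS)
    (show 0 ≤ 2 / k ^ 2 by positivity)
  refine (add_le_add_left h4 _).trans ?_
  rw [← hkdef, div_mul_eq_mul_div, ← add_div, div_le_div_iff₀ (by positivity) (by positivity)]
  nlinarith [mul_nonneg (sq_nonneg θ) (mul_nonneg (sub_nonneg.2 hk) (by linarith : (0:ℝ) ≤ k))]

/-- Each spin defect has Gibbs mean exactly 0, so only the self-interaction error θ/k survives. It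
is much smaller than the root mean square size k^(-1/2), which the critical lower bound needs. -/
theorem abs_gibbsMean_meanFieldDefect_le (hθ : 0 ≤ θ) (hS : 0 < S.card) :
    |gibbsMean θ S h (meanFieldDefect θ S h)| ≤ θ / S.card := by
  have hk : (0 : ℝ) < S.card := by exact_mod_cast hS
  have h0 : gibbsMean θ S h (fun x => ∑ i ∈ S, spinDefect θ S h i x) = 0 := by
    rw [gibbsMean_sum]
    refine Finset.sum_eq_zero fun i hi => ?_
    have := gibbsMean_mul_spin_sub_tanh (θ := θ) hi h (f := fun _ => 1) fun _ => rfl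
    simp only [one_mul] at this
    exact this
  have h1 := abs_gibbsMean_le (θ := θ) (S := S) (h := h)
    (abs_card_mul_meanFieldDefect_sub_le (h := h) hθ hS)
  rw [gibbsMean_sub, gibbsMean_const_mul, h0, sub_zero, abs_mul, abs_of_pos hk] at h1
  rw [le_div_iff₀ hk, mul_comm]
  exact h1

end meanField

/-! ### Fluctuations of the empirical field -/

/-- The coefficient of `tanh u ^ (p + 1)` in the expansion of `tanh (u + s)`. -/
noncomputable def tanhCoeff (p : ℕ) (s : ℝ) : ℝ := (1 - Real.tanh s ^ 2) * (-Real.tanh s) ^ p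

theorem continuous_tanhCoeff (p : ℕ) : Continuous (tanhCoeff p) :=
  (continuous_const.sub (continuous_tanh.pow 2)).mul (continuous_tanh.neg.pow p)

theorem abs_tanhCoeff_le (p : ℕ) (s : ℝ) : |tanhCoeff p s| ≤ 1 := by
  unfold tanhCoeff
  rw [abs_mul, abs_pow, abs_neg]
  exact mul_le_one₀ (abs_one_sub_tanh_sq_le s) (by positivity)
    (pow_le_one₀ (abs_nonneg _) (abs_tanh_le_one s))

theorem tanh_add_formula (u s : ℝ) :
    Real.tanh (u + s) * (1 + Real.tanh u * Real.tanh s) = Real.tanh u + Real.tanh s := by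
  have h1 := (Real.cosh_pos u).ne'
  have h2 := (Real.cosh_pos s).ne'
  have h3 := (Real.cosh_pos (u + s)).ne'
  have h4 : 1 + Real.tanh u * Real.tanh s = Real.cosh (u + s) / (Real.cosh u * Real.cosh s) := by
    rw [Real.tanh_eq_sinh_div_cosh, Real.tanh_eq_sinh_div_cosh, Real.cosh_add]
    field_simp
  rw [h4, Real.tanh_eq_sinh_div_cosh (u + s), Real.tanh_eq_sinh_div_cosh u,
    Real.tanh_eq_sinh_div_cosh s, Real.sinh_add]
  field_simp

/-- With b = tanh u and t = tanh s, tanh(u + s) - t = b (1 - t²)/(1 + b t) is a geometric series in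
-b t. The bound is uniform in s because 1 + b t ≥ 1 - |t| cancels a factor of 1 - t². -/
theorem abs_tanh_add_sub_expansion_le (P : ℕ) (u s : ℝ) :
    |Real.tanh (u + s) - Real.tanh s - ∑ p ∈ Finset.range P, Real.tanh u ^ (p + 1) *
      tanhCoeff p s| ≤ 2 * |Real.tanh u| ^ (P + 1) := by
  have ht := abs_tanh_le_one s
  have hb := abs_tanh_le_one u
  have htlt := Real.abs_tanh_lt_one s
  have hadd := tanh_add_formula u s
  set b := Real.tanh u with hbdef
  set t := Real.tanh s with htdef
  have hbt : |b * t| ≤ |t| := by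
    rw [abs_mul]; exact mul_le_of_le_one_left (abs_nonneg _) hb
  have hden : 1 - |t| ≤ 1 + b * t := by linarith [neg_abs_le (b * t)]
  have hpos : 0 < 1 + b * t := by linarith
  have hgeom : (∑ p ∈ Finset.range P, (-(b * t)) ^ p) * (1 + b * t) = 1 - (-(b * t)) ^ P := by
    have := geom_sum_mul_neg (-(b * t)) P
    rwa [sub_neg_eq_add] at this
  have hsum : ∑ p ∈ Finset.range P, b ^ (p + 1) * tanhCoeff p s =
      b * (1 - t ^ 2) * ∑ p ∈ Finset.range P, (-(b * t)) ^ p := by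
    rw [Finset.mul_sum]
    refine Finset.sum_congr rfl fun p _ => ?_
    rw [tanhCoeff, ← htdef, neg_mul_eq_mul_neg, mul_pow]; ring
  have hrem : (Real.tanh (u + s) - t - ∑ p ∈ Finset.range P, b ^ (p + 1) * tanhCoeff p s) *
      (1 + b * t) = b * (1 - t ^ 2) * (-(b * t)) ^ P := by
    rw [hsum, sub_mul, sub_mul, hadd, mul_assoc _ _ (1 + b * t), hgeom]; ring
  have habs := congrArg abs hrem
  rw [abs_mul, abs_of_pos hpos] at habs
  have hsq : |b * (1 - t ^ 2) * (-(b * t)) ^ P| ≤ 2 * |b| ^ (P + 1) * (1 - |t|) := by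
    have h1 : 1 - t ^ 2 = (1 + |t|) * (1 - |t|) := by rw [← sq_abs]; ring
    rw [abs_mul, abs_mul, abs_pow, abs_neg, abs_mul b t, mul_pow, h1, abs_mul,
      abs_of_nonneg (by positivity : 0 ≤ 1 + |t|), abs_of_nonneg (by linarith : 0 ≤ 1 - |t|)]
    have h2 : |t| ^ P ≤ 1 := pow_le_one₀ (abs_nonneg _) ht
    have h3 : (1 + |t|) * |t| ^ P ≤ 2 * 1 :=
      mul_le_mul (by linarith) h2 (by positivity) (by norm_num)
    have h4 : 0 ≤ |b| ^ (P + 1) * (1 - |t|) := mul_nonneg (by positivity) (by linarith)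
    calc _ = (|b| ^ (P + 1) * (1 - |t|)) * ((1 + |t|) * |t| ^ P) := by ring
      _ ≤ (|b| ^ (P + 1) * (1 - |t|)) * (2 * 1) := mul_le_mul_of_nonneg_left h3 h4
      _ = _ := by ring
  refine le_of_mul_le_mul_right ?_ hpos
  rw [habs]
  refine hsq.trans (mul_le_mul_of_nonneg_left hden (by positivity))

/-- The centred empirical average of `g` over the fields of the clique. -/
noncomputable def empiricalDev {n : ℕ} (ν : Measure ℝ) (S : Finset (Fin n)) (g : ℝ → ℝ)
    (h : Fin n → ℝ) : ℝ := (∑ i ∈ S, (g (h i) - ∫ s, g s ∂ν)) / S.card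

/-- The total fluctuation of the coefficients of the expansion of `tanh (u + h)`. -/
noncomputable def coeffDev {n : ℕ} (ν : Measure ℝ) (S : Finset (Fin n)) (P : ℕ)
    (h : Fin n → ℝ) : ℝ := ∑ p ∈ Finset.range P, |empiricalDev ν S (tanhCoeff p) h|

section fluctuations

variable {n : ℕ} {ν : Measure ℝ} {S : Finset (Fin n)}

theorem continuous_empiricalDev {g : ℝ → ℝ} (hg : Continuous g) :
    Continuous (empiricalDev ν S g) := by
  unfold empiricalDev; fun_prop

theorem continuous_coeffDev (P : ℕ) : Continuous (coeffDev ν S P) :=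
  continuous_finsetSum _ fun p _ => (continuous_empiricalDev (continuous_tanhCoeff p)).abs

theorem coeffDev_nonneg (P : ℕ) (h : Fin n → ℝ) : 0 ≤ coeffDev ν S P h :=
  Finset.sum_nonneg fun _ _ => abs_nonneg _

theorem restoringForce_eq (hS : 0 < S.card) (θ : ℝ) (h : Fin n → ℝ) (x : Fin n → Bool) :
    restoringForce ν θ (magnetization S x) = meanFieldDefect θ S h x +
      empiricalDev ν S (fun s => Real.tanh (θ * magnetization S x + s)) h := by
  have hk : (S.card : ℝ) ≠ 0 := by exact_mod_cast hS.ne'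
  unfold restoringForce meanFieldDefect empiricalDev
  rw [Finset.sum_sub_distrib, Finset.sum_const, nsmul_eq_mul]
  field_simp
  ring

variable [IsProbabilityMeasure ν]

theorem abs_empiricalDev_le {g : ℝ → ℝ} {B : ℝ} (hB : ∀ s, |g s| ≤ B) (h : Fin n → ℝ) :
    |empiricalDev ν S g h| ≤ 2 * B := by
  have hB0 : 0 ≤ B := (abs_nonneg _).trans (hB 0)
  unfold empiricalDev
  rw [abs_div, Nat.abs_cast]
  refine div_le_of_le_mul₀ (Nat.cast_nonneg _) (by linarith) ?_
  refine (Finset.abs_sum_le_sum_abs _ _).trans ?_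
  refine (Finset.sum_le_sum fun i _ => (abs_sub _ _).trans
    (add_le_add (hB (h i)) (abs_integral_le_of_abs_le hB))).trans (le_of_eq ?_)
  rw [Finset.sum_const, nsmul_eq_mul]; ring

theorem integrable_sq_empiricalDev {g : ℝ → ℝ} (hg : Continuous g) {B : ℝ}
    (hB : ∀ s, |g s| ≤ B) :
    Integrable (fun h => empiricalDev ν S g h ^ 2) (iidField n ν) :=
  integrable_of_continuous_of_abs_le ((continuous_empiricalDev hg).pow 2) ((2 * B) ^ 2)
    fun h => by
      rw [abs_pow]; exact pow_le_pow_left₀ (abs_nonneg _) (abs_empiricalDev_le hB h) 2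

theorem integral_sq_empiricalDev_le {g : ℝ → ℝ} (hg : Continuous g) (hB : ∀ s, |g s| ≤ 1)
    (hS : 0 < S.card) :
    ∫ h, empiricalDev ν S g h ^ 2 ∂(iidField n ν) ≤ 1 / S.card := by
  have hk : (0 : ℝ) < S.card := by exact_mod_cast hS
  unfold empiricalDev
  simp only [div_pow]
  rw [integral_div, div_le_div_iff₀ (by positivity) hk]
  have := integral_sq_centered_sum_field_le (ν := ν) S hg hB
  nlinarith

theorem coeffDev_le (P : ℕ) (h : Fin n → ℝ) : coeffDev ν S P h ≤ 2 * P := by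
  refine (Finset.sum_le_sum fun p _ => abs_empiricalDev_le (abs_tanhCoeff_le p) h).trans ?_
  simp [mul_comm]

theorem integrable_sq_coeffDev (P : ℕ) :
    Integrable (fun h => coeffDev ν S P h ^ 2) (iidField n ν) :=
  integrable_of_continuous_of_abs_le ((continuous_coeffDev P).pow 2) ((2 * P) ^ 2) fun h => by
    rw [abs_pow, abs_of_nonneg (coeffDev_nonneg P h)]
    exact pow_le_pow_left₀ (coeffDev_nonneg P h) (coeffDev_le P h) 2

theorem integral_sq_coeffDev_le (P : ℕ) (hS : 0 < S.card) :
    ∫ h, coeffDev ν S P h ^ 2 ∂(iidField n ν) ≤ (P : ℝ) ^ 2 / S.card := by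
  have h1 : ∀ h : Fin n → ℝ, coeffDev ν S P h ^ 2 ≤
      P * ∑ p ∈ Finset.range P, empiricalDev ν S (tanhCoeff p) h ^ 2 := by
    intro h
    have := sq_sum_le_card_mul_sum_sq (s := Finset.range P)
      (f := fun p => |empiricalDev ν S (tanhCoeff p) h|)
    simpa [coeffDev] using this
  have hi : ∀ p, Integrable (fun h => empiricalDev ν S (tanhCoeff p) h ^ 2) (iidField n ν) :=
    fun p => integrable_sq_empiricalDev (continuous_tanhCoeff p) (abs_tanhCoeff_le p)
  refine (integral_mono (integrable_sq_coeffDev P)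
    ((integrable_finsetSum _ fun p _ => hi p).const_mul _) h1).trans ?_
  rw [integral_const_mul, integral_finsetSum _ fun p _ => hi p]
  refine (mul_le_mul_of_nonneg_left (Finset.sum_le_sum fun p _ => integral_sq_empiricalDev_le
    (continuous_tanhCoeff p) (abs_tanhCoeff_le p) hS) (Nat.cast_nonneg P)).trans (le_of_eq ?_)
  rw [Finset.sum_const, Finset.card_range, nsmul_eq_mul]; ring

/-- The field enters the right side only through the P averages in `coeffDev`, whatever u is. So u
may be the random magnetization, without any supremum over u. -/
theorem abs_empiricalDev_tanh_sub_le (P : ℕ) (hS : 0 < S.card) (h : Fin n → ℝ) (u : ℝ) :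
    |empiricalDev ν S (fun s => Real.tanh (u + s)) h - empiricalDev ν S Real.tanh h| ≤
      |u| * coeffDev ν S P h + 4 * |u| ^ (P + 1) := by
  have hk : (0 : ℝ) < S.card := by exact_mod_cast hS
  set R : ℝ → ℝ := fun s => Real.tanh (u + s) - Real.tanh s -
    ∑ p ∈ Finset.range P, Real.tanh u ^ (p + 1) * tanhCoeff p s with hR
  have hRB : ∀ s, |R s| ≤ 2 * |Real.tanh u| ^ (P + 1) := abs_tanh_add_sub_expansion_le P u
  have hi1 : Integrable (fun s => Real.tanh (u + s)) ν :=
    integrable_of_continuous_real (continuous_tanh.comp (by fun_prop)) fun s => abs_tanh_le_one _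
  have hi2 : Integrable Real.tanh ν :=
    integrable_of_continuous_real continuous_tanh abs_tanh_le_one
  have hi3 : ∀ p, Integrable (fun s => Real.tanh u ^ (p + 1) * tanhCoeff p s) ν := fun p =>
    (integrable_of_continuous_real (continuous_tanhCoeff p) (abs_tanhCoeff_le p)).const_mul _
  have hi4 : Integrable (fun s => Real.tanh (u + s) - Real.tanh s) ν := hi1.sub hi2
  have hRint : ∫ s, R s ∂ν = ∫ s, Real.tanh (u + s) ∂ν - ∫ s, Real.tanh s ∂ν -
      ∑ p ∈ Finset.range P, Real.tanh u ^ (p + 1) * ∫ s, tanhCoeff p s ∂ν := by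
    rw [hR, integral_sub hi4 (integrable_finsetSum _ fun p _ => hi3 p), integral_sub hi1 hi2,
      integral_finsetSum _ fun p _ => hi3 p]
    simp only [integral_const_mul]
  have hdecomp : empiricalDev ν S (fun s => Real.tanh (u + s)) h - empiricalDev ν S Real.tanh h =
      (∑ p ∈ Finset.range P, Real.tanh u ^ (p + 1) * empiricalDev ν S (tanhCoeff p) h) +
        empiricalDev ν S R h := by
    unfold empiricalDev
    rw [hRint]
    simp only [mul_div_assoc', ← Finset.sum_div, Finset.mul_sum]
    rw [← sub_div, ← add_div, Finset.sum_comm, ← Finset.sum_sub_distrib, ← Finset.sum_add_distrib]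
    congr 1
    refine Finset.sum_congr rfl fun i _ => ?_
    simp only [hR, mul_sub, Finset.sum_sub_distrib]
    ring
  have htu : |Real.tanh u| ≤ |u| := by simpa using abs_tanh_sub_tanh_le u 0
  rw [hdecomp]
  refine (abs_add_le _ _).trans (add_le_add ?_ ?_)
  · refine (Finset.abs_sum_le_sum_abs _ _).trans ?_
    unfold coeffDev
    rw [Finset.mul_sum]
    refine Finset.sum_le_sum fun p _ => ?_
    rw [abs_mul, abs_pow]
    refine mul_le_mul_of_nonneg_right ?_ (abs_nonneg _)
    rw [pow_succ]
    exact (mul_le_of_le_one_left (abs_nonneg _)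
      (pow_le_one₀ (abs_nonneg _) (abs_tanh_le_one u))).trans htu
  · refine (abs_empiricalDev_le hRB h).trans ?_
    have : |Real.tanh u| ^ (P + 1) ≤ |u| ^ (P + 1) := pow_le_pow_left₀ (abs_nonneg _) htu _
    linarith

end fluctuations

/-! ### Upper bounds on the moments of the magnetization -/

/-- For small M, c |M|^N is at most the mean-field defect plus field fluctuations, each of mean
square O(1/k), plus a remainder of order |M|^(N+1) that is absorbed on the left. Large M has
probability at most 1/k. -/
theorem exists_integral_magnetization_pow_le {ν : Measure ℝ} [IsProbabilityMeasure ν]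
    (hint : Integrable (fun h : ℝ => h) ν) {θ : ℝ} (hθ : 0 < θ)
    (hmin : ZeroIsUniqueMinimum ν θ) {τ : ℕ} (hτ : HasFlatness ν θ τ) :
    ∃ C : ℝ, 0 < C ∧ ∀ᶠ k : ℕ in atTop, ∀ (n : ℕ) (S : Finset (Fin n)), S.card = k →
      ∫ x, (magnetization S x ^ 2) ^ (2 * τ - 1) ∂(plantedLaw ν θ S) ≤ C / k := by
  obtain ⟨c, -, δ₀, hc, -, hδ₀, hlow, -⟩ := hτ.exists_bounds
  set N := 2 * τ - 1 with hN
  -- Here 64 = 4 · 4²: squaring a sum of four terms costs 4 and the remainder carries the constant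
  -- 4. The condition makes its share at most half of c² (m²)^N.
  obtain ⟨δ, hδ, hδδ₀, hδ1, hδc⟩ : ∃ δ : ℝ, 0 < δ ∧ δ ≤ δ₀ ∧ δ ≤ 1 ∧
      64 * θ ^ (2 * N + 2) * δ ^ 2 ≤ c ^ 2 / 2 := by
    have hcont : Tendsto (fun δ : ℝ => 64 * θ ^ (2 * N + 2) * δ ^ 2) (𝓝[>] 0) (𝓝 0) := by
      have : Continuous fun δ : ℝ => 64 * θ ^ (2 * N + 2) * δ ^ 2 := by fun_prop
      simpa using (this.tendsto 0).mono_left nhdsWithin_le_nhds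
    have e1 := hcont.eventually (gt_mem_nhds (show 0 < c ^ 2 / 2 by positivity))
    have e2 : ∀ᶠ δ : ℝ in 𝓝[>] 0, δ < min δ₀ 1 :=
      (gt_mem_nhds (lt_min hδ₀ one_pos)).filter_mono nhdsWithin_le_nhds
    obtain ⟨δ, ⟨h1, h2⟩, h3⟩ := ((e1.and e2).and self_mem_nhdsWithin).exists
    exact ⟨δ, h3, h2.le.trans (min_le_left _ _), h2.le.trans (min_le_right _ _), h1.le⟩
  refine ⟨8 / c ^ 2 * ((8 + 4 * θ + 2 * θ ^ 2) + 1 + θ ^ 2 * (N : ℝ) ^ 2) + 1, by positivity, ?_⟩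
  filter_upwards [eventually_integral_large_cliqueSum_le hint hθ hmin hδ, eventually_ge_atTop 1]
    with k htail hk1 n S hS
  have hS0 : 0 < S.card := by omega
  have hk0 : (0 : ℝ) < k := by exact_mod_cast hk1
  have hpoint : ∀ (h : Fin n → ℝ) (x : Fin n → Bool), (magnetization S x ^ 2) ^ N ≤
      8 / c ^ 2 * (meanFieldDefect θ S h x ^ 2) +
        8 / c ^ 2 * (empiricalDev ν S Real.tanh h ^ 2 + θ ^ 2 * coeffDev ν S N h ^ 2) +
      (if δ < |(∑ i ∈ S, spin (x i)) / S.card| then 1 else 0) := by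
    intro h x
    set m := magnetization S x with hm
    have hm1 : |m| ≤ 1 := abs_magnetization_le_one x
    have hmsq : m ^ 2 ≤ 1 := by rw [← sq_abs]; exact pow_le_one₀ (abs_nonneg _) hm1
    have hcoef : 0 ≤ 8 / c ^ 2 * (meanFieldDefect θ S h x ^ 2) +
        8 / c ^ 2 * (empiricalDev ν S Real.tanh h ^ 2 + θ ^ 2 * coeffDev ν S N h ^ 2) := by
      positivity
    have hmd : (∑ i ∈ S, spin (x i)) / S.card = m := rfl
    rw [hmd]
    split_ifs with hif
    · have : (m ^ 2) ^ N ≤ 1 := pow_le_one₀ (sq_nonneg m) hmsq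
      linarith
    · have hmδ : |m| ≤ δ := not_lt.1 hif
      have h1 := hlow m (hmδ.trans hδδ₀)
      rw [restoringForce_eq hS0 θ h x] at h1
      have h2 := abs_empiricalDev_tanh_sub_le (ν := ν) N hS0 h (θ * m)
      set D := meanFieldDefect θ S h x
      set E := empiricalDev ν S (fun s => Real.tanh (θ * magnetization S x + s)) h
      set E0 := empiricalDev ν S Real.tanh h
      set W := coeffDev ν S N h
      have hW0 : 0 ≤ W := coeffDev_nonneg N h
      rw [abs_mul, abs_of_pos hθ] at h2
      have h3 : c * |m| ^ N ≤ |D| + |E0| + θ * W + 4 * (θ * |m|) ^ (N + 1) := by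
        have e1 : |D + E| ≤ |D| + (|E - E0| + |E0|) := by
          refine (abs_add_le _ _).trans ?_
          have := abs_add_le (E - E0) E0
          rw [sub_add_cancel] at this
          linarith
        have e2 : θ * |m| * W ≤ θ * W := by
          refine mul_le_mul_of_nonneg_right ?_ hW0
          exact mul_le_of_le_one_right hθ.le hm1
        linarith
      have h4 : (c * |m| ^ N) ^ 2 ≤
          4 * (D ^ 2 + E0 ^ 2 + (θ * W) ^ 2 + (4 * (θ * |m|) ^ (N + 1)) ^ 2) := by
        refine (pow_le_pow_left₀ (by positivity) h3 2).trans ?_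
        rw [← sq_abs D, ← sq_abs E0]
        nlinarith [sq_nonneg (|D| - |E0|), sq_nonneg (|D| - θ * W),
          sq_nonneg (|D| - 4 * (θ * |m|) ^ (N + 1)), sq_nonneg (|E0| - θ * W),
          sq_nonneg (|E0| - 4 * (θ * |m|) ^ (N + 1)),
          sq_nonneg (θ * W - 4 * (θ * |m|) ^ (N + 1))]
      have hpow : (|m| ^ N) ^ 2 = (m ^ 2) ^ N := by
        rw [← pow_mul, mul_comm, pow_mul, sq_abs]
      have h5 : 4 * (4 * (θ * |m|) ^ (N + 1)) ^ 2 ≤ c ^ 2 / 2 * (m ^ 2) ^ N := by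
        have e1 : 4 * (4 * (θ * |m|) ^ (N + 1)) ^ 2 =
            64 * θ ^ (2 * N + 2) * |m| ^ 2 * (m ^ 2) ^ N := by
          rw [← hpow]; ring
        rw [e1]
        refine mul_le_mul_of_nonneg_right (le_trans ?_ hδc) (by positivity)
        gcongr
      rw [mul_pow, hpow] at h4
      have h6 : c ^ 2 / 2 * (m ^ 2) ^ N ≤ 4 * (D ^ 2 + E0 ^ 2 + θ ^ 2 * W ^ 2) := by
        rw [mul_pow θ W] at h4
        linarith
      have h7 : (m ^ 2) ^ N = 2 / c ^ 2 * (c ^ 2 / 2 * (m ^ 2) ^ N) := by field_simp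
      rw [h7]
      refine (mul_le_mul_of_nonneg_left h6 (by positivity)).trans (le_of_eq ?_)
      ring
  have hquenched : ∀ h : Fin n → ℝ, gibbsMean θ S h (fun x => (magnetization S x ^ 2) ^ N) ≤
      8 / c ^ 2 * ((8 + 4 * θ + 2 * θ ^ 2) / k) +
        8 / c ^ 2 * (empiricalDev ν S Real.tanh h ^ 2 + θ ^ 2 * coeffDev ν S N h ^ 2) +
      gibbsMean θ S h (fun x => if δ < |(∑ i ∈ S, spin (x i)) / S.card| then 1 else 0) := by
    intro h
    refine (gibbsMean_mono (hpoint h)).trans ?_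
    rw [gibbsMean_add, gibbsMean_add, gibbsMean_const_mul, gibbsMean_const]
    have := gibbsMean_sq_meanFieldDefect_le (h := h) hθ.le hS0
    rw [hS] at this
    gcongr
  have hi1 := integrable_sq_empiricalDev (ν := ν) (S := S) continuous_tanh abs_tanh_le_one
  have hi2 := integrable_sq_coeffDev (ν := ν) (S := S) N
  have hi3 : Integrable (fun h => 8 / c ^ 2 * (empiricalDev ν S Real.tanh h ^ 2 +
      θ ^ 2 * coeffDev ν S N h ^ 2)) (iidField n ν) := (hi1.add (hi2.const_mul _)).const_mul _
  have hi4 := integrable_gibbsMean ν θ S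
    (fun x => if δ < |(∑ i ∈ S, spin (x i)) / S.card| then 1 else 0)
  have hi5 : Integrable (fun h => 8 / c ^ 2 * ((8 + 4 * θ + 2 * θ ^ 2) / k) +
      8 / c ^ 2 * (empiricalDev ν S Real.tanh h ^ 2 + θ ^ 2 * coeffDev ν S N h ^ 2))
      (iidField n ν) := (integrable_const _).add hi3
  rw [integral_plantedLaw]
  refine (integral_mono (integrable_gibbsMean ν θ S _) (hi5.add hi4) hquenched).trans ?_
  have hI3 : ∫ h, 8 / c ^ 2 * (empiricalDev ν S Real.tanh h ^ 2 +
      θ ^ 2 * coeffDev ν S N h ^ 2) ∂(iidField n ν) =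
      8 / c ^ 2 * (∫ h, empiricalDev ν S Real.tanh h ^ 2 ∂(iidField n ν) +
        θ ^ 2 * ∫ h, coeffDev ν S N h ^ 2 ∂(iidField n ν)) := by
    rw [integral_const_mul, integral_add hi1 (hi2.const_mul _), integral_const_mul]
  simp only [Pi.add_apply]
  rw [integral_add hi5 hi4, integral_add (integrable_const _) hi3, hI3, ← integral_plantedLaw]
  have h1 := integral_sq_empiricalDev_le (ν := ν) continuous_tanh abs_tanh_le_one hS0
  have h2 := integral_sq_coeffDev_le (ν := ν) N hS0
  have h3 := htail n S hS
  rw [hS] at h1 h2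
  simp only [integral_const, probReal_univ, one_smul]
  have h4 : ∫ h, empiricalDev ν S Real.tanh h ^ 2 ∂(iidField n ν) +
      θ ^ 2 * ∫ h, coeffDev ν S N h ^ 2 ∂(iidField n ν) ≤ 1 / k + θ ^ 2 * ((N : ℝ) ^ 2 / k) := by
    gcongr
  have h5 := mul_le_mul_of_nonneg_left h4 (show 0 ≤ 8 / c ^ 2 by positivity)
  refine (add_le_add (add_le_add_right h5 _) h3).trans (le_of_eq ?_)
  field_simp
  ring

/-- Interpolation: a bound on a high moment of the magnetization bounds the second moment. -/
theorem integral_sq_magnetization_le {n : ℕ} {ν : Measure ℝ} [IsProbabilityMeasure ν] {θ : ℝ}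
    {S : Finset (Fin n)} {N : ℕ} (hN : 1 ≤ N) {C l : ℝ} (hl : 0 < l)
    (hlN : l ^ N * S.card = 1)
    (h : ∫ x, (magnetization S x ^ 2) ^ N ∂(plantedLaw ν θ S) ≤ C / S.card) :
    ∫ x, magnetization S x ^ 2 ∂(plantedLaw ν θ S) ≤ (1 + C) * l := by
  have hpoint : ∀ x : Fin n → Bool, magnetization S x ^ 2 ≤
      l + l * S.card * (magnetization S x ^ 2) ^ N := by
    intro x
    set z := magnetization S x ^ 2 with hz
    have hz0 : 0 ≤ z := sq_nonneg _
    -- Since k = l^(-N), l is the natural scale of m²; then either z ≤ l or z/l ≤ (z/l)^N.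
    have hr : l * S.card * z ^ N = l * (z / l) ^ N := by
      rw [div_pow]
      have : (S.card : ℝ) = 1 / l ^ N := by field_simp; linarith
      rw [this]; field_simp
    rw [hr]
    rcases le_total z l with hle | hle
    · have : 0 ≤ l * (z / l) ^ N := by positivity
      linarith
    · have h1 : 1 ≤ z / l := by rwa [le_div_iff₀ hl, one_mul]
      have h2 : z / l ≤ (z / l) ^ N := le_self_pow₀ h1 (by omega)
      have h3 := mul_le_mul_of_nonneg_left h2 hl.le
      rw [mul_div_cancel₀ _ hl.ne'] at h3
      linarith
  have hk : (0 : ℝ) < S.card := by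
    have : (S.card : ℝ) ≠ 0 := fun h0 => by rw [h0, mul_zero] at hlN; exact zero_ne_one hlN
    positivity
  refine (integral_mono Integrable.of_finite Integrable.of_finite hpoint).trans ?_
  rw [integral_add Integrable.of_finite Integrable.of_finite, integral_const_mul]
  simp only [integral_const, probReal_univ, one_smul]
  have := mul_le_mul_of_nonneg_left h (show 0 ≤ l * S.card by positivity)
  have e : l * S.card * (C / S.card) = l * C := by field_simp
  linarith

/-! ### The fluctuation of the random field -/

theorem integral_tanh_sq_pos {ν : Measure ℝ} [IsProbabilityMeasure ν]
    (hν : ν ≠ Measure.dirac 0) : 0 < ∫ s, Real.tanh s ^ 2 ∂ν := by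
  refine lt_of_le_of_ne (integral_nonneg fun s => sq_nonneg _) fun h0 => hν ?_
  have hi : Integrable (fun s => Real.tanh s ^ 2) ν :=
    integrable_of_continuous_real (continuous_tanh.pow 2) (B := 1) fun s => by
      rw [abs_pow]; exact pow_le_one₀ (abs_nonneg _) (abs_tanh_le_one s)
  have h1 := (integral_eq_zero_iff_of_nonneg (fun s => sq_nonneg _) hi).1 h0.symm
  have h2 : (fun s : ℝ => s) =ᵐ[ν] fun _ => (0 : ℝ) := by
    filter_upwards [h1] with s hs
    have h3 : Real.tanh s = 0 := by simpa using hs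
    rw [Real.tanh_eq_sinh_div_cosh, div_eq_zero_iff] at h3
    exact Real.sinh_eq_zero.1 (h3.resolve_right (Real.cosh_pos s).ne')
  calc ν = ν.map (fun s => s) := Measure.map_id'.symm
    _ = ν.map fun _ => (0 : ℝ) := Measure.map_congr h2
    _ = Measure.dirac 0 := by rw [Measure.map_const, measure_univ, one_smul]

theorem pow_four_le_exp_add_exp_neg (x : ℝ) : x ^ 4 ≤ 24 * (Real.exp x + Real.exp (-x)) := by
  have h1 := Real.pow_div_factorial_le_exp |x| (abs_nonneg x) 4
  have h2 : |x| ^ 4 = x ^ 4 := by rw [pow_abs, abs_of_nonneg (by positivity)]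
  have h3 : ((Nat.factorial 4 : ℕ) : ℝ) = 24 := by norm_num [Nat.factorial]
  rw [h2, h3, div_le_iff₀ (by norm_num)] at h1
  have h4 : Real.exp |x| ≤ Real.exp x + Real.exp (-x) := by
    rcases abs_cases x with ⟨h, _⟩ | ⟨h, _⟩ <;> rw [h] <;>
      linarith [Real.exp_pos x, Real.exp_pos (-x)]
  linarith

/-- Each factor is at most 1 + 1/k ≤ e^(1/k), since g is centred and bounded by 1. -/
theorem integral_exp_sum_le {n : ℕ} {ν : Measure ℝ} [IsProbabilityMeasure ν]
    {S : Finset (Fin n)} (hS : 0 < S.card) {g : ℝ → ℝ} (hg : Continuous g)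
    (hB : ∀ s, |g s| ≤ 1) (h0 : ∫ s, g s ∂ν = 0) :
    ∫ h, Real.exp ((∑ i ∈ S, g (h i)) / Real.sqrt S.card) ∂(iidField n ν) ≤ Real.exp 1 := by
  have hk : (1 : ℝ) ≤ S.card := by exact_mod_cast hS
  set w := Real.sqrt S.card with hw
  have hw1 : 1 ≤ w := Real.one_le_sqrt.2 hk
  have hww : w ^ 2 = S.card := Real.sq_sqrt (by linarith)
  have h1 : ∀ h : Fin n → ℝ, Real.exp ((∑ i ∈ S, g (h i)) / w) =
      ∏ i ∈ S, Real.exp (1 / w * g (h i)) := by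
    intro h
    rw [← Real.exp_sum, Finset.sum_div]
    congr 1
    exact Finset.sum_congr rfl fun i _ => by ring
  simp only [h1]
  rw [integral_prod_field S fun s => Real.exp (1 / w * g s)]
  have h2 := integral_exp_le (P := ν) hg.measurable (l := 1 / w) hB (by positivity)
    (by rw [mul_one, div_le_one (by positivity)]; exact hw1)
  have h3 : ∫ s, g s ^ 2 ∂ν ≤ 1 := by
    refine (integral_mono (integrable_of_continuous_real (by fun_prop) (B := 1) fun s => ?_)
      (integrable_const 1) fun s => ?_).trans (by simp)
    · rw [abs_pow]; exact pow_le_one₀ (abs_nonneg _) (hB s)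
    · simp only [← sq_abs (g s)]; exact pow_le_one₀ (abs_nonneg _) (hB s)
  rw [h0, mul_zero, add_zero, div_pow, hww] at h2
  have h4 : ∫ s, Real.exp (1 / w * g s) ∂ν ≤ Real.exp (1 / S.card) := by
    refine h2.trans ?_
    have h5 : 1 ^ 2 / (S.card : ℝ) * ∫ s, g s ^ 2 ∂ν ≤ 1 / S.card := by
      rw [one_pow]; exact mul_le_of_le_one_right (by positivity) h3
    linarith [Real.add_one_le_exp (1 / (S.card : ℝ))]
  refine (pow_le_pow_left₀ (integral_nonneg fun s => (Real.exp_pos _).le) h4 _).trans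
    (le_of_eq ?_)
  rw [← Real.exp_nat_mul]
  congr 1
  field_simp

/-- A central limit lower bound without a limit theorem: the normalised sum has fixed positive
variance and bounded fourth moment, hence a first absolute moment bounded below. -/
theorem exists_le_integral_abs_empiricalDev {ν : Measure ℝ} [IsProbabilityMeasure ν]
    (hsymm : ν.map (fun h : ℝ => -h) = ν) (hν : ν ≠ Measure.dirac 0) :
    ∃ c : ℝ, 0 < c ∧ ∀ (n : ℕ) (S : Finset (Fin n)), 0 < S.card →
      c ≤ Real.sqrt S.card * ∫ h, |empiricalDev ν S Real.tanh h| ∂(iidField n ν) := by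
  set v := ∫ s, Real.tanh s ^ 2 ∂ν with hv
  have hv0 : 0 < v := integral_tanh_sq_pos hν
  have ht0 := integral_tanh_eq_zero hsymm
  -- Chosen so that K² v is twice the fourth moment bound 48 e; then K² E[X²] - E[X⁴] ≥ K² v/2.
  set K := Real.sqrt (96 * Real.exp 1 / v) with hK
  have hK2 : K ^ 2 = 96 * Real.exp 1 / v := Real.sq_sqrt (by positivity)
  have hK0 : 0 < K := Real.sqrt_pos.2 (by positivity)
  refine ⟨v / (2 * K), by positivity, fun n S hS => ?_⟩
  have hk : (0 : ℝ) < S.card := by exact_mod_cast hS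
  set w := Real.sqrt S.card with hw
  have hw0 : 0 < w := Real.sqrt_pos.2 hk
  have hww : w ^ 2 = S.card := Real.sq_sqrt hk.le
  set X : (Fin n → ℝ) → ℝ := fun h => (∑ i ∈ S, Real.tanh (h i)) / w with hX
  have hXc : Continuous X :=
    (continuous_finsetSum _ fun i _ => continuous_tanh.comp (continuous_apply i)).div_const _
  have hXB : ∀ h, |X h| ≤ S.card / w := by
    intro h
    rw [hX, abs_div, abs_of_pos hw0]
    refine div_le_div_of_nonneg_right ?_ hw0.le
    refine (Finset.abs_sum_le_sum_abs _ _).trans ?_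
    exact (Finset.sum_le_sum fun i _ => abs_tanh_le_one (h i)).trans (by simp)
  have hint : ∀ {f : ℝ → ℝ}, Continuous f →
      Integrable (fun h => f (X h)) (iidField n ν) := by
    intro f hf
    obtain ⟨B, hB⟩ := (isCompact_Icc (a := -((S.card : ℝ) / w))
      (b := S.card / w)).exists_bound_of_continuousOn hf.continuousOn
    exact integrable_of_continuous_of_abs_le (hf.comp hXc) B fun h => hB _ (abs_le.1 (hXB h))
  have hX2 : ∫ h, X h ^ 2 ∂(iidField n ν) = v := by
    simp only [hX, div_pow]
    rw [integral_div, integral_sq_sum_field S continuous_tanh abs_tanh_le_one ht0, hww, ← hv]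
    field_simp
  have hX4 : ∫ h, X h ^ 4 ∂(iidField n ν) ≤ 48 * Real.exp 1 := by
    have e1 := integral_exp_sum_le (ν := ν) hS continuous_tanh abs_tanh_le_one ht0
    have e2 := integral_exp_sum_le (ν := ν) hS (g := fun s => -Real.tanh s)
      continuous_tanh.neg (fun s => by rw [abs_neg]; exact abs_tanh_le_one s)
      (by rw [integral_neg, ht0, neg_zero])
    have e3 : ∀ h : Fin n → ℝ, (∑ i ∈ S, -Real.tanh (h i)) / w = -X h := by
      intro h; rw [hX, Finset.sum_neg_distrib, neg_div]
    rw [← hw] at e1 e2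
    simp only [e3] at e2
    have i1 := hint Real.continuous_exp
    have i2 := hint (f := fun x => Real.exp (-x)) (by fun_prop)
    refine (integral_mono (hint (f := fun x => x ^ 4) (by fun_prop)) ((i1.add i2).const_mul 24)
      fun h => pow_four_le_exp_add_exp_neg (X h)).trans ?_
    simp only [Pi.add_apply]
    rw [integral_const_mul, integral_add i1 i2]
    have e4 : ∫ h, Real.exp (X h) ∂(iidField n ν) ≤ Real.exp 1 := e1
    linarith
  have hpoint : ∀ h, K ^ 2 * X h ^ 2 - X h ^ 4 ≤ K ^ 3 * |X h| := by
    intro h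
    have h2 : X h ^ 2 = |X h| ^ 2 := (sq_abs _).symm
    have h4 : X h ^ 4 = |X h| ^ 4 := by rw [pow_abs, abs_of_nonneg (by positivity)]
    rw [h2, h4]
    set y := |X h|
    have hy : 0 ≤ y := abs_nonneg _
    rcases le_total y K with hyK | hyK
    · have : K ^ 2 * y * y ≤ K ^ 2 * y * K := mul_le_mul_of_nonneg_left hyK (by positivity)
      nlinarith [pow_nonneg hy 4]
    · have h5 : K ^ 2 ≤ y ^ 2 := pow_le_pow_left₀ hK0.le hyK 2
      have : K ^ 2 * y ^ 2 ≤ y ^ 2 * y ^ 2 := mul_le_mul_of_nonneg_right h5 (by positivity)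
      have : 0 ≤ K ^ 3 * y := by positivity
      nlinarith
  have i2 := (hint (f := fun x => x ^ 2) (by fun_prop)).const_mul (K ^ 2)
  have i4 := hint (f := fun x => x ^ 4) (by fun_prop)
  have iabs := hint (f := fun x => |x|) continuous_abs
  have hmain := integral_mono (i2.sub i4) (iabs.const_mul (K ^ 3)) hpoint
  simp only [Pi.sub_apply] at hmain
  rw [integral_sub i2 i4, integral_const_mul, integral_const_mul, hX2] at hmain
  have hfin : v / (2 * K) ≤ ∫ h, |X h| ∂(iidField n ν) := by
    have e1 : K ^ 2 * v = 96 * Real.exp 1 := by rw [hK2]; field_simp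
    have e2 : K ^ 2 * v / 2 ≤ K ^ 3 * ∫ h, |X h| ∂(iidField n ν) := by linarith
    have e3 : K ^ 2 * v / 2 = K ^ 3 * (v / (2 * K)) := by field_simp
    rw [e3] at e2
    exact le_of_mul_le_mul_left e2 (by positivity)
  refine hfin.trans (le_of_eq ?_)
  rw [← integral_const_mul]
  refine integral_congr_ae (ae_of_all _ fun h => ?_)
  simp only [hX, empiricalDev, ht0, sub_zero, abs_div, abs_of_pos hw0, ← hww]
  rw [abs_of_nonneg (sq_nonneg w)]
  field_simp

/-! ### The lower bound at critical temperature -/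

/-- The empirical mean of tanh h_i does not depend on the spins, so the mean-field equation may be
averaged over the Gibbs measure before taking absolute values. The cross terms are split by the
arithmetic-geometric mean inequality with a free weight η. -/
theorem abs_empiricalDev_tanh_le {n : ℕ} {ν : Measure ℝ} [IsProbabilityMeasure ν] {θ : ℝ}
    (hθ : 0 ≤ θ) {S : Finset (Fin n)} (hS : 0 < S.card) {N : ℕ} {C η : ℝ} (hη : 0 < η)
    (hC : ∀ m, |m| ≤ 1 → |restoringForce ν θ m| ≤ C * |m| ^ N) (h : Fin n → ℝ) :
    |empiricalDev ν S Real.tanh h| ≤ gibbsMean θ S h (fun x =>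
      C * |magnetization S x| ^ N + (θ / (2 * η) + 2 * θ ^ (N + 1) / η) * magnetization S x ^ 2 +
        2 * θ ^ (N + 1) * η * (magnetization S x ^ 2) ^ N) +
      (θ * η / 2 * coeffDev ν S N h ^ 2 + θ / S.card) := by
  have h1 : |empiricalDev ν S Real.tanh h| ≤
      |gibbsMean θ S h (fun x => empiricalDev ν S Real.tanh h + meanFieldDefect θ S h x)| +
        θ / S.card := by
    have e1 := abs_gibbsMean_meanFieldDefect_le (h := h) hθ hS
    have e2 : gibbsMean θ S h (fun x => empiricalDev ν S Real.tanh h + meanFieldDefect θ S h x) =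
        empiricalDev ν S Real.tanh h + gibbsMean θ S h (meanFieldDefect θ S h) := by
      rw [gibbsMean_add, gibbsMean_const]
    rw [e2]
    have e3 := abs_sub (empiricalDev ν S Real.tanh h + gibbsMean θ S h (meanFieldDefect θ S h))
      (gibbsMean θ S h (meanFieldDefect θ S h))
    rw [add_sub_cancel_right] at e3
    linarith
  rw [← add_assoc]
  refine h1.trans (add_le_add_left ?_ _)
  refine (abs_gibbsMean_le_gibbsMean_abs _).trans ?_
  rw [← gibbsMean_const (θ := θ) (S := S) (h := h) (θ * η / 2 * coeffDev ν S N h ^ 2),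
    ← gibbsMean_add]
  refine gibbsMean_mono fun x => ?_
  set m := magnetization S x with hm
  have hF := hC m (abs_magnetization_le_one x)
  have hE := abs_empiricalDev_tanh_sub_le (ν := ν) N hS h (θ * m)
  have hdec := restoringForce_eq (ν := ν) hS θ h x
  rw [← hm] at hdec
  have e1 : empiricalDev ν S Real.tanh h + meanFieldDefect θ S h x = restoringForce ν θ m -
      (empiricalDev ν S (fun s => Real.tanh (θ * m + s)) h - empiricalDev ν S Real.tanh h) := by
    rw [hdec]; ring
  rw [e1]
  refine (abs_sub _ _).trans ?_
  rw [abs_mul, abs_of_nonneg hθ, mul_pow] at hE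
  set W := coeffDev ν S N h
  have hW : |m| * W ≤ η / 2 * W ^ 2 + 1 / (2 * η) * m ^ 2 := by
    have : 0 ≤ (η * W - |m|) ^ 2 / (2 * η) := by positivity
    have e : η / 2 * W ^ 2 + 1 / (2 * η) * m ^ 2 - |m| * W = (η * W - |m|) ^ 2 / (2 * η) := by
      rw [← sq_abs m]; field_simp; ring
    linarith
  have hP : |m| ^ (N + 1) ≤ 1 / (2 * η) * m ^ 2 + η / 2 * (m ^ 2) ^ N := by
    have : 0 ≤ (η * |m| ^ N - |m|) ^ 2 / (2 * η) := by positivity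
    have e : 1 / (2 * η) * m ^ 2 + η / 2 * (m ^ 2) ^ N - |m| ^ (N + 1) =
        (η * |m| ^ N - |m|) ^ 2 / (2 * η) := by
      rw [← sq_abs m]; field_simp; ring
    linarith
  have hW' := mul_le_mul_of_nonneg_left hW hθ
  have hP' := mul_le_mul_of_nonneg_left hP (show 0 ≤ 4 * θ ^ (N + 1) by positivity)
  refine (add_le_add hF hE).trans ?_
  have e2 : θ * (1 / (2 * η) * m ^ 2) = θ / (2 * η) * m ^ 2 := by ring
  have e3 : 4 * θ ^ (N + 1) * (1 / (2 * η) * m ^ 2) = 2 * θ ^ (N + 1) / η * m ^ 2 := by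
    field_simp; ring
  linarith

theorem pow_le_interpolation {N : ℕ} (hN : 2 ≤ N) {y L : ℝ} (hy : 0 ≤ y) (hL : 0 < L) :
    y ^ N ≤ L ^ (N - 2) * y ^ 2 + (y ^ 2) ^ N / L ^ N := by
  rcases le_total y L with h | h
  · have h1 : y ^ N = y ^ (N - 2) * y ^ 2 := by rw [← pow_add]; congr 1; omega
    have h2 : y ^ (N - 2) ≤ L ^ (N - 2) := pow_le_pow_left₀ hy h _
    have h3 : 0 ≤ (y ^ 2) ^ N / L ^ N := by positivity
    rw [h1]
    nlinarith [mul_le_mul_of_nonneg_right h2 (sq_nonneg y)]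
  · have h1 : y ^ N ≤ (y ^ 2) ^ N / L ^ N := by
      rw [le_div_iff₀ (by positivity), ← pow_mul, mul_comm 2 N, pow_mul, sq]
      exact mul_le_mul_of_nonneg_left (pow_le_pow_left₀ hL.le h N) (by positivity)
    have h3 : 0 ≤ L ^ (N - 2) * y ^ 2 := by positivity
    linarith

/-- The field fluctuation k^(-1/2) forces E|M|^N to be at least of that order. As E[M^(2N)] =
O(1/k), large values cannot carry this moment, so values |M| ≤ L √l must, and these contribute to
E[M²]. -/
theorem exists_le_integral_sq_magnetization {ν : Measure ℝ} [IsProbabilityMeasure ν]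
    (hint : Integrable (fun h : ℝ => h) ν) (hsymm : ν.map (fun h : ℝ => -h) = ν) {θ : ℝ}
    (hθ : 0 < θ) (hmin : ZeroIsUniqueMinimum ν θ) (hν : ν ≠ Measure.dirac 0) {τ : ℕ}
    (hτ2 : 2 ≤ τ) (hτ : HasFlatness ν θ τ) {l : ℕ → ℝ} (hl : ∀ k, 1 ≤ k → 0 < l k)
    (hlN : ∀ k, 1 ≤ k → l k ^ (2 * τ - 1) * k = 1) (hl0 : Tendsto l atTop (𝓝 0)) :
    ∃ c : ℝ, 0 < c ∧ ∀ᶠ k : ℕ in atTop, ∀ (n : ℕ) (S : Finset (Fin n)), S.card = k →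
      c * l k ≤ ∫ x, magnetization S x ^ 2 ∂(plantedLaw ν θ S) := by
  obtain ⟨C, hC, hmom⟩ := exists_integral_magnetization_pow_le hint hθ hmin hτ
  obtain ⟨-, C₂, -, -, hC₂, -, -, hup⟩ := hτ.exists_bounds
  obtain ⟨c₄, hc₄, hdev⟩ := exists_le_integral_abs_empiricalDev hsymm hν
  set N := 2 * τ - 1 with hN
  have hN2 : 2 ≤ N := by omega
  set C₃ := (θ / 2 + 2 * θ ^ (N + 1)) * (1 + C) + 2 * θ ^ (N + 1) * C + θ / 2 * (N : ℝ) ^ 2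
    with hC₃
  set c₅ := c₄ / (2 * C₂) with hc₅
  have hc₅0 : 0 < c₅ := by positivity
  -- Makes the part of the Nth moment coming from |M| > L √l at most c₅/2.
  set L := max 1 (2 * C / c₅) with hL
  have hL1 : 1 ≤ L := le_max_left _ _
  have hL0 : 0 < L := by linarith
  refine ⟨c₅ / 2 / L ^ (N - 2), by positivity, ?_⟩
  have hsmall : Tendsto (fun k : ℕ => θ / Real.sqrt k + C₃ * Real.sqrt (l k)) atTop (𝓝 0) := by
    have e1 : Tendsto (fun k : ℕ => θ / Real.sqrt k) atTop (𝓝 0) :=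
      tendsto_const_nhds.div_atTop (Real.tendsto_sqrt_atTop.comp tendsto_natCast_atTop_atTop)
    have e2 : Tendsto (fun k : ℕ => C₃ * Real.sqrt (l k)) atTop (𝓝 0) := by
      have := ((Real.continuous_sqrt.tendsto 0).comp hl0).const_mul C₃
      simpa using this
    simpa using e1.add e2
  filter_upwards [hmom, eventually_ge_atTop 1,
    hsmall.eventually (gt_mem_nhds (show 0 < c₄ / 2 by positivity))] with k hk hk1 hks n S hS
  have hS0 : 0 < S.card := by omega
  have hk0 : (0 : ℝ) < k := by exact_mod_cast hk1
  have hlk := hl k hk1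
  have hlNk := hlN k hk1
  have hm2N := hk n S hS
  have hm2 := integral_sq_magnetization_le (ν := ν) (θ := θ) (S := S) (N := N) (by omega) hlk
    (by rw [hS]; exact hlNk) (C := C) (by rw [hS]; exact hm2N)
  set w := Real.sqrt k with hw
  have hw0 : 0 < w := Real.sqrt_pos.2 hk0
  have hww : w ^ 2 = k := Real.sq_sqrt hk0.le
  set s := Real.sqrt (l k) with hs
  have hs0 : 0 < s := Real.sqrt_pos.2 hlk
  have hss : s ^ 2 = l k := Real.sq_sqrt hlk.le
  have hsw : s ^ N * w = 1 := by
    have h1 : (s ^ N * w) ^ 2 = 1 := by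
      rw [mul_pow, hww, ← pow_mul, mul_comm N 2, pow_mul, hss, hlNk]
    have h2 : 0 < s ^ N * w := by positivity
    nlinarith
  set EN := ∫ x, |magnetization S x| ^ N ∂(plantedLaw ν θ S) with hEN
  set E2 := ∫ x, magnetization S x ^ 2 ∂(plantedLaw ν θ S) with hE2
  set E2N := ∫ x, (magnetization S x ^ 2) ^ N ∂(plantedLaw ν θ S) with hE2N
  have hEN_low : c₅ ≤ w * EN := by
    -- The weight η = √l √k balances the errors: after multiplication by √k, both l/η and η/k become
    -- √l, which tends to 0.
    have hη : 0 < s * w := by positivity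
    set f : (Fin n → Bool) → ℝ := fun x => C₂ * |magnetization S x| ^ N +
      (θ / (2 * (s * w)) + 2 * θ ^ (N + 1) / (s * w)) * magnetization S x ^ 2 +
        2 * θ ^ (N + 1) * (s * w) * (magnetization S x ^ 2) ^ N with hf
    have hfint : ∫ x, f x ∂(plantedLaw ν θ S) = C₂ * EN +
        (θ / (2 * (s * w)) + 2 * θ ^ (N + 1) / (s * w)) * E2 +
          2 * θ ^ (N + 1) * (s * w) * E2N := by
      rw [hf, integral_add Integrable.of_finite Integrable.of_finite,
        integral_add Integrable.of_finite Integrable.of_finite, integral_const_mul,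
        integral_const_mul, integral_const_mul]
    have hcd := integrable_sq_coeffDev (n := n) (ν := ν) (S := S) N
    have i1 : Integrable (fun h => |empiricalDev ν S Real.tanh h|) (iidField n ν) :=
      integrable_of_continuous_of_abs_le (continuous_empiricalDev continuous_tanh).abs (2 * 1)
        fun h => by rw [abs_abs]; exact abs_empiricalDev_le abs_tanh_le_one h
    have i2 : Integrable (fun h => θ * (s * w) / 2 * coeffDev ν S N h ^ 2 + θ / S.card)
        (iidField n ν) := (hcd.const_mul _).add (integrable_const _)
    have h1 := integral_mono i1 ((integrable_gibbsMean ν θ S f).add i2)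
      fun h => abs_empiricalDev_tanh_le hθ.le hS0 hη hup h
    simp only [Pi.add_apply] at h1
    rw [integral_add (integrable_gibbsMean ν θ S f) i2, ← integral_plantedLaw, hfint,
      integral_add (hcd.const_mul _) (integrable_const _), integral_const_mul] at h1
    simp only [integral_const, probReal_univ, one_smul] at h1
    have h2 := integral_sq_coeffDev_le (n := n) (ν := ν) (S := S) N hS0
    have h3 := hdev n S hS0
    rw [hS] at h1 h2 h3
    rw [← hw] at h3
    have h4 : c₄ ≤ w * (C₂ * EN +
        (θ / (2 * (s * w)) + 2 * θ ^ (N + 1) / (s * w)) * ((1 + C) * l k) +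
          2 * θ ^ (N + 1) * (s * w) * (C / k) +
          (θ * (s * w) / 2 * ((N : ℝ) ^ 2 / k) + θ / k)) := by
      refine h3.trans (mul_le_mul_of_nonneg_left (h1.trans ?_) hw0.le)
      gcongr
    have h5 : w * (C₂ * EN +
        (θ / (2 * (s * w)) + 2 * θ ^ (N + 1) / (s * w)) * ((1 + C) * l k) +
          2 * θ ^ (N + 1) * (s * w) * (C / k) +
          (θ * (s * w) / 2 * ((N : ℝ) ^ 2 / k) + θ / k)) =
        C₂ * (w * EN) + (θ / w + C₃ * s) := by
      rw [← hww, ← hss, hC₃]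
      field_simp
      ring
    rw [h5] at h4
    rw [hc₅, div_le_iff₀ (by positivity)]
    linarith
  have hinterp : w * EN ≤ L ^ (N - 2) * (E2 / l k) + C / L ^ N := by
    have hpt : ∀ x : Fin n → Bool, w * |magnetization S x| ^ N ≤
        L ^ (N - 2) / l k * magnetization S x ^ 2 + k / L ^ N * (magnetization S x ^ 2) ^ N := by
      intro x
      have h1 := pow_le_interpolation hN2 (y := |magnetization S x| / s) (by positivity) hL0
      have e0 : w = 1 / s ^ N := by field_simp; linarith
      have e1 : (|magnetization S x| / s) ^ N = w * |magnetization S x| ^ N := by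
        rw [div_pow, e0]; ring
      have e2 : (|magnetization S x| / s) ^ 2 = magnetization S x ^ 2 / l k := by
        rw [div_pow, sq_abs, hss]
      have e3 : (k : ℝ) = 1 / l k ^ N := by field_simp; linarith
      rw [e1, e2, div_pow] at h1
      refine h1.trans (le_of_eq ?_)
      rw [e3]; field_simp
    have h1 := integral_mono (μ := plantedLaw ν θ S) Integrable.of_finite Integrable.of_finite hpt
    rw [integral_const_mul, integral_add Integrable.of_finite Integrable.of_finite,
      integral_const_mul, integral_const_mul] at h1
    have h2 : (k : ℝ) / L ^ N * E2N ≤ C / L ^ N := by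
      have := mul_le_mul_of_nonneg_left hm2N (show 0 ≤ (k : ℝ) / L ^ N by positivity)
      refine this.trans (le_of_eq ?_)
      field_simp
    have h3 : L ^ (N - 2) / l k * E2 = L ^ (N - 2) * (E2 / l k) := by ring
    linarith
  have hCL : C / L ^ N ≤ c₅ / 2 := by
    have h1 : L ≤ L ^ N := le_self_pow₀ hL1 (by omega)
    have h2 : 2 * C / c₅ ≤ L := le_max_right _ _
    rw [div_le_iff₀ hc₅0] at h2
    rw [div_le_iff₀ (by positivity)]
    nlinarith
  have hfinal : c₅ / 2 ≤ L ^ (N - 2) * (E2 / l k) := by linarith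
  rw [div_mul_eq_mul_div, div_le_iff₀ (by positivity)]
  have := mul_le_mul_of_nonneg_right hfinal hlk.le
  have e : L ^ (N - 2) * (E2 / l k) * l k = E2 * L ^ (N - 2) := by field_simp
  linarith

/-! ### Screening at high, critical and low temperature -/

theorem integral_sq_cliqueSum_eq_magnetization {ν : Measure ℝ} {θ : ℝ} {n : ℕ} {S : Finset (Fin n)} (hS : 0 < S.card) :
    ∫ x, (∑ i ∈ S, spin (x i)) ^ 2 ∂(plantedLaw ν θ S) =
      (S.card : ℝ) ^ 2 * ∫ x, magnetization S x ^ 2 ∂(plantedLaw ν θ S) := by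
  have hk : (S.card : ℝ) ≠ 0 := by exact_mod_cast hS.ne'
  rw [← integral_const_mul]
  refine integral_congr_ae (ae_of_all _ fun x => ?_)
  simp only [magnetization]
  field_simp

section assembly

variable {ν : Measure ℝ} [IsProbabilityMeasure ν] {θ : ℝ}

/-- Translates second moment bounds into correlations. The subtracted 1 is the diagonal, harmless as
soon as k E[M²] tends to infinity. -/
theorem sub_one_mul_pairCorr_eq {n : ℕ} {S : Finset (Fin n)} {i j : Fin n} (hi : i ∈ S)
    (hj : j ∈ S) (hij : i ≠ j) :
    ((S.card : ℝ) - 1) * pairCorr ν θ S i j =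
      S.card * ∫ x, magnetization S x ^ 2 ∂(plantedLaw ν θ S) - 1 := by
  have hS : 0 < S.card := Finset.card_pos.2 ⟨i, hi⟩
  have hk : (S.card : ℝ) ≠ 0 := by exact_mod_cast hS.ne'
  have h1 := integral_sq_cliqueSum ν θ hi hj hij
  rw [integral_sq_cliqueSum_eq_magnetization hS] at h1
  have h2 : (S.card : ℝ) * (((S.card : ℝ) - 1) * pairCorr ν θ S i j) =
      S.card * (S.card * ∫ x, magnetization S x ^ 2 ∂(plantedLaw ν θ S) - 1) := by
    linarith
  exact mul_left_cancel₀ hk h2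

theorem pairCorr_le_of_integral_sq_magnetization_le {n : ℕ} {S : Finset (Fin n)} {i j : Fin n}
    (hi : i ∈ S) (hj : j ∈ S) (hij : i ≠ j) {b : ℝ} (hb : 0 ≤ b)
    (h : ∫ x, magnetization S x ^ 2 ∂(plantedLaw ν θ S) ≤ b) :
    pairCorr ν θ S i j ≤ 2 * b := by
  have hk : (2 : ℝ) ≤ S.card := by exact_mod_cast Finset.one_lt_card.2 ⟨i, hi, j, hj, hij⟩
  have h1 := sub_one_mul_pairCorr_eq (ν := ν) (θ := θ) hi hj hij
  have h2 : ((S.card : ℝ) - 1) * pairCorr ν θ S i j ≤ S.card * b := by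
    have := mul_le_mul_of_nonneg_left h (show (0 : ℝ) ≤ S.card by linarith)
    linarith
  by_contra hcon
  push Not at hcon
  have h3 : ((S.card : ℝ) - 1) * (2 * b) < ((S.card : ℝ) - 1) * pairCorr ν θ S i j :=
    mul_lt_mul_of_pos_left hcon (by linarith)
  nlinarith

theorem signalAtLeast_of_pairCorr {a : ℕ → ℝ} {μ : ℝ}
    (h : ∀ᶠ k : ℕ in atTop, ∀ (n : ℕ) (S : Finset (Fin n)), S.card = k →
      ∀ i ∈ S, ∀ j ∈ S, i ≠ j → μ ≤ ((k : ℝ) - 1) * pairCorr ν θ S i j / a k) :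
    SignalAtLeast ν θ a μ := by
  filter_upwards [h, eventually_ge_atTop 2] with k hk hk2 n S hS i hi
  obtain ⟨j, hj, hij⟩ := Finset.exists_mem_ne (show 1 < S.card by omega) i
  rw [integral_coordScore_clique ν θ (a k) hi hj hij.symm hi, hS]
  exact hk n S hS i hi j hj hij.symm

theorem screeningGuarantee_of_pairCorr (hsymm : ν.map (fun h : ℝ => -h) = ν) {a r : ℕ → ℝ}
    (ha : ∀ k, 1 ≤ k → 1 ≤ a k) (hr : ∀ k, 1 ≤ k → 1 ≤ r k)
    (har : ∀ k, 1 ≤ k → a k * r k = k) {K : ℝ} (hK : 0 ≤ K)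
    (hup : ∀ᶠ k : ℕ in atTop, ∀ (n : ℕ) (S : Finset (Fin n)), S.card = k →
      ∀ i ∈ S, ∀ j ∈ S, i ≠ j → pairCorr ν θ S i j ≤ K * a k / k) {μ : ℝ} (hμ : 0 < μ)
    (hlow : ∀ᶠ k : ℕ in atTop, ∀ (n : ℕ) (S : Finset (Fin n)), S.card = k →
      ∀ i ∈ S, ∀ j ∈ S, i ≠ j → μ ≤ ((k : ℝ) - 1) * pairCorr ν θ S i j / a k) :
    ScreeningGuarantee ν θ a r :=
  ⟨⟨μ, hμ, signalAtLeast_of_pairCorr hlow⟩, fun _ _ hs ht htμ =>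
    exists_screeningExact hsymm ha hr har hK hup hs ht htμ⟩

/-- The upper bound on the correlations when zero is the unique minimum of the potential. -/
theorem exists_pairCorr_le (hint : Integrable (fun h : ℝ => h) ν) (hθ : 0 < θ)
    (hmin : ZeroIsUniqueMinimum ν θ) {τ : ℕ} (hτ1 : 1 ≤ τ) (hτ : HasFlatness ν θ τ) {l : ℕ → ℝ}
    (hl : ∀ k, 1 ≤ k → 0 < l k) (hlN : ∀ k, 1 ≤ k → l k ^ (2 * τ - 1) * k = 1) :
    ∃ K : ℝ, 0 ≤ K ∧ ∀ᶠ k : ℕ in atTop, ∀ (n : ℕ) (S : Finset (Fin n)), S.card = k →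
      ∀ i ∈ S, ∀ j ∈ S, i ≠ j → pairCorr ν θ S i j ≤ K * l k := by
  obtain ⟨C, hC, hmom⟩ := exists_integral_magnetization_pow_le hint hθ hmin hτ
  refine ⟨2 * (1 + C), by positivity, ?_⟩
  filter_upwards [hmom, eventually_ge_atTop 1] with k hk hk1 n S hS i hi j hj hij
  have hlk := hl k hk1
  have h1 := integral_sq_magnetization_le (ν := ν) (θ := θ) (S := S) (N := 2 * τ - 1) (by omega)
    hlk (by rw [hS]; exact hlN k hk1) (C := C) (by rw [hS]; exact hk n S hS)
  rw [mul_assoc]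
  exact pairCorr_le_of_integral_sq_magnetization_le hi hj hij (by positivity) h1

theorem meanSechSq_pos : 0 < meanSechSq ν := by
  have hc : Continuous fun s => 1 / Real.cosh s ^ 2 :=
    continuous_const.div (by fun_prop) fun s => by have := Real.cosh_pos s; positivity
  have hi : Integrable (fun s => 1 / Real.cosh s ^ 2) ν :=
    integrable_of_continuous_real hc (B := 1) fun s => by
      rw [← one_sub_tanh_sq]; exact abs_one_sub_tanh_sq_le s
  have hpos : ∀ s, 0 < 1 / Real.cosh s ^ 2 := fun s => by
    have := Real.cosh_pos s; positivity
  unfold meanSechSq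
  rw [integral_pos_iff_support_of_nonneg (fun s => (hpos s).le) hi]
  have : Function.support (fun s => 1 / Real.cosh s ^ 2) = Set.univ :=
    Set.eq_univ_of_forall fun s => (hpos s).ne'
  rw [this, measure_univ]
  exact one_pos

/-- Here k E[M²] is only known to be bounded, so the diagonal could hide the signal; the lower bound
therefore comes from the cavity estimate `le_pairCorr`. -/
theorem HighTemperature.screeningGuarantee (hint : Integrable (fun h : ℝ => h) ν)
    (hsymm : ν.map (fun h : ℝ => -h) = ν) (hθ : 0 < θ) (hhigh : HighTemperature ν θ) :
    ScreeningGuarantee ν θ (fun _ => 1) (fun k => (k : ℝ)) := by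
  obtain ⟨hlt, hmin⟩ := hhigh
  have hv : 0 < meanSechSq ν := meanSechSq_pos
  obtain ⟨K, hK, hup⟩ := exists_pairCorr_le hint hθ hmin le_rfl (hasFlatness_one hint hsymm hθ hlt)
    (l := fun k => 1 / (k : ℝ))
    (fun k hk => by have : (0 : ℝ) < k := by exact_mod_cast hk
                    positivity)
    (fun k hk => by have : (0 : ℝ) < k := by exact_mod_cast hk
                    simp; field_simp)
  refine screeningGuarantee_of_pairCorr hsymm (fun _ _ => le_rfl)
    (fun k hk => by exact_mod_cast hk) (fun k _ => one_mul _) hK ?_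
    -- The factor 1/2 accounts for (k - 1)/k ≥ 1/2.
    (μ := θ * Real.exp (-(4 * θ)) * meanSechSq ν / 2) (by positivity) ?_
  · filter_upwards [hup] with k hk n S hS i hi j hj hij
    refine (hk n S hS i hi j hj hij).trans (le_of_eq ?_)
    ring
  · filter_upwards [eventually_ge_atTop 2] with k hk2 n S hS i hi j hj hij
    have h1 := le_pairCorr (ν := ν) hsymm hθ.le hi hj hij
    rw [hS] at h1
    have hk : (2 : ℝ) ≤ k := by exact_mod_cast hk2
    rw [div_one]
    refine le_trans ?_ (mul_le_mul_of_nonneg_left h1 (by linarith))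
    have e : ((k : ℝ) - 1) * (θ / k * Real.exp (-(4 * θ)) * meanSechSq ν) =
        θ * Real.exp (-(4 * θ)) * meanSechSq ν * (((k : ℝ) - 1) / k) := by ring
    rw [e, div_eq_mul_inv]
    refine mul_le_mul_of_nonneg_left ?_ (by positivity)
    rw [le_div_iff₀ (by linarith)]
    linarith

theorem CriticalTemperature.screeningGuarantee (hint : Integrable (fun h : ℝ => h) ν)
    (hsymm : ν.map (fun h : ℝ => -h) = ν) (hθ : 0 < θ) {τ : ℕ}
    (hcrit : CriticalTemperature ν θ τ) (hν : ν ≠ Measure.dirac 0) :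
    ScreeningGuarantee ν θ
      (fun k => (k : ℝ) ^ ((2 * (τ : ℝ) - 2) / (2 * (τ : ℝ) - 1)))
      (fun k => (k : ℝ) ^ (1 / (2 * (τ : ℝ) - 1))) := by
  have hτ2 := hcrit.two_le hint hθ
  have hτ := hcrit.hasFlatness hint hθ
  have hmin := hcrit.2.1
  have hτR : (2 : ℝ) ≤ τ := by exact_mod_cast hτ2
  have hNR : ((2 * τ - 1 : ℕ) : ℝ) = 2 * (τ : ℝ) - 1 := by
    rw [Nat.cast_sub (by omega)]; simp
  have hden : 0 < 2 * (τ : ℝ) - 1 := by linarith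
  set α := (2 * (τ : ℝ) - 2) / (2 * (τ : ℝ) - 1) with hα
  set β := 1 / (2 * (τ : ℝ) - 1) with hβ
  have hα0 : 0 < α := div_pos (by linarith) hden
  have hβ0 : 0 < β := div_pos one_pos hden
  have hαβ : α + β = 1 := by rw [hα, hβ]; field_simp; ring
  have hpos : ∀ k : ℕ, 1 ≤ k → (0 : ℝ) < k := fun k hk => by exact_mod_cast hk
  have har : ∀ k : ℕ, 1 ≤ k → (k : ℝ) ^ α * (k : ℝ) ^ β = k := fun k hk => by
    rw [← Real.rpow_add (hpos k hk), hαβ, Real.rpow_one]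
  set l : ℕ → ℝ := fun k => 1 / (k : ℝ) ^ β with hl
  have hl0 : ∀ k, 1 ≤ k → 0 < l k := fun k hk => by
    have := Real.rpow_pos_of_pos (hpos k hk) β
    positivity
  have hlN : ∀ k, 1 ≤ k → l k ^ (2 * τ - 1) * k = 1 := fun k hk => by
    have h1 : ((k : ℝ) ^ β) ^ (2 * τ - 1) = k := by
      rw [← Real.rpow_natCast, ← Real.rpow_mul (hpos k hk).le, hNR, hβ,
        one_div_mul_cancel hden.ne', Real.rpow_one]
    rw [hl]
    simp only [div_pow, one_pow, h1]
    exact one_div_mul_cancel (hpos k hk).ne'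
  have hla : ∀ k, 1 ≤ k → l k = (k : ℝ) ^ α / k := fun k hk => by
    have h1 := Real.rpow_pos_of_pos (hpos k hk) β
    have h2 := hpos k hk
    rw [hl, div_eq_div_iff h1.ne' h2.ne', har k hk, one_mul]
  have hlim : Tendsto l atTop (𝓝 0) :=
    tendsto_const_nhds.div_atTop ((tendsto_rpow_atTop hβ0).comp tendsto_natCast_atTop_atTop)
  obtain ⟨K, hK, hup⟩ := exists_pairCorr_le hint hθ hmin (by omega) hτ hl0 hlN
  obtain ⟨c, hc, hlow⟩ := exists_le_integral_sq_magnetization hint hsymm hθ hmin hν hτ2 hτ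
    hl0 hlN hlim
  refine screeningGuarantee_of_pairCorr hsymm
    (fun k hk => Real.one_le_rpow (by exact_mod_cast hk) hα0.le)
    (fun k hk => Real.one_le_rpow (by exact_mod_cast hk) hβ0.le) har hK ?_
    (μ := c / 2) (by positivity) ?_
  · filter_upwards [hup, eventually_ge_atTop 1] with k hk hk1 n S hS i hi j hj hij
    refine (hk n S hS i hi j hj hij).trans (le_of_eq ?_)
    rw [hla k hk1, mul_div_assoc]
  · have hainf : Tendsto (fun k : ℕ => (k : ℝ) ^ α) atTop atTop :=
      (tendsto_rpow_atTop hα0).comp tendsto_natCast_atTop_atTop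
    -- Once a ≥ 2/c, the diagonal 1 is at most half of c a; this uses that a tends to infinity, that
    -- is τ ≥ 2.
    filter_upwards [hlow, eventually_ge_atTop 1, hainf.eventually_ge_atTop (2 / c)]
      with k hk hk1 hka n S hS i hi j hj hij
    have ha0 : 0 < (k : ℝ) ^ α := Real.rpow_pos_of_pos (hpos k hk1) α
    have h1 := sub_one_mul_pairCorr_eq (ν := ν) (θ := θ) hi hj hij
    rw [hS] at h1
    rw [h1, le_div_iff₀ ha0]
    have h2 := mul_le_mul_of_nonneg_left (hk n S hS) (hpos k hk1).le
    have h3 : (k : ℝ) * (c * l k) = c * (k : ℝ) ^ α := by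
      have := (hpos k hk1).ne'
      rw [hla k hk1]; field_simp
    rw [div_le_iff₀ hc] at hka
    linarith

/-- If H''(0) < 0 then 0 is a local maximum. Were it also a global minimum, H would be constant near
0, contradicting H''(0) ≠ 0. -/
theorem LowTemperature.exists_potential_lt (hint : Integrable (fun h : ℝ => h) ν)
    (hsymm : ν.map (fun h : ℝ => -h) = ν) (hθ : 0 < θ) (hlow : LowTemperature ν θ) :
    ∃ x, potential ν θ x < potential ν θ 0 := by
  rcases hlow with h | ⟨-, h⟩
  · by_contra hcon
    push Not at hcon
    have hdd := (hasDerivAt_deriv_potential_zero (ν := ν) hint hθ.le).deriv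
    have hmax : IsLocalMax (potential ν θ) 0 :=
      isLocalMax_of_deriv_deriv_neg (by rw [hdd]; linarith) (deriv_potential_zero hint hsymm θ)
        (hasDerivAt_potential hint θ 0).continuousAt
    have hconst : potential ν θ =ᶠ[𝓝 0] fun _ => potential ν θ 0 := by
      filter_upwards [hmax] with x hx using le_antisymm hx (hcon x)
    have h1 := hconst.deriv.deriv_eq
    rw [hdd] at h1
    simp at h1
    linarith
  · exact h

theorem LowTemperature.screeningGuarantee (hint : Integrable (fun h : ℝ => h) ν)
    (hsymm : ν.map (fun h : ℝ => -h) = ν) (hθ : 0 < θ) (hlow : LowTemperature ν θ) :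
    ScreeningGuarantee ν θ (fun k => (k : ℝ)) (fun _ => 1) := by
  obtain ⟨x, hx⟩ := hlow.exists_potential_lt hint hsymm hθ
  set g := potential ν θ 0 - potential ν θ x with hg
  have hg0 : 0 < g := sub_pos.2 hx
  refine screeningGuarantee_of_pairCorr hsymm (fun k hk => by exact_mod_cast hk)
    (fun _ _ => le_rfl) (fun k _ => mul_one _) zero_le_one ?_ (μ := g / θ) (by positivity) ?_
  · filter_upwards [eventually_ge_atTop 1] with k hk n S hS i hi j hj hij
    have hk0 : (k : ℝ) ≠ 0 := by exact_mod_cast (show k ≠ 0 by omega)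
    rw [one_mul, div_self hk0]
    exact (abs_le.1 (abs_pairCorr_le_one ν θ S i j)).2
  · filter_upwards [eventually_ge_atTop 1,
      -- From k ≥ θ/g on, the diagonal term 1/k is at most g/θ, half of the lower bound 2g/θ for
      -- E[M²].
      tendsto_natCast_atTop_atTop.eventually_ge_atTop (θ / g)] with k hk hkg n S hS i hi j hj hij
    have hk0 : (0 : ℝ) < k := by exact_mod_cast hk
    have hS0 : 0 < S.card := by omega
    have h1 := sub_one_mul_pairCorr_eq (ν := ν) (θ := θ) hi hj hij
    have h2 := le_integral_sq_cliqueSum (ν := ν) hint hθ.le hS0 x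
    rw [integral_sq_cliqueSum_eq_magnetization hS0] at h2
    rw [hS] at h1 h2
    rw [h1]
    rw [← hg] at h2
    set E := ∫ y, magnetization S y ^ 2 ∂(plantedLaw ν θ S)
    have h3 : 2 * g / θ ≤ E := by
      rw [div_le_iff₀ hθ]
      have e : θ / (2 * k) * ((k : ℝ) ^ 2 * E) = k * (θ * E / 2) := by field_simp
      rw [e] at h2
      have := le_of_mul_le_mul_left h2 hk0
      linarith
    rw [le_div_iff₀ hk0]
    rw [div_le_iff₀ hg0] at hkg
    have h4 : 1 ≤ g / θ * k := by
      rw [div_mul_eq_mul_div, le_div_iff₀ hθ]; linarith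
    have h5 := mul_le_mul_of_nonneg_left h3 hk0.le
    have h6 : (k : ℝ) * (2 * g / θ) = 2 * (g / θ * k) := by ring
    linarith

end assembly

theorem mainTheorem10 (ν : Measure ℝ) [IsProbabilityMeasure ν]
    (hint : Integrable (fun h : ℝ => h) ν) (hsymm : ν.map (fun h : ℝ => -h) = ν)
    (θ : ℝ) (hθ : 0 < θ) :
    (HighTemperature ν θ →
      ScreeningGuarantee ν θ (fun _ => 1) (fun k => (k : ℝ))) ∧
    (∀ τ : ℕ, CriticalTemperature ν θ τ → ν ≠ Measure.dirac 0 →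
      ScreeningGuarantee ν θ
        (fun k => (k : ℝ) ^ ((2 * (τ : ℝ) - 2) / (2 * (τ : ℝ) - 1)))
        (fun k => (k : ℝ) ^ (1 / (2 * (τ : ℝ) - 1)))) ∧
    (LowTemperature ν θ →
      ScreeningGuarantee ν θ (fun k => (k : ℝ)) (fun _ => 1)) :=
  ⟨fun h => h.screeningGuarantee hint hsymm hθ,
    fun _ h hν => h.screeningGuarantee hint hsymm hθ hν,
    fun h => h.screeningGuarantee hint hsymm hθ⟩
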